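/- Let $p$ be an odd prime, $m\ge 1$, $a=\gcd(p+1,4)$, and let $\mathbb F_{p^m}$ be a field with $p^m$ elements with a fixed $\mathbb F_p$-basis, by which it is identified with $\mathbb F_p^m$. Let $V=\mathbb C[\mathbb F_p^m]=(\mathbb C^p)^{\otimes m}$ with orthonormal basis $v_x$ ($x\in\mathbb F_p^m$), and let $E_p(m)=E_p(1)^{\otimes m}\le U(p^m,\mathbb C)$ be the group generated by the operators $v_x\mapsto v_{x+e_j}$ and $v_x\mapsto \exp(2\pi \mathrm{i}\, x_j/p)\,v_x$ for $1\le j\le m$, where $e_1,\dots,e_m$ is the standard basis of $\mathbb F_p^m$. The Clifford group $\mathcal C^{(p)}_m$ is the group generated by the elements of finite order in the normalizer of $E_p(m)$ in $U(p^m,\mathbb Q[\zeta_{ap}])$, where $\zeta_{ap}=\exp(2\pi\mathrm{i}/(ap))$. A matrix $g$ acts on $\mathbb C[x_f\mid f\in\mathbb F_{p^m}]$ by the algebra endomorphism $x_f\mapsto\sum_{f'}g_{f',f}\,x_{f'}$. A code $C$ over $\mathbb F_p$ of length $N$ is a subspace of $\mathbb F_p^N$; $C^\perp$ is its dual for $\sum_i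 c_iw_i$; $C$ is self-orthogonal if $C\subseteq C^\perp$ and self-dual if $C=C^\perp$; $\mathbf 1$ is the all-ones vector. Put $C(m)=C\otimes_{\mathbb F_p}\mathbb F_{p^m}\subseteq\mathbb F_{p^m}^N$ and $$\mathrm{cwe}(C(m))=\sum_{c\in C(m)}\ \prod_{f\in\mathbb F_{p^m}}x_f^{a_f(c)},$$ where $a_f(c)$ is the number of coordinates of $c$ equal to $f$. Then: (i) The group $\mathcal C^{(p)}_m$ is finite, and $\mathcal C^{(p)}_m\cong Z_a\times p^{1+2m}_+.Sp(2m,p)$. That is, $E_p(m)$ is an extraspecial group $p^{1+2m}_+$ (of order $p^{1+2m}$ and exponent $p$, with centre of order $p$ equal to the commutator subgroup), and there is a subgroup $H$ with $E_p(m)\trianglelefteq H\le\mathcal C^{(p)}_m$, $H/E_p(m)\cong Sp(2m,p)$ and $\mathcal C^{(p)}_m\cong Z_a\times H$, where $Z_a$ is cyclic of order $a$. (ii) For every $N\ge 0$ the space of homogeneous polynomials of degree $N$ in $\mathbb C[x_f\mid f\in\mathbb F_{p^m}]$ invariant under $\mathcal C^{(p)}_m$ is spanned by the polynomials $\mathrm{cwe}(C(m))$,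 where $C$ ranges over all self-dual codes over $\mathbb F_p$ of length $N$ containing $\mathbf 1$. (iii) For every self-orthogonal code $C$ over $\mathbb F_p$ of length $N$ containing $\mathbf 1$ and of dimension $N/2-r$, with $r\ge 0$ an integer, $$\frac1{|\mathcal C^{(p)}_m|}\sum_{g\in\mathcal C^{(p)}_m}g\cdot\mathrm{cwe}(C(m))=\prod_{0\le i<r}(p^m+p^i)^{-1}\sum_{C'}\mathrm{cwe}(C'(m)),$$ where $C'$ ranges over all self-dual codes containing $C$. For every self-orthogonal code $C$ containing $\mathbf 1$, of any length and dimension, the left-hand side is $0$ if no self-dual code contains $C$. -/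

import Mathlib

noncomputable section

namespace CliffordCode

/-! ### The extraspecial group and the Clifford group

The space `ℂ^(p^m) = (ℂ^p)^{⊗ m}` has the basis `v_x`, `x ∈ (ℤ/p)^m`; a matrix `g` indexed by
`Fin m → ZMod p` acts by `v_x ↦ ∑ y, g y x • v_y`. -/

/-- The operator `X` in the `i`-th tensor factor and the identity in all others:
`v_x ↦ v_{x + e_i}`. -/
def shiftMatrix (p m : ℕ) (i : Fin m) : Matrix (Fin m → ZMod p) (Fin m → ZMod p) ℂ :=
  Matrix.of fun y x => if y = x + Pi.single i 1 then 1 else 0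

/-- The operator `Z` in the `i`-th tensor factor and the identity in all others:
`v_x ↦ exp (2πi x_i / p) v_x`. -/
def clockMatrix (p m : ℕ) [NeZero p] (i : Fin m) :
    Matrix (Fin m → ZMod p) (Fin m → ZMod p) ℂ :=
  Matrix.diagonal fun x => ZMod.stdAddChar (x i)

theorem shiftMatrix_mem (p m : ℕ) [NeZero p] (i : Fin m) :
    shiftMatrix p m i ∈ Matrix.unitaryGroup (Fin m → ZMod p) ℂ := by
  rw [Matrix.mem_unitaryGroup_iff']
  ext x y
  simp only [Matrix.star_eq_conjTranspose, Matrix.mul_apply, Matrix.conjTranspose_apply,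
    shiftMatrix, Matrix.of_apply, Matrix.one_apply]
  rw [Finset.sum_eq_single (x + Pi.single i 1)]
  · simp
  · intro z _ hz
    simp [hz]
  · simp

theorem clockMatrix_mem (p m : ℕ) [NeZero p] (i : Fin m) :
    clockMatrix p m i ∈ Matrix.unitaryGroup (Fin m → ZMod p) ℂ := by
  rw [Matrix.mem_unitaryGroup_iff']
  rw [Matrix.star_eq_conjTranspose, clockMatrix, Matrix.diagonal_conjTranspose,
    Matrix.diagonal_mul_diagonal, ← Matrix.diagonal_one]
  congr 1
  ext x
  simp only [Pi.star_apply, ZMod.stdAddChar_apply, Complex.star_def]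
  rw [← Complex.normSq_eq_conj_mul_self, Circle.normSq_coe, Complex.ofReal_one]

/-- The group `E_p(m) = E_p(1)^{⊗ m}`, generated by the operators `X` and `Z` in the single tensor
factors, as a subgroup of `U(p^m, ℂ)`. -/
def extraspecialGroup (p m : ℕ) [NeZero p] :
    Subgroup (Matrix.unitaryGroup (Fin m → ZMod p) ℂ) :=
  Subgroup.closure
    (Set.range (fun i => (⟨shiftMatrix p m i, shiftMatrix_mem p m i⟩ :
        Matrix.unitaryGroup (Fin m → ZMod p) ℂ)) ∪
      Set.range (fun i => (⟨clockMatrix p m i, clockMatrix_mem p m i⟩ :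
        Matrix.unitaryGroup (Fin m → ZMod p) ℂ)))

/-- The number `a = gcd (p + 1, 4)`. -/
def clifA (p : ℕ) : ℕ := Nat.gcd (p + 1) 4

/-- The cyclotomic field `ℚ[ζ_{ap}]` inside `ℂ`. -/
def clifField (p : ℕ) : IntermediateField ℚ ℂ :=
  IntermediateField.adjoin ℚ {Complex.exp (2 * Real.pi * Complex.I / ((clifA p * p : ℕ) : ℂ))}

/-- The Clifford group `C^{(p)}_m`: the group generated by the elements of finite order of the
normalizer of `E_p(m)` in `U(p^m, ℚ[ζ_{ap}])`. (The normalizer itself also contains the infinitely many scalars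
of absolute value one of the field.) -/
def cliffordGroup (p m : ℕ) [NeZero p] : Subgroup (Matrix.unitaryGroup (Fin m → ZMod p) ℂ) :=
  Subgroup.closure
    {g | (∀ x y, (g : Matrix (Fin m → ZMod p) (Fin m → ZMod p) ℂ) x y ∈ clifField p) ∧
      g ∈ Subgroup.normalizer (extraspecialGroup p m : Set (Matrix.unitaryGroup _ ℂ)) ∧
      IsOfFinOrder g}

/-- `G` is an extraspecial group `p^{1+2m}_+`, for odd `p`: of order `p^{1+2m}` and exponent `p`,
with the centre of order `p` and equal to the commutator subgroup. -/
def IsExtraspecialPlus (p m : ℕ) (G : Type*) [Group G] : Prop :=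
  Nat.card G = p ^ (1 + 2 * m) ∧ Monoid.exponent G = p ∧
    Nat.card (Subgroup.center G) = p ∧ commutator G = Subgroup.center G

/-! ### Codes and complete weight enumerators -/

/-- The dual code with respect to `∑ i, c i * w i`. -/
def dualCode {p N : ℕ} (C : Submodule (ZMod p) (Fin N → ZMod p)) :
    Submodule (ZMod p) (Fin N → ZMod p) where
  carrier := {w | ∀ c ∈ C, c ⬝ᵥ w = 0}
  zero_mem' := fun c _ => dotProduct_zero c
  add_mem' := fun {v w} hv hw c hc => by rw [dotProduct_add, hv c hc, hw c hc, add_zero]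
  smul_mem' := fun t w hw c hc => by rw [dotProduct_smul, hw c hc, smul_zero]

/-- `C ⊆ C^⊥`. -/
def IsSelfOrthogonal {p N : ℕ} (C : Submodule (ZMod p) (Fin N → ZMod p)) : Prop :=
  C ≤ dualCode C

/-- `C = C^⊥`. -/
def IsSelfDual {p N : ℕ} (C : Submodule (ZMod p) (Fin N → ZMod p)) : Prop :=
  C = dualCode C

/-- The code `C ⊗ F` in `F^N`: the `F`-span of the words of `C`. -/
def extendCode {p N : ℕ} (F : Type*) [Field F] [Algebra (ZMod p) F]
    (C : Submodule (ZMod p) (Fin N → ZMod p)) : Submodule F (Fin N → F) :=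
  Submodule.span F ((fun (c : Fin N → ZMod p) (i : Fin N) => algebraMap (ZMod p) F (c i)) '' C)

open Classical in
/-- The complete weight enumerator `∑_{c ∈ D} ∏_{f ∈ F} x_f ^ {a_f(c)}`, where `a_f(c)` is the
number of coordinates of `c` that are equal to `f`. -/
def cwe {F : Type*} [Field F] [Fintype F] {N : ℕ} (D : Submodule F (Fin N → F)) :
    MvPolynomial F ℂ :=
  ∑ c ∈ Finset.univ.filter (fun c : Fin N → F => c ∈ D),
    ∏ f : F, (MvPolynomial.X f : MvPolynomial F ℂ) ^ (Finset.univ.filter fun i => c i = f).card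

/-- The action of a matrix on polynomials in the variables `x_f`, `f ∈ F`, where `F` is identified
with `(ℤ/p)^m` by the basis `b`: the algebra endomorphism with `x_f ↦ ∑ f', g_{f', f} x_{f'}`. -/
def polyAct {p m : ℕ} {F : Type*} [Field F] [Fintype F] [Algebra (ZMod p) F]
    (b : Module.Basis (Fin m) (ZMod p) F)
    (g : Matrix (Fin m → ZMod p) (Fin m → ZMod p) ℂ) :
    MvPolynomial F ℂ →ₐ[ℂ] MvPolynomial F ℂ :=
  MvPolynomial.aeval fun f => ∑ f' : F, g (b.equivFun f') (b.equivFun f) • MvPolynomial.X f'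

/-- The space of homogeneous invariants of degree `N` of the Clifford group. -/
def invariants {p m : ℕ} [NeZero p] {F : Type*} [Field F] [Fintype F] [Algebra (ZMod p) F]
    (b : Module.Basis (Fin m) (ZMod p) F) (N : ℕ) : Submodule ℂ (MvPolynomial F ℂ) where
  carrier := {q | q.IsHomogeneous N ∧ ∀ g ∈ cliffordGroup p m, polyAct b g q = q}
  zero_mem' := ⟨MvPolynomial.isHomogeneous_zero F ℂ N, fun _ _ => map_zero _⟩
  add_mem' := fun {q r} hq hr =>
    ⟨hq.1.add hr.1, fun g hg => by rw [map_add, hq.2 g hg, hr.2 g hg]⟩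
  smul_mem' := fun t q hq =>
    ⟨(MvPolynomial.homogeneousSubmodule F ℂ N).smul_mem t hq.1,
      fun g hg => by rw [map_smul, hq.2 g hg]⟩

/-- The average `|G|⁻¹ ∑_{g ∈ G} g · q` over the Clifford group `G`. -/
def average {p m : ℕ} [NeZero p] {F : Type*} [Field F] [Fintype F] [Algebra (ZMod p) F]
    (b : Module.Basis (Fin m) (ZMod p) F) (q : MvPolynomial F ℂ) : MvPolynomial F ℂ :=
  (Nat.card (cliffordGroup p m) : ℂ)⁻¹ •
    ∑ᶠ g : cliffordGroup p m,
      polyAct b ((g : Matrix.unitaryGroup (Fin m → ZMod p) ℂ) :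
        Matrix (Fin m → ZMod p) (Fin m → ZMod p) ℂ) q

end CliffordCode

end

noncomputable section

namespace CliffordCode

open Matrix

-- Group structure. Up to scalars `ψ s`, the group $E_p(m)$ consists of the Weyl operators $W(u)$,
-- $u\in\mathbb F_p^{2m}$, with $W(u)W(w)=\psi(\omega(u,w)/2)W(u+w)$ (`weyl_mul`). Conjugation by an
-- element of the normalizer therefore induces a symplectic map of $\mathbb F_p^{2m}$
-- (`exists_implements`). By irreducibility, an element inducing the identity is a scalar times a
-- Weyl operator. Conversely, giving the $\psi(j)$-eigenspace of $W(u)$ the eigenvalue $\psi(cj^2)$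
-- defines an operator of order $p$ over the cyclotomic field that induces a transvection, and
-- transvections generate the symplectic group (`isometry_induction`). The only scalars left are the
-- $ap$-th roots of unity of the field. The condition $\det^p=1$ cuts out a complement $H$ to those
-- of order dividing $a$, because $a$ is prime to $p$.
--
-- Invariants. Polynomials of degree $N$ are images of tensors in $V^{\otimes N}$, and
-- $\mathrm{cwe}(C(m))$ is the image of the indicator $v_C$ of the words all of whose $m$ coordinate
-- rows lie in $C$. For self-orthogonal $C$ and $c\in C$, the operator $\bigotimes_i W(c_iu)$ fixes
-- $v_C$. Hence only the joint eigenspaces labelled by $j\in C^\perp$ meet $v_C$, and there a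
-- transvection operator acts by $\psi(c\,j\cdot j)$. This is $1$ if $C=C^\perp$, so $v_C$ is
-- invariant once $\mathbf 1\in C$ and $ap\mid N$. Evaluating a quadratic Gauss sum in two ways
-- shows that $a$ divides the length of a self-dual code.
--
-- Averaging formula. Let $A(C)$ be the average of $v_C$. Averaging further over the transvections
-- along the translations $(a,0)$, $a\ne0$, expresses $A(C)$ through $A(C)$ itself and the
-- $A(C+\langle k\rangle)$ with $k\in C^\perp$ isotropic (`tensorAverage_codeVector_recursion`). The
-- coefficients are Fourier coefficients of the set of isotropic vectors of $C^\perp$, computed by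
-- Gauss sums. Induction on the codimension $r$ solves the recursion and produces the factors
-- $p^m+p^i$ (`tensorAverage_codeVector_of_dvd`).
--
-- Spanning. The average of a basis tensor $v_x$ depends only on the code generated by the rows of
-- $x$ and $\mathbf 1$, and vanishes unless that code is self-orthogonal. So $A(C)$ is a positive
-- multiple of the average of $v_x$, with $C$ the code of $x$, plus terms from smaller codes. By
-- induction on dimension the averaging formula puts every average into the span of the self-dual
-- code vectors (`tensorAverage_single_mem`), and every invariant is its own average.

local notation "ψ" => (ZMod.stdAddChar : AddChar (ZMod _) ℂ)

/-- The phase space `𝔽_p^{2m}`. -/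
abbrev Phase (p m : ℕ) : Type := Fin m ⊕ Fin m → ZMod p

/-- The symplectic form on the phase space. -/
def sympForm (p m : ℕ) : LinearMap.BilinForm (ZMod p) (Phase p m) :=
  Matrix.toLinearMap₂' (ZMod p) (Matrix.J (Fin m) (ZMod p))

/-! ### Weyl operators: product rule, adjoints and irreducibility. -/

section Weyl

variable {p m : ℕ}

theorem two_ne_zero_zmod [Fact p.Prime] (hp : p ≠ 2) : (2 : ZMod p) ≠ 0 := by
  intro h
  have : ((2 : ℕ) : ZMod p) = 0 := by exact_mod_cast h
  rw [ZMod.natCast_eq_zero_iff] at this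
  exact hp ((Nat.prime_dvd_prime_iff_eq Fact.out Nat.prime_two).1 this)

theorem sympForm_apply (u w : Phase p m) :
    sympForm p m u w = (u ∘ Sum.inr) ⬝ᵥ (w ∘ Sum.inl) - (u ∘ Sum.inl) ⬝ᵥ (w ∘ Sum.inr) := by
  rw [sympForm, Matrix.toLinearMap₂'_apply']
  rw [Matrix.J, Matrix.fromBlocks_mulVec, dotProduct, Fintype.sum_sum_type]
  simp [dotProduct, neg_mulVec]
  ring

theorem sympForm_eq_dotProduct (u w : Phase p m) :
    sympForm p m u w = u ⬝ᵥ (Matrix.J (Fin m) (ZMod p) *ᵥ w) :=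
  Matrix.toLinearMap₂'_apply' _ _ _

theorem sympForm_self (u : Phase p m) : sympForm p m u u = 0 := by
  rw [sympForm_apply, dotProduct_comm, sub_self]

theorem sympForm_swap (u w : Phase p m) : sympForm p m u w = - sympForm p m w u := by
  rw [sympForm_apply, sympForm_apply, dotProduct_comm (u ∘ Sum.inr),
    dotProduct_comm (u ∘ Sum.inl)]
  ring

/-- Every linear functional on the phase space is a value of the symplectic form. -/
theorem exists_sympForm_eq (l : Phase p m) : ∃ w, ∀ u, sympForm p m w u = l ⬝ᵥ u := by
  refine ⟨Sum.elim (fun i => - l (Sum.inr i)) (fun i => l (Sum.inl i)), fun u => ?_⟩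
  rw [sympForm_apply]
  simp [dotProduct, Fintype.sum_sum_type]

theorem eq_zero_of_sympForm {u : Phase p m} (h : ∀ w, sympForm p m u w = 0) : u = 0 := by
  ext i
  rcases i with i | i
  · have := h (Sum.elim 0 (Pi.single i 1))
    rw [sympForm_apply, Sum.elim_comp_inl, Sum.elim_comp_inr] at this
    simpa using this
  · have := h (Sum.elim (Pi.single i 1) 0)
    rw [sympForm_apply, Sum.elim_comp_inl, Sum.elim_comp_inr] at this
    simpa using this

variable [Fact p.Prime]

theorem star_psi (s : ZMod p) : star (ψ s) = ψ (-s) := by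
  rw [AddChar.map_neg_eq_inv]
  refine eq_inv_of_mul_eq_one_left ?_
  simp only [ZMod.stdAddChar_apply, Complex.star_def]
  rw [← Complex.normSq_eq_conj_mul_self, Circle.normSq_coe, Complex.ofReal_one]

theorem psi_ne_zero (s : ZMod p) : ψ s ≠ 0 := (AddChar.val_isUnit _ _).ne_zero

theorem sum_psi_mul (b : ZMod p) : ∑ x : ZMod p, ψ (x * b) = if b = 0 then (p : ℂ) else 0 := by
  rw [AddChar.sum_mulShift b (ZMod.isPrimitive_stdAddChar p), ZMod.card]
  split_ifs <;> simp

theorem psi_pow_prime (s : ZMod p) : ψ s ^ p = 1 := by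
  rw [← AddChar.map_nsmul_eq_pow]
  simp

/-- The Weyl operator `v_x ↦ ψ(b·x + a·b/2) v_{x+a}` of the phase space point `(a, b)`. -/
def weyl (u : Phase p m) : Matrix (Fin m → ZMod p) (Fin m → ZMod p) ℂ :=
  Matrix.of fun y x => if y = x + u ∘ Sum.inl then
    ψ ((u ∘ Sum.inr) ⬝ᵥ x + 2⁻¹ * ((u ∘ Sum.inl) ⬝ᵥ (u ∘ Sum.inr))) else 0

theorem weyl_apply (u : Phase p m) (y x : Fin m → ZMod p) :
    weyl u y x = if y = x + u ∘ Sum.inl then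
    ψ ((u ∘ Sum.inr) ⬝ᵥ x + 2⁻¹ * ((u ∘ Sum.inl) ⬝ᵥ (u ∘ Sum.inr))) else 0 := rfl

theorem comp_add_fun {α : Type*} (u w : α → ZMod p) {β : Type*} (f : β → α) :
    (u + w) ∘ f = u ∘ f + w ∘ f := rfl

theorem comp_smul_fun {α : Type*} (k : ZMod p) (w : α → ZMod p) {β : Type*} (f : β → α) :
    (k • w) ∘ f = k • (w ∘ f) := rfl

theorem comp_neg_fun {α : Type*} (w : α → ZMod p) {β : Type*} (f : β → α) :
    (-w) ∘ f = -(w ∘ f) := rfl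

/-- The correction $a\cdot b/2$ in the phase makes the cocycle alternating instead of merely
bilinear. This gives $W(ku)W(lu)=W((k+l)u)$ without extra phases and makes every linear symplectic
change of $u$ compatible with products. -/
theorem weyl_mul (hp : p ≠ 2) (u w : Phase p m) :
    weyl u * weyl w = ψ (2⁻¹ * sympForm p m u w) • weyl (u + w) := by
  have h2 := two_ne_zero_zmod hp
  ext y x
  rw [Matrix.mul_apply, Finset.sum_eq_single (x + w ∘ Sum.inl)]
  · rw [Matrix.smul_apply, weyl_apply, weyl_apply, weyl_apply, if_pos rfl, comp_add_fun,
      comp_add_fun, smul_eq_mul]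
    have : x + w ∘ Sum.inl + u ∘ Sum.inl = x + (u ∘ Sum.inl + w ∘ Sum.inl) := by
      rw [add_assoc, add_comm (w ∘ Sum.inl)]
    rw [this]
    split_ifs
    · rw [← AddChar.map_add_eq_mul, ← AddChar.map_add_eq_mul]
      congr 1
      rw [sympForm_apply]
      simp only [dotProduct_add, add_dotProduct]
      rw [dotProduct_comm (w ∘ Sum.inl) (u ∘ Sum.inr)]
      field_simp
      ring
    · simp
  · intro z _ hz
    rw [weyl_apply w, if_neg hz, mul_zero]
  · simp

@[simp] theorem weyl_zero : weyl (0 : Phase p m) = 1 := by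
  ext y x
  rw [weyl_apply, Matrix.one_apply]
  have h (f : Fin m → Fin m ⊕ Fin m) : (0 : Phase p m) ∘ f = 0 := rfl
  simp [h]

theorem weyl_conjTranspose (hp : p ≠ 2) (u : Phase p m) : (weyl u)ᴴ = weyl (-u) := by
  have h2 := two_ne_zero_zmod hp
  ext y x
  rw [Matrix.conjTranspose_apply, weyl_apply, weyl_apply]
  simp only [comp_neg_fun]
  by_cases h : x = y + u ∘ Sum.inl
  · rw [if_pos h, if_pos (by rw [h]; simp), star_psi, h]
    congr 1
    simp only [dotProduct_add, neg_dotProduct, dotProduct_neg]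
    rw [dotProduct_comm (u ∘ Sum.inr) (u ∘ Sum.inl)]
    field_simp
    ring
  · rw [if_neg h, if_neg (fun h' => h (by rw [h']; simp)), star_zero]

theorem weyl_mem (hp : p ≠ 2) (u : Phase p m) :
    weyl u ∈ Matrix.unitaryGroup (Fin m → ZMod p) ℂ := by
  rw [Matrix.mem_unitaryGroup_iff, Matrix.star_eq_conjTranspose, weyl_conjTranspose hp,
    weyl_mul hp, map_neg, sympForm_self]
  simp

theorem weyl_comm (hp : p ≠ 2) (u w : Phase p m) :
    weyl u * weyl w = ψ (sympForm p m u w) • (weyl w * weyl u) := by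
  have h2 := two_ne_zero_zmod hp
  rw [weyl_mul hp, weyl_mul hp, smul_smul, ← AddChar.map_add_eq_mul, add_comm w u,
    sympForm_swap w u]
  congr 2
  field_simp
  ring

theorem weyl_smul_mul (hp : p ≠ 2) (u : Phase p m) (k l : ZMod p) :
    weyl (k • u) * weyl (l • u) = weyl ((k + l) • u) := by
  rw [weyl_mul hp, map_smul, map_smul, LinearMap.smul_apply, sympForm_self, add_smul]
  simp

theorem weyl_pow (hp : p ≠ 2) (u : Phase p m) (n : ℕ) :
    weyl u ^ n = weyl ((n : ZMod p) • u) := by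
  induction n with
  | zero => simp
  | succ n ih =>
    have := weyl_smul_mul hp u n 1
    rw [one_smul] at this
    rw [pow_succ, ih, this, Nat.cast_succ]

theorem weyl_pow_prime (hp : p ≠ 2) (u : Phase p m) : weyl u ^ p = 1 := by
  rw [weyl_pow hp, CharP.cast_eq_zero, zero_smul, weyl_zero]

theorem weyl_apply_ne_zero_iff (u : Phase p m) (y x : Fin m → ZMod p) :
    weyl u y x ≠ 0 ↔ y = x + u ∘ Sum.inl := by
  rw [weyl_apply]
  split_ifs with h
  · simp [psi_ne_zero, h]
  · simp [h]

/-- Scalar multiples of Weyl operators determine the phase space point. -/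
theorem eq_of_smul_weyl_eq {c d : ℂ} (hc : c ≠ 0) (hd : d ≠ 0) {u w : Phase p m}
    (h : c • weyl u = d • weyl w) : u = w ∧ c = d := by
  have hl : u ∘ Sum.inl = w ∘ Sum.inl := by
    have h1 := congrFun (congrFun h (0 + u ∘ Sum.inl)) 0
    have h2 : (c • weyl u) (0 + u ∘ Sum.inl) 0 ≠ 0 := by
      rw [Matrix.smul_apply, smul_eq_mul]
      exact mul_ne_zero hc ((weyl_apply_ne_zero_iff _ _ _).2 rfl)
    rw [h1, Matrix.smul_apply, smul_eq_mul] at h2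
    have := (weyl_apply_ne_zero_iff _ _ _).1 (right_ne_zero_of_mul h2)
    simpa using this
  -- Comparing the only nonzero entry in each column $x$: the ratio of the values at $e_i$ and at
  -- $0$ recovers $\psi(b_i)$, and then $x=0$ recovers the scalar.
  have key (x : Fin m → ZMod p) :
      c * ψ ((u ∘ Sum.inr) ⬝ᵥ x + 2⁻¹ * ((u ∘ Sum.inl) ⬝ᵥ (u ∘ Sum.inr))) =
      d * ψ ((w ∘ Sum.inr) ⬝ᵥ x + 2⁻¹ * ((w ∘ Sum.inl) ⬝ᵥ (w ∘ Sum.inr))) := by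
    have h1 := congrFun (congrFun h (x + u ∘ Sum.inl)) x
    rw [Matrix.smul_apply, Matrix.smul_apply, weyl_apply, weyl_apply, hl, if_pos rfl,
      if_pos rfl] at h1
    rw [hl]
    exact h1
  have hr : u ∘ Sum.inr = w ∘ Sum.inr := by
    funext i
    have h0 := key 0
    have h1 := key (Pi.single i 1)
    rw [AddChar.map_add_eq_mul, AddChar.map_add_eq_mul] at h0 h1
    simp only [dotProduct_zero, AddChar.map_zero_eq_one, one_mul, dotProduct_single_one] at h0 h1
    rw [mul_left_comm, h0, mul_left_comm d] at h1
    exact ZMod.injective_stdAddChar (mul_right_cancel₀ (mul_ne_zero hd (psi_ne_zero _)) h1)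
  have huw : u = w := by
    funext i
    rcases i with i | i
    · exact congrFun hl i
    · exact congrFun hr i
  refine ⟨huw, ?_⟩
  subst huw
  exact mul_right_cancel₀ (psi_ne_zero _) (key 0)

/-- The Weyl operators act irreducibly: their commutant consists of the scalars. -/
theorem exists_eq_smul_one_of_commute {A : Matrix (Fin m → ZMod p) (Fin m → ZMod p) ℂ}
    (hA : ∀ u : Phase p m, A * weyl u = weyl u * A) : ∃ c : ℂ, A = c • 1 := by
  -- The clock operators separate the coordinates, so commuting with them forces a diagonal matrix;
  -- commuting with translations then makes the diagonal constant.
  have hdiag : ∀ y x, y ≠ x → A y x = 0 := by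
    intro y x hyx
    obtain ⟨i, hi⟩ := Function.ne_iff.1 hyx
    have h := congrFun (congrFun (hA (Sum.elim 0 (Pi.single i 1))) y) x
    have hw (y x : Fin m → ZMod p) : weyl (Sum.elim 0 (Pi.single i 1)) y x =
        if y = x then ψ (x i) else 0 := by
      rw [weyl_apply]
      have h1 : (Sum.elim (0 : Fin m → ZMod p) (Pi.single i 1 : Fin m → ZMod p)) ∘ Sum.inl
          = 0 := rfl
      have h2 : (Sum.elim (0 : Fin m → ZMod p) (Pi.single i 1 : Fin m → ZMod p)) ∘ Sum.inr
          = Pi.single i 1 := rfl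
      rw [h1, h2]
      simp
    rw [Matrix.mul_apply, Matrix.mul_apply] at h
    simp only [hw, mul_ite, mul_zero, ite_mul, zero_mul, Finset.sum_ite_eq, Finset.sum_ite_eq',
      Finset.mem_univ, if_true] at h
    by_contra h0
    rw [mul_comm] at h
    exact hi (ZMod.injective_stdAddChar (mul_right_cancel₀ h0 h)).symm
  refine ⟨A 0 0, ?_⟩
  ext y x
  rw [Matrix.smul_apply, Matrix.one_apply]
  split_ifs with hyx
  · subst hyx
    have h := congrFun (congrFun (hA (Sum.elim y 0)) y) 0
    have hw (z x : Fin m → ZMod p) : weyl (Sum.elim y 0) z x =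
        if z = x + y then (1 : ℂ) else 0 := by
      rw [weyl_apply]
      have h1 : (Sum.elim y (0 : Fin m → ZMod p)) ∘ Sum.inl = y := rfl
      have h2 : (Sum.elim y (0 : Fin m → ZMod p)) ∘ Sum.inr = 0 := rfl
      rw [h1, h2]
      simp
    rw [Matrix.mul_apply, Matrix.mul_apply, Finset.sum_eq_single y, Finset.sum_eq_single 0] at h
    · simpa [hw] using h
    · intro z _ hz
      rw [hw, if_neg (fun h' => hz (by simpa using h')), zero_mul]
    · simp
    · intro z _ hz
      rw [hw, if_neg (fun h' => hz (by simpa using h')), mul_zero]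
    · simp
  · rw [hdiag y x hyx, smul_zero]

theorem shiftMatrix_eq_weyl (i : Fin m) :
    shiftMatrix p m i = weyl (Sum.elim (Pi.single i 1) 0) := by
  ext y x
  rw [weyl_apply]
  have h1 : (Sum.elim (Pi.single i 1) (0 : Fin m → ZMod p)) ∘ Sum.inl = Pi.single i 1 := rfl
  have h2 : (Sum.elim (Pi.single i 1) (0 : Fin m → ZMod p)) ∘ Sum.inr = 0 := rfl
  rw [h1, h2]
  simp [shiftMatrix]

theorem clockMatrix_eq_weyl (i : Fin m) :
    clockMatrix p m i = weyl (Sum.elim 0 (Pi.single i 1)) := by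
  ext y x
  rw [weyl_apply]
  have h1 : (Sum.elim (0 : Fin m → ZMod p) (Pi.single i 1 : Fin m → ZMod p)) ∘ Sum.inl = 0 := rfl
  have h2 : (Sum.elim (0 : Fin m → ZMod p) (Pi.single i 1 : Fin m → ZMod p)) ∘ Sum.inr
    = Pi.single i 1 := rfl
  rw [h1, h2, clockMatrix, Matrix.diagonal_apply]
  split_ifs with h3 h4 h4
  · rw [h3]; simp
  · simp_all
  · simp_all
  · rfl

end Weyl

/-! ### Generation of the symplectic group by transvections. -/

section Transvections

variable {K V : Type*} [Field K] [AddCommGroup V] [Module K V]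

/-- The set of fixed vectors of a linear endomorphism. -/
def fixedSpace (g : V →ₗ[K] V) : Submodule K V := LinearMap.ker (g - LinearMap.id)

theorem mem_fixedSpace {g : V →ₗ[K] V} {x : V} : x ∈ fixedSpace g ↔ g x = x := by
  rw [fixedSpace, LinearMap.mem_ker, LinearMap.sub_apply, LinearMap.id_apply, sub_eq_zero]

/-- The symplectic transvection `x ↦ x + c B(x, v) v`. -/
def sympTransvection (B : LinearMap.BilinForm K V) (c : K) (v : V) : V →ₗ[K] V :=
  LinearMap.id + (c • LinearMap.flip B v).smulRight v

theorem sympTransvection_apply (B : LinearMap.BilinForm K V) (c : K) (v x : V) :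
    sympTransvection B c v x = x + (c * B x v) • v := rfl

theorem sympTransvection_isometry {B : LinearMap.BilinForm K V} (hB : ∀ x, B x x = 0)
    (c : K) (v x y : V) : B (sympTransvection B c v x) (sympTransvection B c v y) = B x y := by
  have h : B v y = - B y v := (LinearMap.IsAlt.neg (B := B) hB y v).symm
  simp only [sympTransvection_apply, map_add, map_smul, LinearMap.add_apply, LinearMap.smul_apply,
    smul_eq_mul, hB, h]
  ring

theorem sympTransvection_comp_neg {B : LinearMap.BilinForm K V} (hB : ∀ x, B x x = 0)
    (c : K) (v : V) : sympTransvection B (-c) v ∘ₗ sympTransvection B c v = LinearMap.id := by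
  ext x
  simp [sympTransvection_apply, hB]

/-- If `g` moves `x` to a vector not orthogonal to `x`, then a transvection increases the fixed
space. -/
theorem exists_fixedSpace_lt {B : LinearMap.BilinForm K V} (hB : ∀ x, B x x = 0)
    {g : V →ₗ[K] V} (hg : ∀ x y, B (g x) (g y) = B x y) {x : V} (hx : B x (g x) ≠ 0) :
    ∃ c v, fixedSpace g < fixedSpace (sympTransvection B c v ∘ₗ g) := by
  have hx' : B (g x) x ≠ 0 := by
    rw [← LinearMap.IsAlt.neg (B := B) hB]
    exact neg_ne_zero.2 hx
  -- The direction $gx-x$ and this scalar make the transvection carry $gx$ back to $x$. A vector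
  -- fixed by $g$ is orthogonal to $gx-x$, since $g$ is an isometry, and so remains fixed.
  refine ⟨(B (g x) x)⁻¹, g x - x, ?_⟩
  rw [SetLike.lt_iff_le_and_exists]
  refine ⟨fun f hf => ?_, x, ?_, ?_⟩
  · rw [mem_fixedSpace] at hf ⊢
    have : B f (g x - x) = 0 := by
      rw [map_sub, sub_eq_zero]
      conv_lhs => rw [← hf]
      exact hg f x
    rw [LinearMap.comp_apply, hf, sympTransvection_apply, this, mul_zero, zero_smul, add_zero]
  · rw [mem_fixedSpace, LinearMap.comp_apply, sympTransvection_apply, map_sub, hB, zero_sub,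
      mul_neg, inv_mul_cancel₀ hx', neg_smul, one_smul]
    abel
  · rw [mem_fixedSpace]
    intro h
    rw [h, hB] at hx
    exact hx rfl

/-- Two nonzero functionals have a common vector where neither vanishes. -/
theorem exists_apply_ne_zero_and {f₁ f₂ : V →ₗ[K] K} (h₁ : f₁ ≠ 0) (h₂ : f₂ ≠ 0) :
    ∃ y, f₁ y ≠ 0 ∧ f₂ y ≠ 0 := by
  obtain ⟨y₁, hy₁⟩ := DFunLike.ne_iff.1 h₁
  obtain ⟨y₂, hy₂⟩ := DFunLike.ne_iff.1 h₂
  rw [LinearMap.zero_apply] at hy₁ hy₂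
  by_cases h12 : f₂ y₁ = 0
  · by_cases h21 : f₁ y₂ = 0
    · exact ⟨y₁ + y₂, by simpa [h21] using hy₁, by simpa [h12] using hy₂⟩
    · exact ⟨y₂, h21, hy₂⟩
  · exact ⟨y₁, hy₁, h12⟩

variable [FiniteDimensional K V]

/-- For an isometry different from the identity at most two transvections are needed to increase
the fixed space. -/
theorem exists_fixedSpace_lt_of_ne_id {B : LinearMap.BilinForm K V} (hB : ∀ x, B x x = 0)
    (hnd : ∀ x, (∀ y, B x y = 0) → x = 0) {g : V →ₗ[K] V} (hg : ∀ x y, B (g x) (g y) = B x y)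
    (h1 : g ≠ LinearMap.id) :
    ∃ c v d w, fixedSpace g <
      fixedSpace (sympTransvection B c v ∘ₗ sympTransvection B d w ∘ₗ g) := by
  by_cases h : ∃ x, B x (g x) ≠ 0
  · obtain ⟨x, hx⟩ := h
    obtain ⟨c, v, hcv⟩ := exists_fixedSpace_lt hB hg hx
    -- One transvection suffices here; the second, with parameters zero, is the identity.
    refine ⟨c, v, 0, 0, ?_⟩
    convert hcv
    ext x
    simp [sympTransvection_apply]
  · push Not at h
    obtain ⟨x, hx⟩ : ∃ x, g x ≠ x := by
      by_contra! h'
      exact h1 (LinearMap.ext h')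
    set v := g x - x with hv
    have hv0 : v ≠ 0 := sub_ne_zero.2 hx
    have hflip (y z : V) : B y z = - B z y := (LinearMap.IsAlt.neg (B := B) hB z y).symm
    have hf : LinearMap.flip B v ≠ 0 := by
      intro h0
      refine hv0 (hnd v fun y => ?_)
      rw [hflip]
      have := LinearMap.congr_fun h0 y
      rw [LinearMap.flip_apply] at this
      rw [this]
      simp
    have hinj : Function.Injective g := by
      rw [← LinearMap.ker_eq_bot, LinearMap.ker_eq_bot']
      intro y hy
      refine hnd y fun z => ?_
      rw [← hg, hy, map_zero, LinearMap.zero_apply]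
    have hsurj : Function.Surjective g := LinearMap.surjective_of_injective hinj
    have hfg : LinearMap.flip B v ∘ₗ g ≠ 0 := by
      intro h0
      apply hf
      ext y
      obtain ⟨z, rfl⟩ := hsurj y
      exact LinearMap.congr_fun h0 z
    -- When $B(z,gz)=0$ for all $z$, a preliminary transvection $g'$ of $g$ along $v$ gives
    -- $B(y,g'y)=B(gy,v)B(y,v)$. Hence $y$ must avoid the kernels of these two functionals.
    obtain ⟨y, hy1, hy2⟩ := exists_apply_ne_zero_and hf hfg
    rw [LinearMap.flip_apply] at hy1
    rw [LinearMap.comp_apply, LinearMap.flip_apply] at hy2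
    set g' := sympTransvection B 1 v ∘ₗ g with hg'
    have hiso : ∀ x y, B (g' x) (g' y) = B x y := fun x y => by
      rw [hg', LinearMap.comp_apply, LinearMap.comp_apply, sympTransvection_isometry hB, hg]
    have hy : B y (g' y) ≠ 0 := by
      rw [hg', LinearMap.comp_apply, sympTransvection_apply, map_add, h, map_smul, zero_add,
        one_mul, smul_eq_mul]
      exact mul_ne_zero hy2 hy1
    obtain ⟨c, w, hcw⟩ := exists_fixedSpace_lt hB hiso hy
    refine ⟨c, w, 1, v, lt_of_le_of_lt (fun f hf => ?_) hcw⟩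
    rw [mem_fixedSpace] at hf ⊢
    have : B f v = 0 := by
      rw [hv, map_sub, sub_eq_zero]
      conv_lhs => rw [← hf]
      exact hg f x
    rw [hg', LinearMap.comp_apply, hf, sympTransvection_apply, this, mul_zero, zero_smul, add_zero]

/-- The symplectic group is generated by the transvections. -/
theorem isometry_induction {B : LinearMap.BilinForm K V} (hB : ∀ x, B x x = 0)
    (hnd : ∀ x, (∀ y, B x y = 0) → x = 0) (P : (V →ₗ[K] V) → Prop) (hid : P LinearMap.id)
    (hmul : ∀ c v g, P g → P (sympTransvection B c v ∘ₗ g))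
    (g : V →ₗ[K] V) (hg : ∀ x y, B (g x) (g y) = B x y) : P g := by
  -- Induction on the codimension of the fixed space; the inverse transvections lead back from the
  -- improved isometry to $g$.
  induction hn : Module.finrank K V - Module.finrank K (fixedSpace g)
    using Nat.strong_induction_on generalizing g with
  | _ n ih =>
  by_cases h1 : g = LinearMap.id
  · rwa [h1]
  obtain ⟨c, v, d, w, hlt⟩ := exists_fixedSpace_lt_of_ne_id hB hnd hg h1
  set g' := sympTransvection B c v ∘ₗ sympTransvection B d w ∘ₗ g with hg'
  have h2 := Submodule.finrank_lt_finrank_of_lt hlt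
  have h3 := Submodule.finrank_le (fixedSpace g')
  have hP : P g' := ih _ (by omega) g' (fun x y => by
    rw [hg']
    simp only [LinearMap.comp_apply, sympTransvection_isometry hB, hg]) rfl
  have := hmul (-d) w _ (hmul (-c) v _ hP)
  have e : sympTransvection B (-d) w ∘ₗ sympTransvection B (-c) v ∘ₗ g' = g := by
    ext x
    have hc (c : K) (v x : V) : sympTransvection B (-c) v (sympTransvection B c v x) = x :=
      LinearMap.congr_fun (sympTransvection_comp_neg hB c v) x
    simp only [hg', LinearMap.comp_apply, hc]
  rwa [e] at this

end Transvections

/-! ### The extraspecial group as the Heisenberg group of the phase space. -/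

section Extraspecial

variable {p m : ℕ} [Fact p.Prime]

theorem smul_mem_unitaryGroup {ι : Type*} [Fintype ι] [DecidableEq ι] {c : ℂ} (hc : c * star c = 1)
    {A : Matrix ι ι ℂ} (hA : A ∈ Matrix.unitaryGroup ι ℂ) : c • A ∈ Matrix.unitaryGroup ι ℂ := by
  rw [Matrix.mem_unitaryGroup_iff] at hA ⊢
  rw [star_smul, smul_mul_smul_comm, hA, hc, one_smul]

theorem psi_mul_star (s : ZMod p) : ψ s * star (ψ s) = 1 := by
  rw [star_psi, ← AddChar.map_add_eq_mul, add_neg_cancel, AddChar.map_zero_eq_one]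

/-- The element `ψ(s) W(u)` of the unitary group. -/
def heis (hp : p ≠ 2) (s : ZMod p) (u : Phase p m) : Matrix.unitaryGroup (Fin m → ZMod p) ℂ :=
  ⟨ψ s • weyl u, smul_mem_unitaryGroup (psi_mul_star s) (weyl_mem hp u)⟩

theorem coe_heis (hp : p ≠ 2) (s : ZMod p) (u : Phase p m) :
    (heis hp s u : Matrix (Fin m → ZMod p) (Fin m → ZMod p) ℂ) = ψ s • weyl u := rfl

theorem heis_mul (hp : p ≠ 2) (s t : ZMod p) (u w : Phase p m) :
    heis hp s u * heis hp t w = heis hp (s + t + 2⁻¹ * sympForm p m u w) (u + w) := by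
  apply Subtype.ext
  rw [Submonoid.coe_mul, coe_heis, coe_heis, coe_heis, smul_mul_smul_comm, weyl_mul hp, smul_smul,
    AddChar.map_add_eq_mul, AddChar.map_add_eq_mul]

theorem heis_zero (hp : p ≠ 2) : heis hp 0 (0 : Phase p m) = 1 := by
  apply Subtype.ext
  simp [coe_heis]

theorem heis_inv (hp : p ≠ 2) (s : ZMod p) (u : Phase p m) :
    (heis hp s u)⁻¹ = heis hp (-s) (-u) := by
  rw [inv_eq_iff_mul_eq_one, heis_mul, map_neg, sympForm_self, ← heis_zero hp]
  simp

theorem heis_pow (hp : p ≠ 2) (s : ZMod p) (u : Phase p m) : heis hp s u ^ p = 1 := by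
  apply Subtype.ext
  rw [SubmonoidClass.coe_pow, coe_heis, smul_pow, weyl_pow_prime hp, psi_pow_prime, one_smul]
  rfl

theorem heis_injective (hp : p ≠ 2) {s t : ZMod p} {u w : Phase p m}
    (h : heis hp s u = heis hp t w) : s = t ∧ u = w := by
  obtain ⟨h1, h2⟩ := eq_of_smul_weyl_eq (psi_ne_zero _) (psi_ne_zero _) (congrArg Subtype.val h)
  exact ⟨ZMod.injective_stdAddChar h2, h1⟩

open scoped commutatorElement in
theorem heis_commutator (hp : p ≠ 2) (s t : ZMod p) (u w : Phase p m) :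
    ⁅heis hp s u, heis hp t w⁆ = heis hp (sympForm p m u w) 0 := by
  have h2 := two_ne_zero_zmod hp
  rw [commutatorElement_def, mul_assoc, ← _root_.mul_inv_rev, mul_inv_eq_iff_eq_mul, heis_mul, heis_mul,
    heis_mul, sympForm_swap w u, add_comm w u, zero_add]
  congr 1
  rw [map_zero, LinearMap.zero_apply]
  field_simp
  ring

theorem exists_sympForm_eq_one (hm : 1 ≤ m) : ∃ u w : Phase p m, sympForm p m u w = 1 := by
  refine ⟨Sum.elim 0 (Pi.single ⟨0, hm⟩ 1), Sum.elim (Pi.single ⟨0, hm⟩ 1) 0, ?_⟩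
  rw [sympForm_apply, Sum.elim_comp_inl, Sum.elim_comp_inr, Sum.elim_comp_inl, Sum.elim_comp_inr]
  simp

-- The generators reach a multiple of every $W(u)$, because the phase points reached form a subspace
-- containing the standard basis. All scalars $\psi(s)$ arise as commutators, since $\omega$ takes
-- the value $1$ when $m\ge1$; they correct the multiple.
open scoped commutatorElement in
theorem heis_mem_extraspecialGroup (hp : p ≠ 2) (hm : 1 ≤ m) (s : ZMod p) (u : Phase p m) :
    heis hp s u ∈ extraspecialGroup p m := by
  have hgen : ∀ u : Phase p m, ∃ s, heis hp s u ∈ extraspecialGroup p m := by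
    let S : AddSubgroup (Phase p m) :=
      { carrier := {u | ∃ s, heis hp s u ∈ extraspecialGroup p m}
        zero_mem' := ⟨0, by rw [heis_zero]; exact one_mem _⟩
        add_mem' := by
          rintro u w ⟨s, hs⟩ ⟨t, ht⟩
          exact ⟨_, by rw [← heis_mul]; exact mul_mem hs ht⟩
        neg_mem' := by
          rintro u ⟨s, hs⟩
          exact ⟨_, by rw [← heis_inv]; exact inv_mem hs⟩ }
    let T : Submodule (ZMod p) (Phase p m) := AddSubgroup.toZModSubmodule p S
    have hT : T = ⊤ := by
      rw [eq_top_iff, ← (Pi.basisFun (ZMod p) (Fin m ⊕ Fin m)).span_eq, Submodule.span_le]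
      rintro _ ⟨i, rfl⟩
      refine ⟨0, Subgroup.subset_closure ?_⟩
      rcases i with i | i
      · refine Or.inl ⟨i, Subtype.ext ?_⟩
        change shiftMatrix p m i = _
        rw [shiftMatrix_eq_weyl, coe_heis, AddChar.map_zero_eq_one, one_smul]
        congr 1
        simp [Sum.elim_single_zero]
      · refine Or.inr ⟨i, Subtype.ext ?_⟩
        change clockMatrix p m i = _
        rw [clockMatrix_eq_weyl, coe_heis, AddChar.map_zero_eq_one, one_smul]
        congr 1
        simp [Sum.elim_zero_single]
    intro u
    have : u ∈ T := by rw [hT]; trivial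
    exact this
  have hscal : ∀ s, heis hp s (0 : Phase p m) ∈ extraspecialGroup p m := by
    intro s
    obtain ⟨u, w, huw⟩ := exists_sympForm_eq_one (p := p) hm
    obtain ⟨a, ha⟩ := hgen (s • u)
    obtain ⟨b, hb⟩ := hgen w
    have h1 : ⁅heis hp a (s • u), heis hp b w⁆ ∈ extraspecialGroup p m := by
      rw [commutatorElement_def]
      exact mul_mem (mul_mem (mul_mem ha hb) (inv_mem ha)) (inv_mem hb)
    rwa [heis_commutator, map_smul, LinearMap.smul_apply, huw, smul_eq_mul, mul_one] at h1
  obtain ⟨t, ht⟩ := hgen u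
  have := mul_mem (hscal (s - t)) ht
  rw [heis_mul] at this
  simpa using this

theorem mem_extraspecialGroup_iff (hp : p ≠ 2) (hm : 1 ≤ m)
    {g : Matrix.unitaryGroup (Fin m → ZMod p) ℂ} :
    g ∈ extraspecialGroup p m ↔ ∃ s u, g = heis hp s u := by
  constructor
  · intro h
    induction h using Subgroup.closure_induction with
    | mem x hx =>
      rcases hx with ⟨i, rfl⟩ | ⟨i, rfl⟩
      · refine ⟨0, Sum.elim (Pi.single i 1) 0, Subtype.ext ?_⟩
        change shiftMatrix p m i = _
        rw [coe_heis, shiftMatrix_eq_weyl]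
        simp
      · refine ⟨0, Sum.elim 0 (Pi.single i 1), Subtype.ext ?_⟩
        change clockMatrix p m i = _
        rw [coe_heis, clockMatrix_eq_weyl]
        simp
    | one => exact ⟨0, 0, (heis_zero hp).symm⟩
    | mul x y _ _ hx hy =>
      obtain ⟨s, u, rfl⟩ := hx
      obtain ⟨t, w, rfl⟩ := hy
      exact ⟨_, _, heis_mul hp s t u w⟩
    | inv x _ hx =>
      obtain ⟨s, u, rfl⟩ := hx
      exact ⟨_, _, heis_inv hp s u⟩
  · rintro ⟨s, u, rfl⟩
    exact heis_mem_extraspecialGroup hp hm s u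

/-- The parametrization of `E_p(m)` by pairs of a scalar and a phase space point. -/
def extraspecialEquiv (hp : p ≠ 2) (hm : 1 ≤ m) :
    ZMod p × Phase p m ≃ extraspecialGroup p m :=
  Equiv.ofBijective (fun x => ⟨heis hp x.1 x.2, heis_mem_extraspecialGroup hp hm x.1 x.2⟩) <| by
    constructor
    · intro x y h
      obtain ⟨h1, h2⟩ := heis_injective hp (congrArg Subtype.val h)
      exact Prod.ext h1 h2
    · rintro ⟨g, hg⟩
      obtain ⟨s, u, rfl⟩ := (mem_extraspecialGroup_iff hp hm).1 hg
      exact ⟨(s, u), rfl⟩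

theorem finite_extraspecialGroup (hp : p ≠ 2) (hm : 1 ≤ m) : Finite (extraspecialGroup p m) :=
  Finite.of_equiv _ (extraspecialEquiv hp hm)

theorem mem_center_extraspecialGroup_iff (hp : p ≠ 2) (hm : 1 ≤ m) {g : extraspecialGroup p m} :
    g ∈ Subgroup.center (extraspecialGroup p m) ↔ ∃ s,
      (g : Matrix.unitaryGroup (Fin m → ZMod p) ℂ) = heis hp s 0 := by
  have h2 := two_ne_zero_zmod hp
  rw [Subgroup.mem_center_iff]
  constructor
  · intro h
    obtain ⟨s, u, hg⟩ := (mem_extraspecialGroup_iff hp hm).1 g.2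
    -- The commutator with $W(w)$ is $\psi(\omega(u,w))$, so centrality puts $u$ into the radical of
    -- the nondegenerate form.
    suffices hu : u = 0 by
      rw [hu] at hg
      exact ⟨s, hg⟩
    refine eq_zero_of_sympForm fun w => ?_
    have h1 := congrArg Subtype.val (h ⟨_, heis_mem_extraspecialGroup hp hm 0 w⟩)
    rw [Subgroup.coe_mul, Subgroup.coe_mul, hg, heis_mul, heis_mul] at h1
    have h3 := (heis_injective hp h1).1
    rw [sympForm_swap w u] at h3
    have h4 : 2⁻¹ * (2 * sympForm p m u w) = 0 := by linear_combination -h3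
    simpa [h2] using h4
  · rintro ⟨s, hg⟩ h
    apply Subtype.ext
    obtain ⟨t, u, hh⟩ := (mem_extraspecialGroup_iff hp hm).1 h.2
    rw [Subgroup.coe_mul, Subgroup.coe_mul, hg, hh, heis_mul, heis_mul]
    simp [add_comm]

theorem isExtraspecialPlus (hp : p ≠ 2) (hm : 1 ≤ m) :
    IsExtraspecialPlus p m (extraspecialGroup p m) := by
  have hp0 : p.Prime := Fact.out
  refine ⟨?_, ?_, ?_, ?_⟩
  · rw [← Nat.card_congr (extraspecialEquiv hp hm), Nat.card_prod, Nat.card_zmod, Nat.card_fun,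
      Nat.card_zmod, Nat.card_eq_fintype_card, Fintype.card_sum, Fintype.card_fin]
    ring
  · have hdvd : Monoid.exponent (extraspecialGroup p m) ∣ p := by
      refine Monoid.exponent_dvd_of_forall_pow_eq_one fun g => ?_
      obtain ⟨s, u, hg⟩ := (mem_extraspecialGroup_iff hp hm).1 g.2
      apply Subtype.ext
      rw [Subgroup.coe_pow, hg, heis_pow]
      rfl
    rcases (Nat.dvd_prime hp0).1 hdvd with h | h
    · exfalso
      rw [Monoid.exp_eq_one_iff] at h
      have h1 := (extraspecialEquiv hp hm).symm.subsingleton_congr.1 h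
      have : ((0, 0) : ZMod p × Phase p m) = (1, 0) := Subsingleton.elim _ _
      simp at this
    · exact h
  · have e : ZMod p ≃ Subgroup.center (extraspecialGroup p m) :=
      Equiv.ofBijective (fun s => ⟨⟨heis hp s 0, heis_mem_extraspecialGroup hp hm s 0⟩,
        (mem_center_extraspecialGroup_iff hp hm).2 ⟨s, rfl⟩⟩) <| by
      constructor
      · intro s t h
        exact (heis_injective hp (congrArg (fun x => x.1.1) h)).1
      · rintro ⟨g, hg⟩
        obtain ⟨s, hs⟩ := (mem_center_extraspecialGroup_iff hp hm).1 hg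
        exact ⟨s, Subtype.ext (Subtype.ext hs.symm)⟩
    rw [← Nat.card_congr e, Nat.card_zmod]
  · apply le_antisymm
    · rw [commutator_def, Subgroup.commutator_le]
      intro g _ h _
      rw [mem_center_extraspecialGroup_iff hp hm]
      obtain ⟨s, u, hg⟩ := (mem_extraspecialGroup_iff hp hm).1 g.2
      obtain ⟨t, w, hh⟩ := (mem_extraspecialGroup_iff hp hm).1 h.2
      refine ⟨sympForm p m u w, ?_⟩
      rw [← heis_commutator hp s t, ← hg, ← hh]
      rfl
    · intro g hg
      obtain ⟨s, hs⟩ := (mem_center_extraspecialGroup_iff hp hm).1 hg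
      obtain ⟨u, w, huw⟩ := exists_sympForm_eq_one (p := p) hm
      have := Subgroup.commutator_mem_commutator
        (Subgroup.mem_top (⟨_, heis_mem_extraspecialGroup hp hm 0 (s • u)⟩ : extraspecialGroup p m))
        (Subgroup.mem_top (⟨_, heis_mem_extraspecialGroup hp hm 0 w⟩ : extraspecialGroup p m))
      rw [commutator_def]
      convert this using 1
      apply Subtype.ext
      rw [hs]
      have h1 := heis_commutator hp 0 0 (s • u) w
      rw [map_smul, LinearMap.smul_apply, huw, smul_eq_mul, mul_one] at h1
      exact h1.symm

end Extraspecial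

/-! ### Operators implementing symplectic transvections. -/

section TransvectionOperators

variable {p m : ℕ} [Fact p.Prime]

/-- The projection to the eigenspace of `W(u)` for the eigenvalue `ψ(j)`. -/
def weylProj (u : Phase p m) (j : ZMod p) : Matrix (Fin m → ZMod p) (Fin m → ZMod p) ℂ :=
  (p : ℂ)⁻¹ • ∑ k : ZMod p, ψ (-(j * k)) • weyl (k • u)

theorem prime_cast_ne_zero : (p : ℂ) ≠ 0 := Nat.cast_ne_zero.2 (Fact.out : p.Prime).ne_zero

theorem weyl_mul_weylProj (hp : p ≠ 2) (u : Phase p m) (k j : ZMod p) :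
    weyl (k • u) * weylProj u j = ψ (j * k) • weylProj u j := by
  rw [weylProj, Matrix.mul_smul, smul_comm (ψ (j * k)), Finset.mul_sum]
  congr 1
  rw [Finset.smul_sum, ← Equiv.sum_comp (Equiv.addLeft k) (fun l => ψ (j * k) • ψ (-(j * l)) • weyl (l • u))]
  refine Finset.sum_congr rfl fun l _ => ?_
  rw [Matrix.mul_smul, weyl_smul_mul hp, smul_smul, ← AddChar.map_add_eq_mul, Equiv.coe_addLeft]
  congr 2
  ring

theorem sum_weylProj (u : Phase p m) : ∑ j, weylProj u j = 1 := by
  simp only [weylProj]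
  rw [← Finset.smul_sum, Finset.sum_comm, Finset.sum_eq_single 0]
  · simp [smul_smul, ← Nat.cast_smul_eq_nsmul ℂ]
  · intro k _ hk
    rw [← Finset.sum_smul]
    have h := sum_psi_mul (-k)
    rw [if_neg (neg_ne_zero.2 hk)] at h
    have h' : ∑ j, ψ (-(j * k)) = 0 := by
      rw [← h]
      exact Finset.sum_congr rfl fun j _ => by rw [mul_neg]
    rw [h', zero_smul]
  · simp

theorem weylProj_mul (hp : p ≠ 2) (u : Phase p m) (i j : ZMod p) :
    weylProj u i * weylProj u j = if i = j then weylProj u j else 0 := by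
  conv_lhs => rw [weylProj, Matrix.smul_mul, Finset.sum_mul]
  have h : ∑ k, (ψ (-(i * k)) • weyl (k • u)) * weylProj u j =
      (∑ k, ψ (k * (j - i))) • weylProj u j := by
    rw [Finset.sum_smul]
    refine Finset.sum_congr rfl fun k _ => ?_
    rw [Matrix.smul_mul, weyl_mul_weylProj hp, smul_smul, ← AddChar.map_add_eq_mul]
    congr 2
    ring
  rw [h, sum_psi_mul]
  by_cases hij : i = j
  · rw [if_pos hij, if_pos (by rw [hij, sub_self]), smul_smul,
      inv_mul_cancel₀ prime_cast_ne_zero, one_smul]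
  · rw [if_neg hij, if_neg (fun h0 => hij (sub_eq_zero.1 h0).symm), zero_smul, smul_zero]

theorem weylProj_conjTranspose (hp : p ≠ 2) (u : Phase p m) (j : ZMod p) :
    (weylProj u j)ᴴ = weylProj u j := by
  rw [weylProj, Matrix.conjTranspose_smul, Matrix.conjTranspose_sum]
  congr 1
  · simp
  rw [← Equiv.sum_comp (Equiv.neg (ZMod p))]
  refine Finset.sum_congr rfl fun k _ => ?_
  rw [Matrix.conjTranspose_smul, star_psi, Equiv.neg_apply, weyl_conjTranspose hp, neg_smul,
    neg_neg, mul_neg, neg_neg]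

/-- Since $W(u)$ and $W(w)$ commute up to a root of unity, $W(w)$ permutes the eigenspaces of $W(u)$
by a translation of their labels. -/
theorem weylProj_mul_weyl (hp : p ≠ 2) (u w : Phase p m) (j : ZMod p) :
    weylProj u j * weyl w = weyl w * weylProj u (j + sympForm p m w u) := by
  simp only [weylProj]
  rw [Matrix.smul_mul, Matrix.mul_smul, Finset.sum_mul, Finset.mul_sum]
  congr 1
  refine Finset.sum_congr rfl fun k _ => ?_
  rw [Matrix.smul_mul, Matrix.mul_smul, weyl_comm hp, smul_smul, ← AddChar.map_add_eq_mul,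
    map_smul, LinearMap.smul_apply, sympForm_swap u w, smul_eq_mul]
  congr 2
  ring

theorem weylProj_mul_weyl_smul (hp : p ≠ 2) (u : Phase p m) (k j : ZMod p) :
    weylProj u j * weyl (k • u) = ψ (j * k) • weylProj u j := by
  rw [weylProj_mul_weyl hp, map_smul, LinearMap.smul_apply, sympForm_self, smul_zero, add_zero,
    weyl_mul_weylProj hp]

/-- The operator with eigenvalues `ψ(c j²)` on the `ψ(j)`-eigenspaces of `W(u)`; it implements a
symplectic transvection along `u`. -/
def transvectionOp (u : Phase p m) (c : ZMod p) :
    Matrix (Fin m → ZMod p) (Fin m → ZMod p) ℂ :=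
  ∑ j : ZMod p, ψ (c * (j * j)) • weylProj u j

theorem transvectionOp_mul (hp : p ≠ 2) (u : Phase p m) (c d : ZMod p) :
    transvectionOp u c * transvectionOp u d = transvectionOp u (c + d) := by
  simp only [transvectionOp]
  rw [Finset.sum_mul]
  refine Finset.sum_congr rfl fun i _ => ?_
  rw [Finset.mul_sum, Finset.sum_eq_single i]
  · rw [smul_mul_smul_comm, weylProj_mul hp, if_pos rfl, ← AddChar.map_add_eq_mul]
    congr 2
    ring
  · intro j _ hj
    rw [smul_mul_smul_comm, weylProj_mul hp, if_neg hj.symm, smul_zero]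
  · simp

theorem transvectionOp_zero (u : Phase p m) : transvectionOp u 0 = 1 := by
  simp [transvectionOp, sum_weylProj]

theorem transvectionOp_pow (hp : p ≠ 2) (u : Phase p m) (c : ZMod p) (n : ℕ) :
    transvectionOp u c ^ n = transvectionOp u (n * c) := by
  induction n with
  | zero => simp [transvectionOp_zero]
  | succ n ih => rw [pow_succ, ih, transvectionOp_mul hp, Nat.cast_succ, add_mul, one_mul]

theorem transvectionOp_conjTranspose (hp : p ≠ 2) (u : Phase p m) (c : ZMod p) :
    (transvectionOp u c)ᴴ = transvectionOp u (-c) := by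
  simp only [transvectionOp]
  rw [Matrix.conjTranspose_sum]
  refine Finset.sum_congr rfl fun j _ => ?_
  rw [Matrix.conjTranspose_smul, weylProj_conjTranspose hp, star_psi, neg_mul]

theorem transvectionOp_mem (hp : p ≠ 2) (u : Phase p m) (c : ZMod p) :
    transvectionOp u c ∈ Matrix.unitaryGroup (Fin m → ZMod p) ℂ := by
  rw [Matrix.mem_unitaryGroup_iff, Matrix.star_eq_conjTranspose, transvectionOp_conjTranspose hp,
    transvectionOp_mul hp, add_neg_cancel, transvectionOp_zero]

/-- Moving $W(w)$ across an eigenprojection shifts its label by $s=\omega(w,u)$, which turns $cj^2$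
into $c(i-s)^2=ci^2-2csi+cs^2$ in the new label $i$. The linear term is the action of $W(-2cs\,u)$
on the eigenspace, hence the transvection parameter $-2c$. -/
theorem transvectionOp_mul_weyl (hp : p ≠ 2) (u w : Phase p m) (c : ZMod p) :
    transvectionOp u c * weyl w =
      weyl (sympTransvection (sympForm p m) (-2 * c) u w) * transvectionOp u c := by
  have h2 := two_ne_zero_zmod hp
  set s := sympForm p m w u with hs
  have h1 : transvectionOp u c * weyl w =
      ψ (c * s ^ 2) • (weyl w * (weyl ((-2 * c * s) • u) * transvectionOp u c)) := by
    simp only [transvectionOp]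
    rw [Finset.sum_mul, Finset.mul_sum, Finset.mul_sum, Finset.smul_sum,
      ← Equiv.sum_comp (Equiv.addRight s) (fun j => ψ (c * s ^ 2) •
        (weyl w * (weyl ((-2 * c * s) • u) * ψ (c * (j * j)) • weylProj u j)))]
    refine Finset.sum_congr rfl fun j _ => ?_
    rw [Matrix.smul_mul, weylProj_mul_weyl hp, Equiv.coe_addRight, Matrix.mul_smul,
      weyl_mul_weylProj hp, smul_smul, Matrix.mul_smul, smul_smul, ← AddChar.map_add_eq_mul,
      ← AddChar.map_add_eq_mul]
    congr 2
    ring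
  rw [h1, ← Matrix.mul_assoc, weyl_mul hp, map_smul, smul_eq_mul, ← hs, Matrix.smul_mul, smul_smul,
    ← AddChar.map_add_eq_mul, sympTransvection_apply, ← hs]
  -- The constant term of the square cancels the cocycle of $W(w)W(-2cs\,u)$.
  have : c * s ^ 2 + 2⁻¹ * (-2 * c * s * s) = 0 := by
    field_simp
    ring
  rw [this, AddChar.map_zero_eq_one, one_smul]

end TransvectionOperators

/-! ### Scalar matrices by roots of unity. -/

section Scalars

theorem stdAddChar_mul_star {n : ℕ} [NeZero n] (k : ZMod n) : ψ k * star (ψ k) = 1 := by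
  rw [mul_comm]
  simp only [ZMod.stdAddChar_apply, Complex.star_def]
  rw [← Complex.normSq_eq_conj_mul_self, Circle.normSq_coe, Complex.ofReal_one]

theorem stdAddChar_pow {n : ℕ} [NeZero n] (k : ZMod n) : ψ k ^ n = 1 := by
  rw [← AddChar.map_nsmul_eq_pow]
  simp

theorem exists_stdAddChar_eq {n : ℕ} [NeZero n] {c : ℂ} (hc : c ^ n = 1) :
    ∃ k : ZMod n, ψ k = c := by
  obtain ⟨i, _, rfl⟩ := (Complex.isPrimitiveRoot_exp n (NeZero.ne n)).eq_pow_of_pow_eq_one hc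
  refine ⟨((i : ℤ) : ZMod n), ?_⟩
  rw [ZMod.stdAddChar_coe, ← Complex.exp_nat_mul]
  congr 1
  push_cast
  ring

variable (ι : Type*) [Fintype ι] [DecidableEq ι]

/-- The scalar matrices by `n`-th roots of unity. -/
def rootScalar (n : ℕ) [NeZero n] : Multiplicative (ZMod n) →* Matrix.unitaryGroup ι ℂ where
  toFun k := ⟨ψ k.toAdd • 1, smul_mem_unitaryGroup (stdAddChar_mul_star _) (one_mem _)⟩
  map_one' := by
    apply Subtype.ext
    simp
  map_mul' k l := by
    apply Subtype.ext
    simp [AddChar.map_add_eq_mul, smul_smul, mul_comm]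

theorem coe_rootScalar (n : ℕ) [NeZero n] (k : Multiplicative (ZMod n)) :
    (rootScalar ι n k : Matrix ι ι ℂ) = ψ k.toAdd • 1 := rfl

variable {ι} in
theorem rootScalar_comm (n : ℕ) [NeZero n] (k : Multiplicative (ZMod n))
    (g : Matrix.unitaryGroup ι ℂ) : Commute (rootScalar ι n k) g := by
  apply Subtype.ext
  rw [Submonoid.coe_mul, Submonoid.coe_mul, coe_rootScalar]
  simp

theorem rootScalar_pow (n : ℕ) [NeZero n] (k : Multiplicative (ZMod n)) :
    rootScalar ι n k ^ n = 1 := by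
  rw [← map_pow]
  have : k ^ n = 1 := by
    apply Multiplicative.toAdd.injective
    simp
  rw [this, map_one]

end Scalars

/-! ### Roots of unity in the cyclotomic field. -/

section Field

variable {p : ℕ}

theorem clifA_pos : 0 < clifA p := Nat.gcd_pos_of_pos_right _ (by norm_num)

theorem clifA_dvd_four : clifA p ∣ 4 := Nat.gcd_dvd_right _ _

theorem det_mem_clifField {ι : Type*} [Fintype ι] [DecidableEq ι] {A : Matrix ι ι ℂ}
    (hA : ∀ x y, A x y ∈ clifField p) : A.det ∈ clifField p := by
  rw [Matrix.det_apply]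
  refine sum_mem fun σ _ => ?_
  rw [Units.smul_def]
  exact zsmul_mem (prod_mem fun i _ => hA _ _) _

variable [Fact p.Prime]

theorem odd_prime (hp : p ≠ 2) : Odd p := (Fact.out : p.Prime).odd_of_ne_two hp

theorem two_dvd_clifA (hp : p ≠ 2) : 2 ∣ clifA p :=
  Nat.dvd_gcd (by obtain ⟨k, hk⟩ := odd_prime hp; omega) (by norm_num)

theorem clifA_coprime_prime (hp : p ≠ 2) : Nat.Coprime (clifA p) p := by
  have : Nat.Coprime 4 p := by
    have := (Nat.coprime_two_left.2 (odd_prime hp))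
    exact Nat.Coprime.pow_left 2 this
  exact Nat.Coprime.coprime_dvd_left clifA_dvd_four this

instance : NeZero (clifA p) := ⟨clifA_pos.ne'⟩

instance : NeZero (clifA p * p) :=
  ⟨mul_ne_zero clifA_pos.ne' (Fact.out : p.Prime).ne_zero⟩

theorem clifField_isPrimitiveRoot :
    IsPrimitiveRoot (Complex.exp (2 * Real.pi * Complex.I / ((clifA p * p : ℕ) : ℂ)))
      (clifA p * p) :=
  Complex.isPrimitiveRoot_exp _ (NeZero.ne _)

theorem mem_clifField_of_pow_eq_one {c : ℂ} (hc : c ^ (clifA p * p) = 1) : c ∈ clifField p := by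
  obtain ⟨i, _, rfl⟩ := (clifField_isPrimitiveRoot (p := p)).eq_pow_of_pow_eq_one hc
  exact pow_mem (IntermediateField.mem_adjoin_simple_self _ _) _

theorem psi_mem_clifField (s : ZMod p) : ψ s ∈ clifField p :=
  mem_clifField_of_pow_eq_one (by rw [mul_comm, pow_mul, psi_pow_prime, one_pow])

/-- As $a$ is even, so is $n=ap$, and the roots of unity of $\mathbb Q(\zeta_n)$ are then the $n$-th
ones, not the $2n$-th ones. This bounds the scalars in the Clifford group. -/
theorem pow_eq_one_of_mem_clifField (hp : p ≠ 2) {c : ℂ} (hc : c ∈ clifField p)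
    (hfin : IsOfFinOrder c) : c ^ (clifA p * p) = 1 := by
  have hcyc : IsCyclotomicExtension {clifA p * p} ℚ (clifField p) := by
    change IsCyclotomicExtension {clifA p * p} ℚ (clifField p).toSubalgebra
    have hint : IsIntegral ℚ (Complex.exp (2 * Real.pi * Complex.I / ((clifA p * p : ℕ) : ℂ))) :=
      ((clifField_isPrimitiveRoot (p := p)).isIntegral (NeZero.pos _)).tower_top
    rw [clifField, IntermediateField.adjoin_simple_toSubalgebra_of_isAlgebraic hint.isAlgebraic]
    exact (clifField_isPrimitiveRoot (p := p)).adjoin_isCyclotomicExtension ℚ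
  have : NumberField (clifField p) := IsCyclotomicExtension.numberField {clifA p * p} ℚ _
  have h1 := IsCyclotomicExtension.Rat.torsionOrder_eq (n := clifA p * p) (K := clifField p)
  rw [if_pos (even_iff_two_dvd.2 ((two_dvd_clifA hp).mul_right p))] at h1
  have h2 : IsPrimitiveRoot (⟨c, hc⟩ : clifField p) (orderOf c) :=
    (IsPrimitiveRoot.orderOf c).of_map_of_injective (f := algebraMap (clifField p) ℂ)
      (algebraMap (clifField p) ℂ).injective
  have : NeZero (orderOf c) := ⟨hfin.orderOf_pos.ne'⟩
  have h3 := NumberField.Units.dvd_torsionOrder_of_isPrimitiveRoot h2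
  rw [h1] at h3
  exact orderOf_dvd_iff_pow_eq_one.1 h3

theorem star_mem_clifField {c : ℂ} (hc : c ∈ clifField p) : star c ∈ clifField p := by
  let f : ℂ →ₐ[ℚ] ℂ := (Complex.conjAe.toAlgHom).restrictScalars ℚ
  have h : (clifField p).map f ≤ clifField p := by
    conv_lhs => rw [clifField]
    rw [IntermediateField.adjoin_map, IntermediateField.adjoin_le_iff, Set.image_singleton,
      Set.singleton_subset_iff]
    refine mem_clifField_of_pow_eq_one ?_
    rw [← map_pow, (clifField_isPrimitiveRoot (p := p)).pow_eq_one, map_one]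
  exact h ⟨c, hc, rfl⟩

/-- The unitary matrices with entries in the cyclotomic field. -/
def fieldUnitary (p m : ℕ) [Fact p.Prime] : Subgroup (Matrix.unitaryGroup (Fin m → ZMod p) ℂ) where
  carrier := {g | ∀ x y, (g : Matrix (Fin m → ZMod p) (Fin m → ZMod p) ℂ) x y ∈ clifField p}
  one_mem' x y := by
    rw [Submonoid.coe_one, Matrix.one_apply]
    split_ifs
    exacts [one_mem _, zero_mem _]
  mul_mem' hg hh x y := by
    rw [Submonoid.coe_mul, Matrix.mul_apply]
    exact sum_mem fun z _ => mul_mem (hg _ _) (hh _ _)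
  inv_mem' {g} hg x y := star_mem_clifField (hg y x)

end Field

/-! ### The normalizer of the extraspecial group and its action on the phase space. -/

section Normalizer

variable {p m : ℕ} [Fact p.Prime]

theorem sympForm_mulVec (A : Matrix (Fin m ⊕ Fin m) (Fin m ⊕ Fin m) (ZMod p)) (u w : Phase p m) :
    sympForm p m (A *ᵥ u) (A *ᵥ w) =
      Matrix.toLinearMap₂' (ZMod p) (Aᵀ * Matrix.J (Fin m) (ZMod p) * A) u w := by
  rw [sympForm_eq_dotProduct, Matrix.toLinearMap₂'_apply', ← Matrix.mulVec_mulVec,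
    ← Matrix.mulVec_mulVec, Matrix.dotProduct_mulVec u, Matrix.vecMul_transpose]

theorem mem_symplecticGroup_iff {A : Matrix (Fin m ⊕ Fin m) (Fin m ⊕ Fin m) (ZMod p)} :
    A ∈ Matrix.symplecticGroup (Fin m) (ZMod p) ↔
      ∀ u w, sympForm p m (A *ᵥ u) (A *ᵥ w) = sympForm p m u w := by
  rw [SymplecticGroup.mem_iff']
  simp only [sympForm_mulVec]
  constructor
  · intro h u w
    rw [h]
    rfl
  · intro h
    exact (Matrix.toLinearMap₂' (ZMod p)).injective (LinearMap.ext₂ h)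

/-- The unitary matrix `g` maps each `W(u)` under conjugation to a multiple `ψ(l·u) W(Au)`. -/
def Implements (g : Matrix.unitaryGroup (Fin m → ZMod p) ℂ)
    (A : Matrix (Fin m ⊕ Fin m) (Fin m ⊕ Fin m) (ZMod p)) : Prop :=
  ∃ l : Phase p m, ∀ u : Phase p m,
    (g : Matrix (Fin m → ZMod p) (Fin m → ZMod p) ℂ) * weyl u =
      ψ (l ⬝ᵥ u) • (weyl (A *ᵥ u) * (g : Matrix (Fin m → ZMod p) (Fin m → ZMod p) ℂ))

theorem implements_one : Implements (1 : Matrix.unitaryGroup (Fin m → ZMod p) ℂ) 1 :=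
  ⟨0, fun u => by simp⟩

theorem Implements.mul {g h : Matrix.unitaryGroup (Fin m → ZMod p) ℂ}
    {A B : Matrix (Fin m ⊕ Fin m) (Fin m ⊕ Fin m) (ZMod p)} (hg : Implements g A)
    (hh : Implements h B) : Implements (g * h) (A * B) := by
  obtain ⟨l, hl⟩ := hg
  obtain ⟨k, hk⟩ := hh
  refine ⟨k + l ᵥ* B, fun u => ?_⟩
  rw [Submonoid.coe_mul, Matrix.mul_assoc, hk, Matrix.mul_smul, ← Matrix.mul_assoc, hl,
    Matrix.smul_mul, smul_smul, ← AddChar.map_add_eq_mul, add_dotProduct,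
    Matrix.dotProduct_mulVec, Matrix.mulVec_mulVec, Matrix.mul_assoc]

theorem Implements.unique {g : Matrix.unitaryGroup (Fin m → ZMod p) ℂ}
    {A B : Matrix (Fin m ⊕ Fin m) (Fin m ⊕ Fin m) (ZMod p)} (hA : Implements g A)
    (hB : Implements g B) : A = B := by
  obtain ⟨l, hl⟩ := hA
  obtain ⟨k, hk⟩ := hB
  refine Matrix.ext_of_mulVec_single fun i => ?_
  have h := hl (Pi.single i 1)
  rw [hk, ← Matrix.smul_mul, ← Matrix.smul_mul] at h
  have h1 := congrArg (· * star (g : Matrix (Fin m → ZMod p) (Fin m → ZMod p) ℂ)) h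
  simp only [Matrix.mul_assoc, Matrix.mem_unitaryGroup_iff.1 g.2, Matrix.mul_one] at h1
  exact (eq_of_smul_weyl_eq (psi_ne_zero _) (psi_ne_zero _) h1).1.symm

theorem Implements.mem_normalizer (hp : p ≠ 2) (hm : 1 ≤ m)
    {g : Matrix.unitaryGroup (Fin m → ZMod p) ℂ}
    {A : Matrix (Fin m ⊕ Fin m) (Fin m ⊕ Fin m) (ZMod p)} (hA : Implements g A) :
    g ∈ Subgroup.normalizer (extraspecialGroup p m : Set (Matrix.unitaryGroup _ ℂ)) := by
  have := finite_extraspecialGroup hp hm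
  obtain ⟨l, hl⟩ := hA
  refine Subgroup.mem_normalizer_fintype fun h hh => ?_
  obtain ⟨s, u, rfl⟩ := (mem_extraspecialGroup_iff hp hm).1 hh
  refine (mem_extraspecialGroup_iff hp hm).2 ⟨s + l ⬝ᵥ u, A *ᵥ u, ?_⟩
  rw [mul_inv_eq_iff_eq_mul]
  apply Subtype.ext
  rw [Submonoid.coe_mul, Submonoid.coe_mul, coe_heis, coe_heis, Matrix.mul_smul, hl, smul_smul,
    Matrix.smul_mul, AddChar.map_add_eq_mul]

/-- Every element of the normalizer of `E_p(m)` induces a symplectic transformation. -/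
theorem exists_implements (hp : p ≠ 2) (hm : 1 ≤ m)
    {g : Matrix.unitaryGroup (Fin m → ZMod p) ℂ}
    (hg : g ∈ Subgroup.normalizer (extraspecialGroup p m : Set (Matrix.unitaryGroup _ ℂ))) :
    ∃ A ∈ Matrix.symplecticGroup (Fin m) (ZMod p), Implements g A := by
  have h2 := two_ne_zero_zmod hp
  rw [Subgroup.mem_normalizer_iff] at hg
  have hex : ∀ u : Phase p m, ∃ s v, g * heis hp 0 u * g⁻¹ = heis hp s v := fun u =>
    (mem_extraspecialGroup_iff hp hm).1 ((hg _).1 (heis_mem_extraspecialGroup hp hm 0 u))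
  choose s σ hσ using hex
  have hcentral (t : ZMod p) (h : Matrix.unitaryGroup (Fin m → ZMod p) ℂ) :
      h * heis hp t 0 = heis hp t 0 * h := by
    apply Subtype.ext
    rw [Submonoid.coe_mul, Submonoid.coe_mul, coe_heis]
    simp
  -- Conjugation fixes central scalars, so applying it to the product rule for $W(u)W(w)$ compares
  -- scalars and phase points separately.
  have key (u w : Phase p m) :
      s u + s w + 2⁻¹ * sympForm p m (σ u) (σ w) = 2⁻¹ * sympForm p m u w + s (u + w) ∧
        σ u + σ w = σ (u + w) := by
    have h1 : heis hp 0 u * heis hp 0 w =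
        heis hp (2⁻¹ * sympForm p m u w) 0 * heis hp 0 (u + w) := by
      rw [heis_mul, heis_mul]
      simp
    have h3 : (g * heis hp 0 u * g⁻¹) * (g * heis hp 0 w * g⁻¹) =
        heis hp (2⁻¹ * sympForm p m u w) 0 * (g * heis hp 0 (u + w) * g⁻¹) := by
      calc _ = g * (heis hp 0 u * heis hp 0 w) * g⁻¹ := by group
        _ = _ := by rw [h1, ← mul_assoc, hcentral]; group
    rw [hσ, hσ, hσ, heis_mul, heis_mul] at h3
    have := heis_injective hp h3
    simpa using this
  -- Exchanging $u$ and $w$ changes the sign of both values of $\omega$ and of nothing else; adding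
  -- the two relations isolates $s$, and what is left over is the invariance of $\omega$.
  have hs (u w : Phase p m) : s (u + w) = s u + s w := by
    have e1 := (key u w).1
    have e2 := (key w u).1
    rw [sympForm_swap (σ w), sympForm_swap w, add_comm w u] at e2
    have : 2 * (s (u + w) - (s u + s w)) = 0 := by linear_combination -e1 - e2
    rcases mul_eq_zero.1 this with h | h
    · exact absurd h h2
    · exact sub_eq_zero.1 h
  have hω (u w : Phase p m) : sympForm p m (σ u) (σ w) = sympForm p m u w := by
    have e1 := (key u w).1
    rw [hs u w] at e1
    have : 2⁻¹ * (sympForm p m (σ u) (σ w) - sympForm p m u w) = 0 := by linear_combination e1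
    rcases mul_eq_zero.1 this with h | h
    · exact absurd h (inv_ne_zero h2)
    · exact sub_eq_zero.1 h
  let S : Phase p m →ₗ[ZMod p] ZMod p := (AddMonoidHom.mk' s hs).toZModLinearMap p
  let T : Phase p m →ₗ[ZMod p] Phase p m :=
    (AddMonoidHom.mk' σ fun u w => (key u w).2.symm).toZModLinearMap p
  have hS (u : Phase p m) : (dotProductEquiv (ZMod p) (Fin m ⊕ Fin m)).symm S ⬝ᵥ u = s u := by
    have := LinearMap.congr_fun
      ((dotProductEquiv (ZMod p) (Fin m ⊕ Fin m)).apply_symm_apply S) u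
    exact this
  have hA (u : Phase p m) : LinearMap.toMatrix' T *ᵥ u = σ u := by
    rw [LinearMap.toMatrix'_mulVec]
    rfl
  refine ⟨LinearMap.toMatrix' T, mem_symplecticGroup_iff.2 fun u w => ?_,
    (dotProductEquiv (ZMod p) (Fin m ⊕ Fin m)).symm S, fun u => ?_⟩
  · rw [hA, hA, hω]
  · have h1 := hσ u
    rw [mul_inv_eq_iff_eq_mul] at h1
    have h3 := congrArg Subtype.val h1
    rw [Submonoid.coe_mul, Submonoid.coe_mul, coe_heis, coe_heis, AddChar.map_zero_eq_one,
      one_smul, Matrix.smul_mul] at h3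
    rw [hS, hA, h3]

/-- A matrix inducing the trivial symplectic transformation is a multiple of a Weyl operator. -/
theorem Implements.exists_eq_smul_weyl (hp : p ≠ 2)
    {g : Matrix.unitaryGroup (Fin m → ZMod p) ℂ} (hg : Implements g 1) :
    ∃ (c : ℂ) (w : Phase p m), (g : Matrix (Fin m → ZMod p) (Fin m → ZMod p) ℂ) = c • weyl w := by
  obtain ⟨l, hl⟩ := hg
  -- With this $w$ the operator $W(w)$ has the same commutation phases as $g$, so $W(-w)g$ commutes
  -- with every Weyl operator and is a scalar.
  obtain ⟨w, hw⟩ := exists_sympForm_eq l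
  have hww : weyl w * weyl (-w) = 1 := by
    rw [weyl_mul hp, map_neg, sympForm_self]
    simp
  obtain ⟨c, hc⟩ := exists_eq_smul_one_of_commute
    (A := weyl (-w) * (g : Matrix (Fin m → ZMod p) (Fin m → ZMod p) ℂ)) (fun u => by
      rw [Matrix.mul_assoc, hl, Matrix.one_mulVec, Matrix.mul_smul, ← Matrix.mul_assoc,
        weyl_comm hp (-w) u, Matrix.smul_mul, smul_smul, ← AddChar.map_add_eq_mul, map_neg,
        LinearMap.neg_apply, hw, add_neg_cancel, AddChar.map_zero_eq_one, one_smul,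
        Matrix.mul_assoc])
  refine ⟨c, w, ?_⟩
  have := congrArg (weyl w * ·) hc
  simpa only [← Matrix.mul_assoc, hww, Matrix.one_mul, Matrix.mul_smul, Matrix.mul_one] using this

/-- The element of the unitary group given by `transvectionOp`. -/
def transvectionU (hp : p ≠ 2) (u : Phase p m) (c : ZMod p) :
    Matrix.unitaryGroup (Fin m → ZMod p) ℂ :=
  ⟨transvectionOp u c, transvectionOp_mem hp u c⟩

theorem transvectionU_pow (hp : p ≠ 2) (u : Phase p m) (c : ZMod p) :
    transvectionU hp u c ^ p = 1 := by
  apply Subtype.ext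
  rw [SubmonoidClass.coe_pow, transvectionU, transvectionOp_pow hp, CharP.cast_eq_zero, zero_mul,
    transvectionOp_zero]
  rfl

theorem transvectionU_implements (hp : p ≠ 2) (u : Phase p m) (c : ZMod p) :
    Implements (transvectionU hp u c)
      (LinearMap.toMatrix' (sympTransvection (sympForm p m) (-2 * c) u)) := by
  refine ⟨0, fun w => ?_⟩
  rw [zero_dotProduct, AddChar.map_zero_eq_one, one_smul, LinearMap.toMatrix'_mulVec]
  exact transvectionOp_mul_weyl hp u w c

/-- The group generated by the operators that implement transvections. -/
def transvectionGroup (m : ℕ) (hp : p ≠ 2) : Subgroup (Matrix.unitaryGroup (Fin m → ZMod p) ℂ) :=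
  Subgroup.closure (Set.range fun x : Phase p m × ZMod p => transvectionU hp x.1 x.2)

theorem transvectionU_mem (hp : p ≠ 2) (u : Phase p m) (c : ZMod p) :
    transvectionU hp u c ∈ transvectionGroup m hp :=
  Subgroup.subset_closure ⟨(u, c), rfl⟩

theorem exists_transvectionGroup_implements (hp : p ≠ 2)
    {A : Matrix (Fin m ⊕ Fin m) (Fin m ⊕ Fin m) (ZMod p)}
    (hA : A ∈ Matrix.symplecticGroup (Fin m) (ZMod p)) :
    ∃ t ∈ transvectionGroup m hp, Implements t A := by
  have h2 := two_ne_zero_zmod hp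
  have := isometry_induction (B := sympForm p m) sympForm_self (fun _ h => eq_zero_of_sympForm h)
    (fun f => ∃ t ∈ transvectionGroup m hp, Implements t (LinearMap.toMatrix' f))
    ⟨1, one_mem _, by rw [LinearMap.toMatrix'_id]; exact implements_one⟩ ?_
    (Matrix.toLin' A) ?_
  · simpa using this
  · rintro c v f ⟨t, ht, htf⟩
    -- The parameter $-c/2$ undoes the factor $-2$ between an operator and the transvection it
    -- induces.
    refine ⟨transvectionU hp v (-2⁻¹ * c) * t, mul_mem (transvectionU_mem hp _ _) ht, ?_⟩
    rw [LinearMap.toMatrix'_comp]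
    convert (transvectionU_implements hp v (-2⁻¹ * c)).mul htf using 4
    field_simp
  · intro u w
    rw [Matrix.toLin'_apply, Matrix.toLin'_apply]
    exact mem_symplecticGroup_iff.1 hA u w

end Normalizer

/-! ### Finiteness and structure of the Clifford group. -/

section CliffordGroup

variable {p m : ℕ} [Fact p.Prime]

/-- The determinant on the unitary group. -/
def unitaryDet (p m : ℕ) [NeZero p] : Matrix.unitaryGroup (Fin m → ZMod p) ℂ →* ℂ :=
  Matrix.detMonoidHom.comp (Matrix.unitaryGroup (Fin m → ZMod p) ℂ).subtype

theorem unitaryDet_apply (g : Matrix.unitaryGroup (Fin m → ZMod p) ℂ) :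
    unitaryDet p m g = (g : Matrix (Fin m → ZMod p) (Fin m → ZMod p) ℂ).det := rfl

theorem cliffordGroup_le_fieldUnitary : cliffordGroup p m ≤ fieldUnitary p m :=
  (Subgroup.closure_le _).2 fun _ hg => hg.1

theorem cliffordGroup_le_normalizer : cliffordGroup p m ≤
    Subgroup.normalizer (extraspecialGroup p m : Set (Matrix.unitaryGroup _ ℂ)) :=
  (Subgroup.closure_le _).2 fun _ hg => hg.2.1

/-- A product of elements of finite order need not have finite order, but the determinant lands in a
commutative monoid, so the bound passes from the generators to the whole group. It is what forces
scalars in the group to be roots of unity before finiteness is known. -/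
theorem unitaryDet_pow_eq_one (hp : p ≠ 2) {g : Matrix.unitaryGroup (Fin m → ZMod p) ℂ}
    (hg : g ∈ cliffordGroup p m) : unitaryDet p m g ^ (clifA p * p) = 1 := by
  have : cliffordGroup p m ≤ ((powMonoidHom (clifA p * p)).comp (unitaryDet p m)).ker :=
    (Subgroup.closure_le _).2 fun g hg => MonoidHom.mem_ker.2
      (pow_eq_one_of_mem_clifField hp (det_mem_clifField hg.1)
        ((unitaryDet p m).isOfFinOrder hg.2.2))
  exact this hg

theorem Implements.mem_cliffordGroup (hp : p ≠ 2) (hm : 1 ≤ m)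
    {g : Matrix.unitaryGroup (Fin m → ZMod p) ℂ}
    {A : Matrix (Fin m ⊕ Fin m) (Fin m ⊕ Fin m) (ZMod p)} (hA : Implements g A)
    (hfield : g ∈ fieldUnitary p m) (hfin : IsOfFinOrder g) : g ∈ cliffordGroup p m :=
  Subgroup.subset_closure ⟨hfield, hA.mem_normalizer hp hm, hfin⟩

theorem weyl_apply_mem_clifField (u : Phase p m) (y x : Fin m → ZMod p) :
    weyl u y x ∈ clifField p := by
  rw [weyl_apply]
  split_ifs
  exacts [psi_mem_clifField _, zero_mem _]

theorem transvectionU_mem_cliffordGroup (hp : p ≠ 2) (hm : 1 ≤ m) (u : Phase p m) (c : ZMod p) :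
    transvectionU hp u c ∈ cliffordGroup p m := by
  refine (transvectionU_implements hp u c).mem_cliffordGroup hp hm (fun y x => ?_)
    (isOfFinOrder_iff_pow_eq_one.2 ⟨p, (Fact.out : p.Prime).pos, transvectionU_pow hp u c⟩)
  change (∑ j : ZMod p, ψ (c * (j * j)) • weylProj u j) y x ∈ clifField p
  rw [Matrix.sum_apply]
  refine sum_mem fun j _ => ?_
  rw [Matrix.smul_apply, weylProj, Matrix.smul_apply, Matrix.sum_apply]
  refine mul_mem (psi_mem_clifField _) (mul_mem (inv_mem (natCast_mem _ _))
    (sum_mem fun k _ => mul_mem (psi_mem_clifField _) (weyl_apply_mem_clifField _ _ _)))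

theorem transvectionGroup_le_cliffordGroup (hp : p ≠ 2) (hm : 1 ≤ m) :
    transvectionGroup m hp ≤ cliffordGroup p m := by
  rw [transvectionGroup, Subgroup.closure_le]
  rintro _ ⟨x, rfl⟩
  exact transvectionU_mem_cliffordGroup hp hm x.1 x.2

theorem heis_implements (hp : p ≠ 2) (s : ZMod p) (w : Phase p m) :
    Implements (heis hp s w) 1 := by
  refine ⟨Matrix.J (Fin m) (ZMod p) *ᵥ (-w), fun u => ?_⟩
  rw [coe_heis, Matrix.smul_mul, weyl_comm hp, Matrix.one_mulVec, Matrix.mul_smul, smul_comm]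
  congr 2
  rw [dotProduct_comm, ← sympForm_eq_dotProduct, map_neg, ← sympForm_swap]

theorem heis_mem_cliffordGroup (hp : p ≠ 2) (hm : 1 ≤ m) (s : ZMod p) (w : Phase p m) :
    heis hp s w ∈ cliffordGroup p m := by
  refine (heis_implements hp s w).mem_cliffordGroup hp hm (fun y x => ?_)
    (isOfFinOrder_iff_pow_eq_one.2 ⟨p, (Fact.out : p.Prime).pos, heis_pow hp s w⟩)
  rw [coe_heis, Matrix.smul_apply]
  exact mul_mem (psi_mem_clifField _) (weyl_apply_mem_clifField _ _ _)

theorem rootScalar_implements (n : ℕ) [NeZero n] (k : Multiplicative (ZMod n)) :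
    Implements (rootScalar (Fin m → ZMod p) n k) 1 := by
  refine ⟨0, fun u => ?_⟩
  rw [coe_rootScalar]
  simp

theorem rootScalar_mem_cliffordGroup (hp : p ≠ 2) (hm : 1 ≤ m) {n : ℕ} [NeZero n]
    (hn : n ∣ clifA p * p) (k : Multiplicative (ZMod n)) :
    rootScalar (Fin m → ZMod p) n k ∈ cliffordGroup p m := by
  refine (rootScalar_implements n k).mem_cliffordGroup hp hm (fun y x => ?_)
    (isOfFinOrder_iff_pow_eq_one.2 ⟨n, NeZero.pos n, rootScalar_pow _ n k⟩)
  rw [coe_rootScalar, Matrix.smul_apply, Matrix.one_apply]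
  refine mul_mem (mem_clifField_of_pow_eq_one ?_) ?_
  · obtain ⟨d, hd⟩ := hn
    rw [hd, pow_mul, stdAddChar_pow, one_pow]
  · split_ifs
    exacts [one_mem _, zero_mem _]

theorem unitaryDet_heis_pow (hp : p ≠ 2) (s : ZMod p) (w : Phase p m) :
    unitaryDet p m (heis hp s w) ^ p = 1 := by
  rw [← map_pow, heis_pow, map_one]

theorem unitaryDet_rootScalar (n : ℕ) [NeZero n] (k : Multiplicative (ZMod n)) :
    unitaryDet p m (rootScalar _ n k) = ψ k.toAdd ^ (p ^ m) := by
  rw [unitaryDet_apply, coe_rootScalar, Matrix.det_smul, Matrix.det_one, mul_one]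
  simp [ZMod.card]

/-- An element of the Clifford group inducing the trivial symplectic transformation is a product of
a scalar and a Weyl operator. -/
theorem exists_eq_rootScalar_mul_heis (hp : p ≠ 2) {g : Matrix.unitaryGroup (Fin m → ZMod p) ℂ}
    (hg : g ∈ cliffordGroup p m) (hg1 : Implements g 1) :
    ∃ (k : Multiplicative (ZMod (clifA p * p))) (w : Phase p m),
      g = rootScalar _ _ k * heis hp 0 w := by
  obtain ⟨c, w, hcw⟩ := hg1.exists_eq_smul_weyl hp
  -- Any nonzero entry of $c\,W(w)$ is $c$ times a $p$-th root of unity.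
  have hc : c ∈ clifField p := by
    have h1 := cliffordGroup_le_fieldUnitary hg (0 + w ∘ Sum.inl) 0
    rw [hcw, Matrix.smul_apply, weyl_apply, if_pos rfl, smul_eq_mul] at h1
    have h2 := mul_mem h1 (inv_mem (psi_mem_clifField (p := p)
      ((w ∘ Sum.inr) ⬝ᵥ 0 + 2⁻¹ * ((w ∘ Sum.inl) ⬝ᵥ (w ∘ Sum.inr)))))
    rwa [mul_inv_cancel_right₀ (psi_ne_zero _)] at h2
  have hdet : c ^ (p ^ m * (clifA p * p)) = 1 := by
    have h1 := unitaryDet_pow_eq_one hp hg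
    rw [unitaryDet_apply, hcw, Matrix.det_smul, mul_pow] at h1
    have h2 : (weyl w).det ^ (clifA p * p) = 1 := by
      rw [mul_comm, pow_mul, ← Matrix.det_pow, weyl_pow_prime hp, Matrix.det_one, one_pow]
    rw [h2, mul_one, ← pow_mul] at h1
    simpa [ZMod.card] using h1
  have hp0 : 0 < p := (Fact.out : p.Prime).pos
  have hfin : IsOfFinOrder c := isOfFinOrder_iff_pow_eq_one.2
    ⟨_, Nat.mul_pos (pow_pos hp0 m) (NeZero.pos _), hdet⟩
  obtain ⟨k, hk⟩ := exists_stdAddChar_eq (pow_eq_one_of_mem_clifField hp hc hfin)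
  refine ⟨Multiplicative.ofAdd k, w, Subtype.ext ?_⟩
  rw [Submonoid.coe_mul, coe_rootScalar, coe_heis, hcw, toAdd_ofAdd, hk]
  simp

/-- Every element of the Clifford group is a product of operators implementing transvections, a
scalar and a Weyl operator. -/
theorem exists_eq_mul_rootScalar_mul_heis (hp : p ≠ 2) (hm : 1 ≤ m)
    {g : Matrix.unitaryGroup (Fin m → ZMod p) ℂ} (hg : g ∈ cliffordGroup p m)
    {A : Matrix (Fin m ⊕ Fin m) (Fin m ⊕ Fin m) (ZMod p)} (hA : Implements g A)
    {t : Matrix.unitaryGroup (Fin m → ZMod p) ℂ} (ht : t ∈ transvectionGroup m hp)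
    (htA : Implements t A) :
    ∃ (k : Multiplicative (ZMod (clifA p * p))) (w : Phase p m),
      g = t * (rootScalar _ _ k * heis hp 0 w) := by
  have htc := transvectionGroup_le_cliffordGroup hp hm ht
  obtain ⟨B, _, hB⟩ := exists_implements hp hm (cliffordGroup_le_normalizer (inv_mem htc))
  have hBA : B * A = 1 := by
    have := hB.mul htA
    rw [inv_mul_cancel] at this
    exact this.unique implements_one
  have h1 := hB.mul hA
  rw [hBA] at h1
  obtain ⟨k, w, h⟩ := exists_eq_rootScalar_mul_heis hp (mul_mem (inv_mem htc) hg) h1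
  exact ⟨k, w, by rw [← h, mul_inv_cancel_left]⟩

/-- The symplectic transformation induced by an element of the Clifford group. -/
def toSymplectic (hp : p ≠ 2) (hm : 1 ≤ m) :
    cliffordGroup p m →* Matrix.symplecticGroup (Fin m) (ZMod p) :=
  have h (g : cliffordGroup p m) := exists_implements hp hm (cliffordGroup_le_normalizer g.2)
  MonoidHom.mk' (fun g => ⟨(h g).choose, (h g).choose_spec.1⟩) fun g g' => Subtype.ext
    ((h (g * g')).choose_spec.2.unique ((h g).choose_spec.2.mul (h g').choose_spec.2))

theorem toSymplectic_spec (hp : p ≠ 2) (hm : 1 ≤ m) (g : cliffordGroup p m) :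
    Implements (g : Matrix.unitaryGroup (Fin m → ZMod p) ℂ) (toSymplectic hp hm g : Matrix _ _ _) :=
  (exists_implements hp hm (cliffordGroup_le_normalizer g.2)).choose_spec.2

/-- After choosing one implementing operator for each symplectic matrix, every element is determined
by that matrix, a scalar from a finite group and a phase point. -/
theorem finite_cliffordGroup (hp : p ≠ 2) (hm : 1 ≤ m) : Finite (cliffordGroup p m) := by
  choose t ht htA using fun A : Matrix.symplecticGroup (Fin m) (ZMod p) =>
    exists_transvectionGroup_implements hp A.2
  have hfin : (Set.range fun x : (Matrix.symplecticGroup (Fin m) (ZMod p) ×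
      Multiplicative (ZMod (clifA p * p)) × Phase p m) =>
      t x.1 * (rootScalar (Fin m → ZMod p) _ x.2.1 * heis hp 0 x.2.2)).Finite := Set.finite_range _
  refine hfin.subset fun g hg => ?_
  obtain ⟨k, w, h⟩ := exists_eq_mul_rootScalar_mul_heis hp hm hg
    (toSymplectic_spec hp hm ⟨g, hg⟩) (ht _) (htA _)
  exact ⟨(_, k, w), h.symm⟩

/-- The complement of the scalars of order prime to `p`: the elements of the Clifford group whose
determinant is a `p`-th root of unity. -/
def cliffordComplement (p m : ℕ) [Fact p.Prime] :
    Subgroup (Matrix.unitaryGroup (Fin m → ZMod p) ℂ) :=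
  cliffordGroup p m ⊓ ((powMonoidHom p).comp (unitaryDet p m)).ker

theorem mem_cliffordComplement {g : Matrix.unitaryGroup (Fin m → ZMod p) ℂ} :
    g ∈ cliffordComplement p m ↔ g ∈ cliffordGroup p m ∧ unitaryDet p m g ^ p = 1 := Iff.rfl

theorem extraspecialGroup_le_cliffordComplement (hp : p ≠ 2) (hm : 1 ≤ m) :
    extraspecialGroup p m ≤ cliffordComplement p m := by
  intro g hg
  obtain ⟨s, u, rfl⟩ := (mem_extraspecialGroup_iff hp hm).1 hg
  exact ⟨heis_mem_cliffordGroup hp hm s u, unitaryDet_heis_pow hp s u⟩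

/-- The generators have order $p$, hence determinants that are $p$-th roots of unity. The complement
thus contains an implementing operator for every symplectic matrix. -/
theorem transvectionGroup_le_cliffordComplement (hp : p ≠ 2) (hm : 1 ≤ m) :
    transvectionGroup m hp ≤ cliffordComplement p m := by
  rw [transvectionGroup, Subgroup.closure_le]
  rintro _ ⟨x, rfl⟩
  refine ⟨transvectionU_mem_cliffordGroup hp hm x.1 x.2, ?_⟩
  change unitaryDet p m (transvectionU hp x.1 x.2) ^ p = 1
  rw [← map_pow, transvectionU_pow, map_one]

/-- The map from the complement to the symplectic group. -/
def complementToSymplectic (hp : p ≠ 2) (hm : 1 ≤ m) :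
    cliffordComplement p m →* Matrix.symplecticGroup (Fin m) (ZMod p) :=
  (toSymplectic hp hm).comp (Subgroup.inclusion inf_le_left)

theorem complementToSymplectic_spec (hp : p ≠ 2) (hm : 1 ≤ m) (g : cliffordComplement p m) :
    Implements (g : Matrix.unitaryGroup (Fin m → ZMod p) ℂ)
      (complementToSymplectic hp hm g : Matrix _ _ _) :=
  toSymplectic_spec hp hm (Subgroup.inclusion inf_le_left g)

theorem complementToSymplectic_surjective (hp : p ≠ 2) (hm : 1 ≤ m) :
    Function.Surjective (complementToSymplectic (p := p) (m := m) hp hm) := by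
  intro A
  obtain ⟨t, ht, htA⟩ := exists_transvectionGroup_implements hp A.2
  refine ⟨⟨t, transvectionGroup_le_cliffordComplement hp hm ht⟩, Subtype.ext ?_⟩
  exact (complementToSymplectic_spec hp hm _).unique htA

/-- A kernel element is $c\,W(w)$ with $c^{ap}=1$, and the determinant condition adds
$c^{p^{m+1}}=1$. As $a$ is prime to $p$, the two exponents have greatest common divisor $p$, so $c$
is one of the scalars of $E_p(m)$. -/
theorem ker_complementToSymplectic (hp : p ≠ 2) (hm : 1 ≤ m) :
    (complementToSymplectic (p := p) (m := m) hp hm).ker =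
      (extraspecialGroup p m).subgroupOf (cliffordComplement p m) := by
  ext g
  rw [MonoidHom.mem_ker, Subgroup.mem_subgroupOf]
  have hspec := complementToSymplectic_spec hp hm g
  constructor
  · intro h
    rw [h] at hspec
    obtain ⟨k, w, hkw⟩ := exists_eq_rootScalar_mul_heis hp g.2.1 hspec
    set c : ℂ := ψ k.toAdd with hc
    have h1 : c ^ (clifA p * p) = 1 := stdAddChar_pow _
    have h2 : c ^ (p ^ (m + 1)) = 1 := by
      have h3 := (mem_cliffordComplement.1 g.2).2
      rw [hkw, map_mul, mul_pow, unitaryDet_heis_pow, mul_one, unitaryDet_rootScalar, ← pow_mul,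
        ← pow_succ] at h3
      exact h3
    have h3 : c ^ p = 1 := by
      have hcop : Nat.gcd (clifA p * p) (p ^ (m + 1)) = p := by
        rw [Nat.Coprime.gcd_mul_left_cancel _
          (Nat.Coprime.pow_right _ (clifA_coprime_prime hp))]
        exact Nat.gcd_eq_left (dvd_pow_self p (Nat.succ_ne_zero m))
      rw [← hcop]
      exact pow_gcd_eq_one.2 ⟨h1, h2⟩
    obtain ⟨s, hs⟩ := exists_stdAddChar_eq h3
    refine (mem_extraspecialGroup_iff hp hm).2 ⟨s, w, ?_⟩
    rw [hkw]
    apply Subtype.ext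
    rw [Submonoid.coe_mul, coe_rootScalar, ← hc, coe_heis, coe_heis, hs]
    simp
  · intro h
    obtain ⟨s, u, hg⟩ := (mem_extraspecialGroup_iff hp hm).1 h
    rw [hg] at hspec
    exact Subtype.ext (hspec.unique (heis_implements hp s u))

/-- The Clifford group is the product of the scalars of order `a` and the complement. -/
theorem nonempty_cliffordGroup_mulEquiv (hp : p ≠ 2) (hm : 1 ≤ m) :
    Nonempty (cliffordGroup p m ≃* Multiplicative (ZMod (clifA p)) × cliffordComplement p m) := by
  have hcop : Nat.Coprime (p ^ (m + 1)) (clifA p) :=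
    (Nat.Coprime.pow_right _ (clifA_coprime_prime hp)).symm
  let f₁ : Multiplicative (ZMod (clifA p)) →* cliffordGroup p m :=
    (rootScalar (Fin m → ZMod p) (clifA p)).codRestrict _
      fun k => rootScalar_mem_cliffordGroup hp hm (dvd_mul_right _ _) k
  let f₂ : cliffordComplement p m →* cliffordGroup p m := Subgroup.inclusion inf_le_left
  let f : Multiplicative (ZMod (clifA p)) × cliffordComplement p m →* cliffordGroup p m :=
    f₁.noncommCoprod f₂ fun k g => Subtype.ext (rootScalar_comm (clifA p) k g.1)
  have hf (x) : (f x : Matrix.unitaryGroup (Fin m → ZMod p) ℂ) =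
      rootScalar _ _ x.1 * (x.2 : Matrix.unitaryGroup (Fin m → ZMod p) ℂ) := rfl
  have hdet (k : Multiplicative (ZMod (clifA p))) :
      unitaryDet p m (rootScalar _ _ k) ^ p = ψ k.toAdd ^ (p ^ (m + 1)) := by
    rw [unitaryDet_rootScalar, ← pow_mul, ← pow_succ]
  refine ⟨(MulEquiv.ofBijective f ⟨?_, ?_⟩).symm⟩
  -- Applying $\det^p$ kills the second factor and is $c\mapsto c^{p^{m+1}}$ on the scalars, which
  -- is injective on $a$-th roots of unity.
  · rw [injective_iff_map_eq_one]
    rintro ⟨k, g⟩ h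
    have h0 := congrArg Subtype.val h
    rw [hf] at h0
    have h1 := congrArg (fun x => unitaryDet p m x ^ p) h0
    simp only at h1
    rw [map_mul, mul_pow, (mem_cliffordComplement.1 g.2).2, mul_one, hdet, Subgroup.coe_one,
      map_one, one_pow] at h1
    have h2 : ψ k.toAdd ^ 1 = 1 := by
      have := pow_gcd_eq_one.2 ⟨h1, stdAddChar_pow k.toAdd⟩
      rwa [hcop] at this
    rw [pow_one] at h2
    have hk : k = 1 := by
      apply Multiplicative.toAdd.injective
      apply ZMod.injective_stdAddChar
      rw [h2, toAdd_one, AddChar.map_zero_eq_one]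
    subst hk
    refine Prod.ext rfl (Subtype.ext ?_)
    simpa using h0
  · rintro ⟨g, hg⟩
    set d := unitaryDet p m g ^ p with hd
    have hda : d ^ clifA p = 1 := by
      rw [hd, ← pow_mul, mul_comm, unitaryDet_pow_eq_one hp hg]
    -- Raising to the power $p^{m+1}$ is bijective on $a$-th roots of unity, so some scalar of order
    -- dividing $a$ has the same $\det^p$ as $g$; dividing by it lands in the complement.
    obtain ⟨n, hn⟩ := exists_pow_eq_self_of_coprime
      (show (p ^ (m + 1)).Coprime (orderOf d) from
        Nat.Coprime.coprime_dvd_right (orderOf_dvd_of_pow_eq_one hda) hcop)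
    obtain ⟨l, hl⟩ := exists_stdAddChar_eq (n := clifA p) (c := d ^ n) (by
      rw [← pow_mul, mul_comm, pow_mul, hda, one_pow])
    set k : Multiplicative (ZMod (clifA p)) := Multiplicative.ofAdd l with hk
    have hkd : ψ k.toAdd ^ (p ^ (m + 1)) = d := by
      rw [hk, toAdd_ofAdd, hl, ← pow_mul, mul_comm, pow_mul, hn]
    have hmem : (rootScalar _ _ k)⁻¹ * g ∈ cliffordComplement p m := by
      refine mem_cliffordComplement.2 ⟨mul_mem (inv_mem
        (rootScalar_mem_cliffordGroup hp hm (dvd_mul_right _ _) k)) hg, ?_⟩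
      have h1 : unitaryDet p m (rootScalar _ _ k * ((rootScalar _ _ k)⁻¹ * g)) ^ p = d := by
        rw [mul_inv_cancel_left]
      rw [map_mul, mul_pow, hdet, hkd] at h1
      have hd0 : d ≠ 0 := by
        intro h0
        rw [h0, zero_pow clifA_pos.ne'] at hda
        exact zero_ne_one hda
      exact mul_left_cancel₀ hd0 (by rw [h1, mul_one])
    refine ⟨(k, ⟨_, hmem⟩), Subtype.ext ?_⟩
    rw [hf, mul_inv_cancel_left]

theorem cliffordGroup_structure (hp : p ≠ 2) (hm : 1 ≤ m) :
    ∃ (H : Subgroup (Matrix.unitaryGroup (Fin m → ZMod p) ℂ))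
        (_ : ((extraspecialGroup p m).subgroupOf H).Normal),
      extraspecialGroup p m ≤ H ∧ H ≤ cliffordGroup p m ∧
      Nonempty (H ⧸ (extraspecialGroup p m).subgroupOf H ≃*
        Matrix.symplecticGroup (Fin m) (ZMod p)) ∧
      Nonempty (cliffordGroup p m ≃* Multiplicative (ZMod (clifA p)) × H) := by
  have hker := ker_complementToSymplectic (p := p) (m := m) hp hm
  have hn : ((extraspecialGroup p m).subgroupOf (cliffordComplement p m)).Normal := by
    rw [← hker]
    infer_instance
  refine ⟨cliffordComplement p m, hn, extraspecialGroup_le_cliffordComplement hp hm, inf_le_left,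
    ⟨?_⟩, nonempty_cliffordGroup_mulEquiv hp hm⟩
  exact (QuotientGroup.quotientMulEquivOfEq hker.symm).trans
    (QuotientGroup.quotientKerEquivOfSurjective _ (complementToSymplectic_surjective hp hm))

end CliffordGroup

/-! ### Tensor products of matrices. -/

section Tensor

variable {ι : Type*} {N : ℕ}

/-- The tensor product of `N` matrices. -/
def tensorMatrix (M : Fin N → Matrix ι ι ℂ) : Matrix (Fin N → ι) (Fin N → ι) ℂ :=
  Matrix.of fun y x => ∏ i, M i (y i) (x i)

theorem tensorMatrix_apply (M : Fin N → Matrix ι ι ℂ) (y x : Fin N → ι) :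
    tensorMatrix M y x = ∏ i, M i (y i) (x i) := rfl

theorem tensorMatrix_mul [Fintype ι] (M M' : Fin N → Matrix ι ι ℂ) :
    tensorMatrix M * tensorMatrix M' = tensorMatrix fun i => M i * M' i := by
  ext y x
  simp only [Matrix.mul_apply, tensorMatrix_apply, Finset.prod_univ_sum, Fintype.piFinset_univ,
    Finset.prod_mul_distrib]

theorem tensorMatrix_smul (c : Fin N → ℂ) (M : Fin N → Matrix ι ι ℂ) :
    (tensorMatrix fun i => c i • M i) = (∏ i, c i) • tensorMatrix M := by
  ext y x
  simp only [Matrix.smul_apply, tensorMatrix_apply, smul_eq_mul, Finset.prod_mul_distrib]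

theorem tensorMatrix_sum {κ : Type*} [Fintype κ] [DecidableEq κ] (M : Fin N → κ → Matrix ι ι ℂ) :
    (tensorMatrix fun i => ∑ j, M i j) = ∑ j : Fin N → κ, tensorMatrix fun i => M i (j i) := by
  ext y x
  simp only [Matrix.sum_apply, tensorMatrix_apply, Finset.prod_univ_sum, Fintype.piFinset_univ]

theorem tensorMatrix_one [DecidableEq ι] : tensorMatrix (fun _ : Fin N => (1 : Matrix ι ι ℂ)) = 1 := by
  ext y x
  rw [tensorMatrix_apply, Matrix.one_apply]
  split_ifs with h
  · subst h; simp
  · obtain ⟨i, hi⟩ := Function.ne_iff.1 h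
    exact Finset.prod_eq_zero (Finset.mem_univ i) (Matrix.one_apply_ne hi)

/-- The diagonal action of a matrix on tensors. -/
abbrev tensorPow (N : ℕ) (g : Matrix ι ι ℂ) : Matrix (Fin N → ι) (Fin N → ι) ℂ :=
  tensorMatrix fun _ : Fin N => g

theorem tensorPow_mul [Fintype ι] (g h : Matrix ι ι ℂ) :
    tensorPow N (g * h) = tensorPow N g * tensorPow N h := (tensorMatrix_mul _ _).symm

/-- A monomial operator acts on the basis tensors by a monomial operator. -/
theorem tensorPow_mulVec_single [Fintype ι] [DecidableEq ι] {g : Matrix ι ι ℂ} {f : ι → ι} {c : ι → ℂ}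
    (hg : ∀ y x, g y x = if y = f x then c x else 0) (x : Fin N → ι) :
    tensorPow N g *ᵥ Pi.single x 1 = (∏ i, c (x i)) • Pi.single (fun i => f (x i)) (1 : ℂ) := by
  ext y
  rw [Matrix.mulVec_single_one, Matrix.col_apply, Pi.smul_apply]
  change ∏ i, g (y i) (x i) = _
  simp only [hg]
  by_cases h : y = fun i => f (x i)
  · subst h; simp
  · rw [Pi.single_eq_of_ne h, smul_zero]
    obtain ⟨i, hi⟩ := Function.ne_iff.1 h
    exact Finset.prod_eq_zero (Finset.mem_univ i) (if_neg hi)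

end Tensor

/-! ### The averaging operator on tensors and its values on basis tensors. -/

section Average

variable {p m : ℕ} [Fact p.Prime] {N : ℕ}

/-- The average over the Clifford group on tensors. -/
def tensorAverage (p m N : ℕ) [NeZero p] : Module.End ℂ ((Fin N → Fin m → ZMod p) → ℂ) :=
  (Nat.card (cliffordGroup p m) : ℂ)⁻¹ • ∑ᶠ g : cliffordGroup p m,
    (tensorPow N ((g : Matrix.unitaryGroup (Fin m → ZMod p) ℂ) :
        Matrix (Fin m → ZMod p) (Fin m → ZMod p) ℂ)).mulVecLin

theorem tensorAverage_apply [Fintype (cliffordGroup p m)] (φ : (Fin N → Fin m → ZMod p) → ℂ) :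
    tensorAverage p m N φ = (Nat.card (cliffordGroup p m) : ℂ)⁻¹ • ∑ g : cliffordGroup p m,
      tensorPow N ((g : Matrix.unitaryGroup (Fin m → ZMod p) ℂ) :
        Matrix (Fin m → ZMod p) (Fin m → ZMod p) ℂ) *ᵥ φ := by
  rw [tensorAverage, finsum_eq_sum_of_fintype, LinearMap.smul_apply, LinearMap.sum_apply]
  rfl

theorem tensorAverage_act (hp : p ≠ 2) (hm : 1 ≤ m) {g : Matrix.unitaryGroup (Fin m → ZMod p) ℂ}
    (hg : g ∈ cliffordGroup p m) (φ : (Fin N → Fin m → ZMod p) → ℂ) :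
    tensorAverage p m N (tensorPow N (g : Matrix (Fin m → ZMod p) (Fin m → ZMod p) ℂ) *ᵥ φ) =
      tensorAverage p m N φ := by
  have := finite_cliffordGroup (p := p) (m := m) hp hm
  have := Fintype.ofFinite (cliffordGroup p m)
  rw [tensorAverage_apply, tensorAverage_apply]
  congr 1
  refine Fintype.sum_equiv (Equiv.mulRight (⟨g, hg⟩ : cliffordGroup p m)) _ _ fun h => ?_
  rw [Matrix.mulVec_mulVec, ← tensorPow_mul]
  rfl

theorem tensorAverage_of_invariant (hp : p ≠ 2) (hm : 1 ≤ m) {φ : (Fin N → Fin m → ZMod p) → ℂ}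
    (hφ : ∀ g ∈ cliffordGroup p m,
      tensorPow N (g : Matrix (Fin m → ZMod p) (Fin m → ZMod p) ℂ) *ᵥ φ = φ) :
    tensorAverage p m N φ = φ := by
  have := finite_cliffordGroup (p := p) (m := m) hp hm
  have := Fintype.ofFinite (cliffordGroup p m)
  rw [tensorAverage_apply, Finset.sum_congr rfl fun g _ => hφ g.1 g.2, Finset.sum_const,
    Finset.card_univ, Nat.card_eq_fintype_card, ← Nat.cast_smul_eq_nsmul ℂ, smul_smul,
    inv_mul_cancel₀, one_smul]
  exact Nat.cast_ne_zero.2 Fintype.card_ne_zero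

theorem tensorAverage_eq_sum (φ : (Fin N → Fin m → ZMod p) → ℂ) :
    tensorAverage p m N φ = ∑ x, φ x • tensorAverage p m N (Pi.single x 1) := by
  conv_lhs => rw [pi_eq_sum_univ' φ, map_sum]
  exact Finset.sum_congr rfl fun x _ => by rw [map_smul]

/-- If a group element multiplies `φ` by a scalar different from one, then the average vanishes. -/
theorem tensorAverage_eq_zero (hp : p ≠ 2) (hm : 1 ≤ m)
    {g : Matrix.unitaryGroup (Fin m → ZMod p) ℂ} (hg : g ∈ cliffordGroup p m)
    {φ : (Fin N → Fin m → ZMod p) → ℂ} {c : ℂ} (hc : c ≠ 1)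
    (h : tensorPow N (g : Matrix (Fin m → ZMod p) (Fin m → ZMod p) ℂ) *ᵥ φ = c • φ) :
    tensorAverage p m N φ = 0 := by
  have h1 := tensorAverage_act hp hm hg φ
  rw [h, map_smul] at h1
  have h2 : (c - 1) • tensorAverage p m N φ = 0 := by rw [sub_smul, h1, one_smul, sub_self]
  exact (smul_eq_zero.1 h2).resolve_left (sub_ne_zero.2 hc)

theorem tensorPow_rootScalar (n : ℕ) [NeZero n] (k : Multiplicative (ZMod n))
    (φ : (Fin N → Fin m → ZMod p) → ℂ) :
    tensorPow N (rootScalar (Fin m → ZMod p) n k :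
      Matrix (Fin m → ZMod p) (Fin m → ZMod p) ℂ) *ᵥ φ = ψ k.toAdd ^ N • φ := by
  rw [coe_rootScalar, tensorPow, tensorMatrix_smul (fun _ => ψ k.toAdd) (fun _ => 1),
    tensorMatrix_one, Matrix.smul_mulVec, Matrix.one_mulVec]
  simp

/-- The scalar $\zeta_{ap}$ lies in the group and multiplies every tensor by $\zeta_{ap}^N\ne1$. -/
theorem tensorAverage_eq_zero_of_not_dvd (hp : p ≠ 2) (hm : 1 ≤ m) (hN : ¬ clifA p * p ∣ N) :
    tensorAverage p m N = 0 := by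
  refine LinearMap.ext fun φ => tensorAverage_eq_zero hp hm
    (rootScalar_mem_cliffordGroup hp hm (dvd_refl _) (Multiplicative.ofAdd 1)) ?_
    (tensorPow_rootScalar _ _ φ)
  rw [toAdd_ofAdd, ← AddChar.map_nsmul_eq_pow, nsmul_one]
  intro h
  rw [← AddChar.map_zero_eq_one (ψ : AddChar (ZMod (clifA p * p)) ℂ)] at h
  exact hN ((ZMod.natCast_eq_zero_iff _ _).1 (ZMod.injective_stdAddChar h))

theorem psi_sum {κ : Type*} (s : Finset κ) (f : κ → ZMod p) :
    ψ (∑ i ∈ s, f i) = ∏ i ∈ s, ψ (f i) := by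
  classical
  induction s using Finset.induction_on with
  | empty => simp
  | insert a s ha ih => rw [Finset.sum_insert ha, Finset.prod_insert ha, AddChar.map_add_eq_mul, ih]

theorem tensorAverage_single_add (hp : p ≠ 2) (hm : 1 ≤ m) (x : Fin N → Fin m → ZMod p)
    (t : Fin m → ZMod p) :
    tensorAverage p m N (Pi.single (fun i => x i + t) 1) = tensorAverage p m N (Pi.single x 1) := by
  rw [← tensorAverage_act hp hm (heis_mem_cliffordGroup hp hm 0 (Sum.elim t 0))
    (Pi.single x 1),
    tensorPow_mulVec_single (f := fun x => x + t) (c := fun _ => 1)]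
  · simp
  · intro y x
    rw [coe_heis, AddChar.map_zero_eq_one, one_smul, weyl_apply, Sum.elim_comp_inl,
      Sum.elim_comp_inr]
    simp

theorem tensorAverage_single_eq_zero_of_sum_ne (hp : p ≠ 2) (hm : 1 ≤ m)
    {x : Fin N → Fin m → ZMod p} {l : Fin m} (h : ∑ i, x i l ≠ 0) :
    tensorAverage p m N (Pi.single x 1) = 0 := by
  refine tensorAverage_eq_zero hp hm
    (heis_mem_cliffordGroup hp hm 0 (Sum.elim 0 (Pi.single l 1))) (c := ψ (∑ i, x i l)) ?_ ?_
  · intro h1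
    rw [← AddChar.map_zero_eq_one (ψ : AddChar (ZMod p) ℂ)] at h1
    exact h (ZMod.injective_stdAddChar h1)
  · rw [tensorPow_mulVec_single (f := fun x => x) (c := fun x => ψ (x l)), psi_sum]
    intro y x
    rw [coe_heis, AddChar.map_zero_eq_one, one_smul, weyl_apply, Sum.elim_comp_inl,
      Sum.elim_comp_inr]
    simp

/-- The operators $W(0,kb)$ are diagonal, and their eigenspaces are spanned by the $v_x$ with a
prescribed value of $b\cdot x$. -/
theorem transvectionOp_inr_apply (b y x : Fin m → ZMod p) (c : ZMod p) :
    transvectionOp (Sum.elim (0 : Fin m → ZMod p) b) c y x = if y = x then ψ (c * ((b ⬝ᵥ x) * (b ⬝ᵥ x))) else 0 := by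
  have hw (k : ZMod p) : weyl (k • Sum.elim (0 : Fin m → ZMod p) b) y x =
      if y = x then ψ (k * (b ⬝ᵥ x)) else 0 := by
    rw [weyl_apply]
    simp only [comp_smul_fun, Sum.elim_comp_inl, Sum.elim_comp_inr]
    simp
  have hproj (j : ZMod p) : weylProj (Sum.elim (0 : Fin m → ZMod p) b) j y x =
      if y = x then (if b ⬝ᵥ x = j then 1 else 0) else 0 := by
    rw [weylProj, Matrix.smul_apply, Matrix.sum_apply]
    simp only [Matrix.smul_apply, hw]
    by_cases hyx : y = x
    · simp only [if_pos hyx]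
      have : ∑ k, ψ (-(j * k)) • ψ (k * (b ⬝ᵥ x)) = ∑ k, ψ (k * (b ⬝ᵥ x - j)) := by
        refine Finset.sum_congr rfl fun k _ => ?_
        rw [smul_eq_mul, ← AddChar.map_add_eq_mul]
        congr 1
        ring
      rw [this, sum_psi_mul]
      simp only [sub_eq_zero]
      split_ifs
      · rw [smul_eq_mul, inv_mul_cancel₀ prime_cast_ne_zero]
      · rw [smul_zero]
    · simp [if_neg hyx]
  rw [transvectionOp, Matrix.sum_apply]
  simp only [Matrix.smul_apply, hproj]
  by_cases hyx : y = x <;> simp [hyx]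

/-- A diagonal transvection operator has $v_x$ as an eigenvector; its eigenvalue is $\psi$ of the
norm of the row combination given by $b$. -/
theorem tensorAverage_single_eq_zero_of_norm_ne (hp : p ≠ 2) (hm : 1 ≤ m)
    {x : Fin N → Fin m → ZMod p} {b : Fin m → ZMod p}
    (h : (fun i => b ⬝ᵥ x i) ⬝ᵥ (fun i => b ⬝ᵥ x i) ≠ 0) :
    tensorAverage p m N (Pi.single x 1) = 0 := by
  refine tensorAverage_eq_zero hp hm
    (transvectionU_mem_cliffordGroup hp hm (Sum.elim 0 b) 1)
    (c := ψ ((fun i => b ⬝ᵥ x i) ⬝ᵥ (fun i => b ⬝ᵥ x i))) ?_ ?_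
  · intro h1
    rw [← AddChar.map_zero_eq_one (ψ : AddChar (ZMod p) ℂ)] at h1
    exact h (ZMod.injective_stdAddChar h1)
  · rw [tensorPow_mulVec_single (f := fun x => x) (c := fun x => ψ ((b ⬝ᵥ x) * (b ⬝ᵥ x))),
      dotProduct, psi_sum]
    intro y x
    have := transvectionOp_inr_apply b y x 1
    rwa [one_mul] at this

/-- The permutation operators `v_x ↦ v_{g x}`, for `g` in the general linear group. -/
def linearOp (p m : ℕ) [Fact p.Prime] :
    (Matrix (Fin m) (Fin m) (ZMod p))ˣ →* Matrix.unitaryGroup (Fin m → ZMod p) ℂ where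
  toFun g := ⟨Matrix.of fun y x => if y = g.1 *ᵥ x then 1 else 0, by
    rw [Matrix.mem_unitaryGroup_iff']
    ext x y
    simp only [Matrix.star_eq_conjTranspose, Matrix.mul_apply, Matrix.conjTranspose_apply,
      Matrix.of_apply, Matrix.one_apply]
    rw [Finset.sum_eq_single (g.1 *ᵥ x)]
    · have : g.1 *ᵥ x = g.1 *ᵥ y ↔ x = y :=
        (Matrix.mulVec_injective_iff_isUnit.2 g.isUnit).eq_iff
      simp [this]
    · intro z _ hz
      simp [hz]
    · simp⟩
  map_one' := by
    apply Subtype.ext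
    ext y x
    simp [Matrix.one_apply]
  map_mul' g h := by
    apply Subtype.ext
    ext y x
    rw [Submonoid.coe_mul, Matrix.mul_apply, Finset.sum_eq_single (h.1 *ᵥ x)]
    · simp
    · intro z _ hz
      simp [hz]
    · simp

theorem linearOp_apply (g : (Matrix (Fin m) (Fin m) (ZMod p))ˣ) (y x : Fin m → ZMod p) :
    (linearOp p m g : Matrix (Fin m → ZMod p) (Fin m → ZMod p) ℂ) y x =
      if y = g.1 *ᵥ x then 1 else 0 := rfl

theorem linearOp_implements (g : (Matrix (Fin m) (Fin m) (ZMod p))ˣ) :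
    Implements (linearOp p m g) (Matrix.fromBlocks g.1 0 0 (g⁻¹.1)ᵀ) := by
  refine ⟨0, fun u => ?_⟩
  rw [zero_dotProduct, AddChar.map_zero_eq_one, one_smul, Matrix.fromBlocks_mulVec]
  ext y x
  rw [Matrix.mul_apply, Matrix.mul_apply, Finset.sum_eq_single (x + u ∘ Sum.inl),
    Finset.sum_eq_single (g.1 *ᵥ x)]
  · rw [linearOp_apply, linearOp_apply, if_pos rfl, weyl_apply, weyl_apply, if_pos rfl,
      Sum.elim_comp_inl, Sum.elim_comp_inr]
    simp only [Matrix.zero_mulVec, add_zero, zero_add, Matrix.mulVec_add]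
    have h (z : Fin m → ZMod p) : ((g⁻¹.1)ᵀ *ᵥ u ∘ Sum.inr) ⬝ᵥ (g.1 *ᵥ z) = u ∘ Sum.inr ⬝ᵥ z := by
      rw [Matrix.mulVec_transpose, ← Matrix.dotProduct_mulVec, Matrix.mulVec_mulVec,
        Units.inv_mul, Matrix.one_mulVec]
    rw [h, dotProduct_comm (g.1 *ᵥ _) _, h, dotProduct_comm (u ∘ Sum.inr) (u ∘ Sum.inl)]
    split_ifs <;> simp
  · intro z _ hz
    rw [linearOp_apply, if_neg hz, mul_zero]
  · simp
  · intro z _ hz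
    rw [weyl_apply, if_neg hz, mul_zero]
  · simp

theorem linearOp_mem_cliffordGroup (hp : p ≠ 2) (hm : 1 ≤ m)
    (g : (Matrix (Fin m) (Fin m) (ZMod p))ˣ) : linearOp p m g ∈ cliffordGroup p m := by
  refine (linearOp_implements g).mem_cliffordGroup hp hm (fun y x => ?_)
    ((linearOp p m).isOfFinOrder (isOfFinOrder_of_finite g))
  rw [linearOp_apply]
  split_ifs
  exacts [one_mem _, zero_mem _]

theorem tensorAverage_single_mulVec (hp : p ≠ 2) (hm : 1 ≤ m) (x : Fin N → Fin m → ZMod p)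
    (g : (Matrix (Fin m) (Fin m) (ZMod p))ˣ) :
    tensorAverage p m N (Pi.single (fun i => g.1 *ᵥ x i) 1) =
      tensorAverage p m N (Pi.single x 1) := by
  rw [← tensorAverage_act hp hm (linearOp_mem_cliffordGroup hp hm g) (Pi.single x 1),
    tensorPow_mulVec_single (f := fun x => g.1 *ᵥ x) (c := fun _ => 1)]
  · simp
  · exact linearOp_apply g

end Average

/-! ### Quadratic Gauss sums and the number $a$. -/

section GaussSums

variable {p : ℕ}

theorem clifA_eq_two (h : p % 4 = 1) : clifA p = 2 := by
  rw [clifA, ← Nat.mod_add_div p 4, h, show 1 + 4 * (p / 4) + 1 = 2 + 4 * (p / 4) by ring,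
    Nat.gcd_add_mul_left_left]
  rfl

theorem clifA_eq_four (h : p % 4 = 3) : clifA p = 4 := by
  rw [clifA, ← Nat.mod_add_div p 4, h, show 3 + 4 * (p / 4) + 1 = 4 + 4 * (p / 4) by ring,
    Nat.gcd_add_mul_left_left]
  rfl

variable [Fact p.Prime]

/-- The quadratic Gauss sum `∑ ψ(t x²)`. -/
def quadSum (t : ZMod p) : ℂ := ∑ x : ZMod p, ψ (t * (x * x))

/-- Each $y$ has $1+\chi(y)$ square roots, $\chi$ being the quadratic character, and the
contribution of the $1$ vanishes because $\sum_y\psi(ty)=0$. -/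
theorem quadSum_eq_gaussSum (hp : p ≠ 2) {t : ZMod p} (ht : t ≠ 0) :
    quadSum t = gaussSum ((quadraticChar (ZMod p)).ringHomComp (Int.castRingHom ℂ))
      (AddChar.mulShift ψ t) := by
  have hchar : ringChar (ZMod p) ≠ 2 := by rwa [ZMod.ringChar_zmod_n]
  have h1 : quadSum t = ∑ a : ZMod p, ∑ x : ZMod p with x ^ 2 = a, ψ (t * a) := by
    rw [quadSum, ← Finset.sum_fiberwise (g := fun x : ZMod p => x ^ 2)]
    refine Finset.sum_congr rfl fun a _ => Finset.sum_congr rfl fun x hx => ?_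
    rw [← (Finset.mem_filter.1 hx).2, pow_two]
  have h2 (a : ZMod p) : ∑ x : ZMod p with x ^ 2 = a, ψ (t * a) =
      ((quadraticChar (ZMod p) a : ℤ) : ℂ) * ψ (t * a) + ψ (t * a) := by
    have h3 := quadraticChar_card_sqrts hchar a
    rw [Finset.sum_const, nsmul_eq_mul, ← add_one_mul]
    congr 1
    have h4 : (({x : ZMod p | x ^ 2 = a}.toFinset.card : ℤ) : ℂ) =
        ((quadraticChar (ZMod p) a + 1 : ℤ) : ℂ) := by rw [h3]
    rw [Set.toFinset_ofPred] at h4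
    exact_mod_cast h4
  have h5 : ∑ a : ZMod p, ψ (t * a) = 0 := by
    have := sum_psi_mul t
    rw [if_neg ht] at this
    rw [← this]
    exact Finset.sum_congr rfl fun a _ => by rw [mul_comm]
  rw [h1, Finset.sum_congr rfl fun a _ => h2 a, Finset.sum_add_distrib, h5, add_zero]
  rfl

theorem quadSum_sq (hp : p ≠ 2) {t : ZMod p} (ht : t ≠ 0) :
    quadSum t ^ 2 = ((ZMod.χ₄ p : ℤ) : ℂ) * p := by
  have hchar : ringChar (ZMod p) ≠ 2 := by rwa [ZMod.ringChar_zmod_n]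
  have hinj : Function.Injective (Int.castRingHom ℂ) := Int.cast_injective
  rw [quadSum_eq_gaussSum hp ht, gaussSum_sq]
  · rw [MulChar.ringHomComp_apply, quadraticChar_neg_one hchar, ZMod.card]
    rfl
  · intro h
    exact quadraticChar_ne_one hchar ((MulChar.ringHomComp_eq_one_iff hinj).1 h)
  · exact (quadraticChar_isQuadratic (ZMod p)).comp _
  · exact AddChar.IsPrimitive.of_ne_one fun h => by
      have := (AddChar.mulShift_unit_eq_one_iff ψ (Ne.isUnit ht)).1 h
      exact (ZMod.isPrimitive_stdAddChar p one_ne_zero) (by rw [AddChar.mulShift_one, this])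

theorem mod_four_cases (hp : p ≠ 2) : p % 4 = 1 ∨ p % 4 = 3 := by
  obtain ⟨k, hk⟩ := odd_prime hp
  omega

/-- The sign in the square of the Gauss sum detects divisibility by `a`. -/
theorem quadSum_pow_eq_iff (hp : p ≠ 2) {t : ZMod p} (ht : t ≠ 0) (n : ℕ) :
    quadSum t ^ (2 * n) = (p : ℂ) ^ n ↔ clifA p ∣ 2 * n := by
  have hp0 : (p : ℂ) ^ n ≠ 0 := pow_ne_zero _ prime_cast_ne_zero
  rw [pow_mul, quadSum_sq hp ht, mul_pow]
  -- The squared Gauss sum is $p$ or $-p$ according to $p$ modulo $4$, and $a$ is $2$ or $4$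
  -- accordingly: an even power $2n$ loses its sign exactly when $a\mid 2n$.
  rcases mod_four_cases hp with h | h
  · rw [ZMod.χ₄_nat_one_mod_four h, clifA_eq_two h]
    simp
  · rw [ZMod.χ₄_nat_three_mod_four h, clifA_eq_four h, mul_eq_right₀ hp0,
      show (4 : ℕ) = 2 * 2 from rfl, Nat.mul_dvd_mul_iff_left (by norm_num), ← even_iff_two_dvd]
    push_cast
    constructor
    · intro h1
      by_contra h2
      rw [(Nat.not_even_iff_odd.1 h2).neg_one_pow] at h1
      norm_num at h1
    · intro h1
      exact h1.neg_one_pow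

theorem sum_psi_dotProduct_self (N : ℕ) (t : ZMod p) :
    ∑ x : Fin N → ZMod p, ψ (t * (x ⬝ᵥ x)) = quadSum t ^ N := by
  have : quadSum t ^ N = ∏ _i : Fin N, ∑ x : ZMod p, ψ (t * (x * x)) := by simp [quadSum]
  rw [this, Finset.prod_univ_sum, Fintype.piFinset_univ]
  refine Finset.sum_congr rfl fun x _ => ?_
  rw [dotProduct, Finset.mul_sum, psi_sum]

end GaussSums

/-! ### Dual codes and Fourier sums over isotropic vectors. -/

section Codes

open scoped Classical

variable {p N : ℕ} {C D : Submodule (ZMod p) (Fin N → ZMod p)}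

theorem mem_dualCode {w : Fin N → ZMod p} : w ∈ dualCode C ↔ ∀ c ∈ C, c ⬝ᵥ w = 0 := Iff.rfl

theorem dualCode_anti (h : C ≤ D) : dualCode D ≤ dualCode C := fun _ hw c hc => hw c (h hc)

theorem IsSelfOrthogonal.dotProduct_eq_zero (hC : IsSelfOrthogonal C) {c d : Fin N → ZMod p}
    (hc : c ∈ C) (hd : d ∈ C) : c ⬝ᵥ d = 0 := hC hd c hc

theorem IsSelfDual.isSelfOrthogonal (hC : IsSelfDual C) : IsSelfOrthogonal C := le_of_eq hC

variable [Fact p.Prime]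

theorem dualCode_eq_orthogonal :
    dualCode C = (Matrix.toBilin' (1 : Matrix (Fin N) (Fin N) (ZMod p))).orthogonal C := by
  ext w
  rw [LinearMap.BilinForm.mem_orthogonal_iff, mem_dualCode]
  refine forall₂_congr fun c _ => ?_
  rw [Matrix.toBilin'_apply', Matrix.one_mulVec]

theorem toBilin'_one_nondegenerate :
    (Matrix.toBilin' (1 : Matrix (Fin N) (Fin N) (ZMod p))).Nondegenerate :=
  LinearMap.BilinForm.nondegenerate_toBilin'_of_det_ne_zero' _ (by simp)

theorem finrank_dualCode :
    Module.finrank (ZMod p) C + Module.finrank (ZMod p) (dualCode C) = N := by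
  have h := LinearMap.BilinForm.finrank_orthogonal (toBilin'_one_nondegenerate (p := p) (N := N)) C
  have h1 := Submodule.finrank_le C
  rw [Module.finrank_fin_fun] at h h1
  rw [dualCode_eq_orthogonal, h]
  omega

theorem dualCode_dualCode : dualCode (dualCode C) = C := by
  refine (Submodule.eq_of_le_of_finrank_eq (fun c hc w hw => ?_) ?_).symm
  · rw [dotProduct_comm]
    exact hw c hc
  · have h1 := finrank_dualCode (C := C)
    have h2 := finrank_dualCode (C := dualCode C)
    omega

theorem natCard_code (C : Submodule (ZMod p) (Fin N → ZMod p)) :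
    Nat.card C = p ^ Module.finrank (ZMod p) C := by
  rw [Module.natCard_eq_pow_finrank (K := ZMod p), Nat.card_zmod]

theorem sum_ite_mem_one (C : Submodule (ZMod p) (Fin N → ZMod p)) :
    (∑ j, if j ∈ C then (1 : ℂ) else 0) = p ^ Module.finrank (ZMod p) C := by
  rw [Finset.sum_boole, ← Nat.cast_pow, ← natCard_code, Nat.card_eq_fintype_card,
    Fintype.card_subtype]

/-- Translation of a sum over a code by a code word. -/
theorem sum_ite_mem_add {c : Fin N → ZMod p} (hc : c ∈ C) (f : (Fin N → ZMod p) → ℂ) :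
    (∑ j, if j ∈ C then f (j + c) else 0) = ∑ j, if j ∈ C then f j else 0 := by
  refine Fintype.sum_equiv (Equiv.addRight c) _ _ fun j => ?_
  rw [Equiv.coe_addRight]
  have : j + c ∈ C ↔ j ∈ C := Submodule.add_mem_iff_left _ hc
  simp only [this]

theorem sum_ite_mem_psi (C : Submodule (ZMod p) (Fin N → ZMod p)) (k : Fin N → ZMod p) :
    (∑ j, if j ∈ C then ψ (j ⬝ᵥ k) else 0) =
      if k ∈ dualCode C then (p : ℂ) ^ Module.finrank (ZMod p) C else 0 := by
  split_ifs with h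
  · rw [← sum_ite_mem_one]
    refine Finset.sum_congr rfl fun j _ => ?_
    split_ifs with hj
    · rw [h j hj, AddChar.map_zero_eq_one]
    · rfl
  · rw [mem_dualCode] at h
    push Not at h
    obtain ⟨c, hc, hck⟩ := h
    have h1 := sum_ite_mem_add hc fun j => ψ (j ⬝ᵥ k)
    simp only [add_dotProduct, AddChar.map_add_eq_mul] at h1
    have h2 : (∑ j, if j ∈ C then ψ (j ⬝ᵥ k) * ψ (c ⬝ᵥ k) else 0) =
        (∑ j, if j ∈ C then ψ (j ⬝ᵥ k) else 0) * ψ (c ⬝ᵥ k) := by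
      rw [Finset.sum_mul]
      exact Finset.sum_congr rfl fun j _ => by rw [ite_mul, zero_mul]
    rw [h2] at h1
    by_contra h0
    have h3 := mul_right_cancel₀ (b := _) h0 ((mul_comm _ _).trans (h1.trans (one_mul _).symm))
    rw [← AddChar.map_zero_eq_one (ψ : AddChar (ZMod p) ℂ)] at h3
    exact hck (ZMod.injective_stdAddChar h3)

/-- The Gauss sum of the whole space is concentrated on the dual of a self-orthogonal code. -/
theorem sum_ite_mem_dualCode_psi (hp : p ≠ 2) (hC : IsSelfOrthogonal C) {t : ZMod p}
    (ht : t ≠ 0) :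
    (∑ x, if x ∈ dualCode C then ψ (t * (x ⬝ᵥ x)) else 0) = quadSum t ^ N := by
  have h2 := two_ne_zero_zmod hp
  rw [← sum_psi_dotProduct_self]
  have hcard : (p : ℂ) ^ Module.finrank (ZMod p) C ≠ 0 := pow_ne_zero _ prime_cast_ne_zero
  refine mul_left_cancel₀ hcard ?_
  -- Translating by the isotropic vector $c$ only adds a linear phase; summing over $c\in C$ then
  -- retains just the $x\in C^\perp$.
  have key : ∀ c ∈ C, ∑ x : Fin N → ZMod p, ψ (t * (x ⬝ᵥ x)) =
      ∑ x, ψ (t * (x ⬝ᵥ x)) * ψ (c ⬝ᵥ ((2 * t) • x)) := by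
    intro c hc
    rw [← Equiv.sum_comp (Equiv.addRight c)]
    refine Finset.sum_congr rfl fun x _ => ?_
    rw [Equiv.coe_addRight, ← AddChar.map_add_eq_mul]
    congr 1
    simp only [add_dotProduct, dotProduct_add, hC.dotProduct_eq_zero hc hc, dotProduct_smul,
      smul_eq_mul]
    rw [dotProduct_comm x c]
    ring
  have h3 : ((p : ℂ) ^ Module.finrank (ZMod p) C) * ∑ x : Fin N → ZMod p, ψ (t * (x ⬝ᵥ x)) =
      ∑ c, if c ∈ C then ∑ x, ψ (t * (x ⬝ᵥ x)) * ψ (c ⬝ᵥ ((2 * t) • x)) else 0 := by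
    rw [← sum_ite_mem_one, Finset.sum_mul]
    refine Finset.sum_congr rfl fun c _ => ?_
    split_ifs with hc
    · rw [one_mul, key c hc]
    · rw [zero_mul]
  have h4 (c : Fin N → ZMod p) :
      (if c ∈ C then ∑ x, ψ (t * (x ⬝ᵥ x)) * ψ (c ⬝ᵥ ((2 * t) • x)) else 0) =
      ∑ x, ψ (t * (x ⬝ᵥ x)) * (if c ∈ C then ψ (c ⬝ᵥ ((2 * t) • x)) else 0) := by
    split_ifs <;> simp
  rw [h3, Finset.sum_congr rfl fun c _ => h4 c, Finset.sum_comm, Finset.mul_sum]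
  refine Finset.sum_congr rfl fun x _ => ?_
  rw [← Finset.mul_sum, sum_ite_mem_psi,
    Submodule.smul_mem_iff _ (mul_ne_zero h2 ht)]
  split_ifs <;> ring

theorem IsSelfDual.two_mul_finrank (hC : IsSelfDual C) : 2 * Module.finrank (ZMod p) C = N := by
  have h := finrank_dualCode (C := C)
  rw [← (show C = dualCode C from hC)] at h
  omega

/-- The length of a self-dual code is divisible by `a`. -/
theorem IsSelfDual.clifA_dvd (hp : p ≠ 2) (hC : IsSelfDual C) : clifA p ∣ N := by
  have h1 := sum_ite_mem_dualCode_psi hp hC.isSelfOrthogonal (one_ne_zero (α := ZMod p))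
  have h2 := hC.two_mul_finrank
  -- On $C^\perp=C$ all phases are trivial, so the $N$-th power of the Gauss sum is $p^{N/2}$.
  have h3 : (∑ x, if x ∈ dualCode C then ψ (1 * (x ⬝ᵥ x)) else 0) =
      (p : ℂ) ^ Module.finrank (ZMod p) C := by
    rw [← sum_ite_mem_one, ← (show C = dualCode C from hC)]
    refine Finset.sum_congr rfl fun x _ => ?_
    split_ifs with hx
    · rw [hC.isSelfOrthogonal.dotProduct_eq_zero hx hx, mul_zero, AddChar.map_zero_eq_one]
    · rfl
  rw [h3] at h1
  have h4 := (quadSum_pow_eq_iff hp (one_ne_zero (α := ZMod p))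
    (Module.finrank (ZMod p) C)).1 (by rw [h2]; exact h1.symm)
  rwa [h2] at h4

theorem IsSelfOrthogonal.prime_dvd (hC : IsSelfOrthogonal C) (h1 : (fun _ => 1) ∈ C) : p ∣ N := by
  have := hC.dotProduct_eq_zero h1 h1
  simp only [dotProduct, mul_one, Finset.sum_const, Finset.card_univ, Fintype.card_fin,
    nsmul_one] at this
  exact (ZMod.natCast_eq_zero_iff _ _).1 this

theorem isSelfDual_of_finrank (hC : IsSelfOrthogonal C)
    (h : 2 * Module.finrank (ZMod p) C = N) : IsSelfDual C :=
  Submodule.eq_of_le_of_finrank_eq hC (by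
    have := finrank_dualCode (C := C)
    omega)

theorem mem_sup_span_singleton_iff {k x : Fin N → ZMod p} :
    x ∈ C ⊔ Submodule.span (ZMod p) {k} ↔ ∃ c ∈ C, ∃ a : ZMod p, c + a • k = x := by
  simp only [Submodule.mem_sup, Submodule.mem_span_singleton, exists_exists_eq_and]

/-- The code spanned by a self-orthogonal code and an isotropic vector of its dual. -/
theorem IsSelfOrthogonal.sup_span (hC : IsSelfOrthogonal C) {k : Fin N → ZMod p}
    (hk : k ∈ dualCode C) (hkk : k ⬝ᵥ k = 0) : IsSelfOrthogonal (C ⊔ Submodule.span (ZMod p) {k}) := by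
  intro x hx y hy
  obtain ⟨c, hc, a, rfl⟩ := mem_sup_span_singleton_iff.1 hx
  obtain ⟨d, hd, b, rfl⟩ := mem_sup_span_singleton_iff.1 hy
  simp only [add_dotProduct, dotProduct_add, smul_dotProduct, dotProduct_smul, hkk, hk d hd,
    dotProduct_comm k c, hk c hc, hC.dotProduct_eq_zero hd hc]
  simp

/-- The isotropic vectors in the dual of a code. -/
def IsDualIsotropic (C : Submodule (ZMod p) (Fin N → ZMod p)) (k : Fin N → ZMod p) : Prop :=
  k ∈ dualCode C ∧ k ⬝ᵥ k = 0

/-- The Fourier transform of the set of isotropic vectors in the dual of a code. -/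
def isotropicSum (C : Submodule (ZMod p) (Fin N → ZMod p)) (k : Fin N → ZMod p) : ℂ :=
  ∑ j, if IsDualIsotropic C j then ψ (-(j ⬝ᵥ k)) else 0

/-- The isotropic vectors of $C^\perp$ form a set invariant under translation by $C$, so their
Fourier transform lives on $C^\perp$. -/
theorem isotropicSum_eq_zero (hC : IsSelfOrthogonal C) {k : Fin N → ZMod p}
    (hk : k ∉ dualCode C) : isotropicSum C k = 0 := by
  rw [mem_dualCode] at hk
  push Not at hk
  obtain ⟨c, hc, hck⟩ := hk
  have h1 : isotropicSum C k * ψ (-(c ⬝ᵥ k)) = isotropicSum C k := by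
    rw [isotropicSum, Finset.sum_mul]
    refine Fintype.sum_equiv (Equiv.addRight c) _ _ fun j => ?_
    rw [Equiv.coe_addRight]
    have : IsDualIsotropic C (j + c) ↔ IsDualIsotropic C j := by
      rw [IsDualIsotropic, IsDualIsotropic, Submodule.add_mem_iff_left _ (hC hc)]
      refine and_congr_right fun hj => ?_
      simp [add_dotProduct, dotProduct_add, hC.dotProduct_eq_zero hc hc, dotProduct_comm j c,
        hj c hc]
    simp only [this]
    split_ifs
    · rw [add_dotProduct, neg_add, AddChar.map_add_eq_mul]
    · rw [zero_mul]
  by_contra h0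
  have h3 := mul_left_cancel₀ h0 (h1.trans (mul_one _).symm)
  rw [← AddChar.map_zero_eq_one (ψ : AddChar (ZMod p) ℂ)] at h3
  exact hck (neg_eq_zero.1 (ZMod.injective_stdAddChar h3))

/-- Isotropy is detected by $\frac1p\sum_t\psi(t\,j\cdot j)$. The term $t=0$ is a character sum over
$C^\perp$, supported on $C^{\perp\perp}=C$; each of the $p-1$ others is a Gauss sum, equal to $p^n$
because $a\mid N$. -/
theorem isotropicSum_eq (hp : p ≠ 2) (hC : IsSelfOrthogonal C) {n : ℕ} (hN : N = 2 * n)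
    (ha : clifA p ∣ N) {k : Fin N → ZMod p} (hk : IsDualIsotropic C k) :
    (p : ℂ) * isotropicSum C k =
      (if k ∈ C then (p : ℂ) ^ Module.finrank (ZMod p) (dualCode C) else 0) +
        ((p : ℂ) - 1) * (p : ℂ) ^ n := by
  have h2 := two_ne_zero_zmod hp
  have h1 (j : Fin N → ZMod p) : (p : ℂ) * (if IsDualIsotropic C j then ψ (-(j ⬝ᵥ k)) else 0) =
      ∑ t : ZMod p, if j ∈ dualCode C then ψ (t * (j ⬝ᵥ j) + j ⬝ᵥ (-k)) else 0 := by
    by_cases hj : j ∈ dualCode C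
    · simp only [if_pos hj, AddChar.map_add_eq_mul]
      rw [← Finset.sum_mul, sum_psi_mul, dotProduct_neg]
      simp [IsDualIsotropic, hj]
    · simp [IsDualIsotropic, hj]
  have h3 (t : ZMod p) (ht : t ≠ 0) :
      (∑ j, if j ∈ dualCode C then ψ (t * (j ⬝ᵥ j) + j ⬝ᵥ (-k)) else 0) = (p : ℂ) ^ n := by
    have h4 := (quadSum_pow_eq_iff hp ht n).2 (by rwa [← hN])
    rw [← h4, ← hN, ← sum_ite_mem_dualCode_psi hp hC ht,
      -- Translation by $k/(2t)$ completes the square, with no constant left since $k$ is isotropic.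
      ← sum_ite_mem_add (Submodule.smul_mem _ ((2 * t)⁻¹) hk.1)]
    refine Finset.sum_congr rfl fun j _ => ?_
    split_ifs
    · congr 1
      simp only [add_dotProduct, dotProduct_add, smul_dotProduct, dotProduct_smul, hk.2,
        dotProduct_neg, smul_eq_mul, dotProduct_comm k j]
      field_simp
      ring
    · rfl
  rw [isotropicSum, Finset.mul_sum, Finset.sum_congr rfl fun j _ => h1 j, Finset.sum_comm,
    ← Finset.add_sum_erase _ _ (Finset.mem_univ 0),
    Finset.sum_congr rfl fun t ht => h3 t (Finset.ne_of_mem_erase ht), Finset.sum_const,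
    Finset.card_erase_of_mem (Finset.mem_univ _), Finset.card_univ, ZMod.card]
  congr 1
  · simp only [zero_mul, zero_add]
    rw [sum_ite_mem_psi, dualCode_dualCode, Submodule.neg_mem_iff]
  · rw [nsmul_eq_mul, Nat.cast_sub (Fact.out : p.Prime).one_le, Nat.cast_one]

end Codes

open scoped Classical

/-! ### Code vectors: invariance and the averaging recursion. -/

section CodeVectors

variable {p m N : ℕ} [Fact p.Prime] {C : Submodule (ZMod p) (Fin N → ZMod p)}

/-- The tensors of vectors all of whose rows lie in the code. -/
def codeRows (m : ℕ) (C : Submodule (ZMod p) (Fin N → ZMod p)) :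
    Submodule (ZMod p) (Fin N → Fin m → ZMod p) where
  carrier := {x | ∀ l, (fun i => x i l) ∈ C}
  zero_mem' _ := zero_mem C
  add_mem' hx hy l := add_mem (hx l) (hy l)
  smul_mem' t _ hx l := C.smul_mem t (hx l)

theorem dotProduct_mem_of_mem_codeRows {x : Fin N → Fin m → ZMod p} (hx : x ∈ codeRows m C)
    (b : Fin m → ZMod p) : (fun i => b ⬝ᵥ x i) ∈ C := by
  have : (fun i => b ⬝ᵥ x i) = ∑ l, b l • fun i => x i l := by
    ext i
    simp [dotProduct]
  rw [this]
  exact sum_mem fun l _ => C.smul_mem _ (hx l)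

/-- The tensor of two vectors. -/
def outer (c : Fin N → ZMod p) (a : Fin m → ZMod p) : Fin N → Fin m → ZMod p := fun i => c i • a

theorem outer_mem_codeRows {c : Fin N → ZMod p} (hc : c ∈ C) (a : Fin m → ZMod p) :
    outer c a ∈ codeRows m C := fun l => by
  have : (fun i => outer c a i l) = a l • c := by
    ext i
    simp [outer, mul_comm]
  rw [this]
  exact C.smul_mem _ hc

/-- The indicator function of the extended code. -/
def codeVector (m : ℕ) (C : Submodule (ZMod p) (Fin N → ZMod p)) :
    (Fin N → Fin m → ZMod p) → ℂ := fun x => if x ∈ codeRows m C then 1 else 0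

theorem tensorMatrix_weyl_mulVec (u : Fin N → Phase p m) (φ : (Fin N → Fin m → ZMod p) → ℂ)
    (y : Fin N → Fin m → ZMod p) :
    (tensorMatrix (fun i => weyl (u i)) *ᵥ φ) y =
      ψ (∑ i, ((u i ∘ Sum.inr) ⬝ᵥ (y i - u i ∘ Sum.inl) +
        2⁻¹ * ((u i ∘ Sum.inl) ⬝ᵥ (u i ∘ Sum.inr)))) * φ (fun i => y i - u i ∘ Sum.inl) := by
  rw [Matrix.mulVec, dotProduct, Finset.sum_eq_single (fun i => y i - u i ∘ Sum.inl)]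
  · congr 1
    rw [tensorMatrix_apply, psi_sum]
    refine Finset.prod_congr rfl fun i _ => ?_
    rw [weyl_apply, if_pos (sub_add_cancel _ _).symm]
  · intro x _ hx
    obtain ⟨i, hi⟩ := Function.ne_iff.1 hx
    rw [tensorMatrix_apply, Finset.prod_eq_zero (Finset.mem_univ i), zero_mul]
    rw [weyl_apply, if_neg]
    intro h
    exact hi (eq_sub_of_add_eq h.symm)
  · simp

/-- The code vector of a self-orthogonal code is fixed by the Weyl operators of the code. -/
theorem tensorMatrix_weyl_codeVector (hC : IsSelfOrthogonal C) {c : Fin N → ZMod p} (hc : c ∈ C)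
    (u : Phase p m) :
    tensorMatrix (fun i => weyl (c i • u)) *ᵥ codeVector m C = codeVector m C := by
  ext y
  rw [tensorMatrix_weyl_mulVec]
  simp only [comp_smul_fun]
  have h1 : (fun i => y i - c i • (u ∘ Sum.inl)) = y - outer c (u ∘ Sum.inl) := rfl
  have h2 : y - outer c (u ∘ Sum.inl) ∈ codeRows m C ↔ y ∈ codeRows m C :=
    Submodule.sub_mem_iff_left _ (outer_mem_codeRows hc _)
  rw [h1, codeVector, codeVector]
  simp only [h2]
  split_ifs with hy
  · rw [mul_one]
    have h3 := hC.dotProduct_eq_zero hc (dotProduct_mem_of_mem_codeRows hy (u ∘ Sum.inr))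
    have h4 := hC.dotProduct_eq_zero hc hc
    convert AddChar.map_zero_eq_one _
    -- The total phase splits into the product of $c$ with a row combination of $y$, which lies in
    -- $C$, and a multiple of $c\cdot c$; both vanish by self-orthogonality.
    have h5 : ∀ i, (c i • u ∘ Sum.inr) ⬝ᵥ (y i - c i • u ∘ Sum.inl) +
        2⁻¹ * ((c i • u ∘ Sum.inl) ⬝ᵥ (c i • u ∘ Sum.inr)) =
        c i * ((u ∘ Sum.inr) ⬝ᵥ y i) + (c i * c i) *
          (2⁻¹ * ((u ∘ Sum.inl) ⬝ᵥ (u ∘ Sum.inr)) - (u ∘ Sum.inr) ⬝ᵥ (u ∘ Sum.inl)) := by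
      intro i
      simp only [dotProduct_sub, smul_dotProduct, dotProduct_smul, smul_eq_mul]
      ring
    rw [Finset.sum_congr rfl fun i _ => h5 i, Finset.sum_add_distrib, ← Finset.sum_mul]
    change c ⬝ᵥ (fun i => (u ∘ Sum.inr) ⬝ᵥ y i) + (c ⬝ᵥ c) * _ = 0
    rw [h3, h4, zero_mul, add_zero]
  · rw [mul_zero]

/-- The operator $\bigotimes_iW(c_iu)$ fixes the code vector but acts on the joint eigenspace of
label $j$ by $\psi(c\cdot j)$, which is not $1$ for some $c\in C$. -/
theorem tensorMatrix_weylProj_codeVector (hp : p ≠ 2) (hC : IsSelfOrthogonal C)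
    {j : Fin N → ZMod p} (hj : j ∉ dualCode C) (u : Phase p m) :
    tensorMatrix (fun i => weylProj u (j i)) *ᵥ codeVector m C = 0 := by
  rw [mem_dualCode] at hj
  push Not at hj
  obtain ⟨c, hc, hcj⟩ := hj
  have h1 : tensorMatrix (fun i => weylProj u (j i)) *ᵥ codeVector m C =
      ψ (c ⬝ᵥ j) • (tensorMatrix (fun i => weylProj u (j i)) *ᵥ codeVector m C) := by
    conv_lhs => rw [← tensorMatrix_weyl_codeVector hC hc u, Matrix.mulVec_mulVec, tensorMatrix_mul]
    simp only [weylProj_mul_weyl_smul hp]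
    rw [tensorMatrix_smul (fun i => ψ (j i * c i)), Matrix.smul_mulVec, ← psi_sum,
      dotProduct_comm]
    rfl
  have h2 : ψ (c ⬝ᵥ j) - 1 ≠ 0 := by
    intro h
    rw [sub_eq_zero, ← AddChar.map_zero_eq_one (ψ : AddChar (ZMod p) ℂ)] at h
    exact hcj (ZMod.injective_stdAddChar h)
  have h3 : (ψ (c ⬝ᵥ j) - 1) • (tensorMatrix (fun i => weylProj u (j i)) *ᵥ codeVector m C) = 0 := by
    rw [sub_smul, one_smul, ← h1, sub_self]
  exact (smul_eq_zero.1 h3).resolve_left h2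

theorem tensorPow_transvectionOp (u : Phase p m) (c : ZMod p) :
    tensorPow N (transvectionOp u c) =
      ∑ j : Fin N → ZMod p, ψ (c * (j ⬝ᵥ j)) • tensorMatrix fun i => weylProj u (j i) := by
  rw [tensorPow]
  simp only [transvectionOp]
  rw [tensorMatrix_sum]
  refine Finset.sum_congr rfl fun j _ => ?_
  rw [tensorMatrix_smul (fun i => ψ (c * (j i * j i))), ← psi_sum, dotProduct, Finset.mul_sum]

/-- Only labels $j\in C^\perp=C$ contribute, and these have phase $\psi(c\,j\cdot j)=1$. The result
is independent of $c$, and $c=0$ gives the identity. -/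
theorem tensorPow_transvectionOp_codeVector (hp : p ≠ 2) (hC : IsSelfDual C) (u : Phase p m)
    (c : ZMod p) : tensorPow N (transvectionOp u c) *ᵥ codeVector m C = codeVector m C := by
  have key (d : ZMod p) : tensorPow N (transvectionOp u d) *ᵥ codeVector m C =
      ∑ j : Fin N → ZMod p, tensorMatrix (fun i => weylProj u (j i)) *ᵥ codeVector m C := by
    rw [tensorPow_transvectionOp, Matrix.sum_mulVec]
    refine Finset.sum_congr rfl fun j _ => ?_
    rw [Matrix.smul_mulVec]
    by_cases hj : j ∈ dualCode C
    · rw [← (show C = dualCode C from hC)] at hj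
      rw [hC.isSelfOrthogonal.dotProduct_eq_zero hj hj, mul_zero, AddChar.map_zero_eq_one, one_smul]
    · rw [tensorMatrix_weylProj_codeVector hp hC.isSelfOrthogonal hj, smul_zero]
  rw [key c, ← key 0, transvectionOp_zero, tensorPow, tensorMatrix_one, Matrix.one_mulVec]

theorem tensorPow_transvectionGroup_codeVector (hp : p ≠ 2) (hC : IsSelfDual C)
    {t : Matrix.unitaryGroup (Fin m → ZMod p) ℂ} (ht : t ∈ transvectionGroup m hp) :
    tensorPow N (t : Matrix (Fin m → ZMod p) (Fin m → ZMod p) ℂ) *ᵥ codeVector m C =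
      codeVector m C := by
  induction ht using Subgroup.closure_induction with
  | mem x hx =>
    obtain ⟨y, rfl⟩ := hx
    exact tensorPow_transvectionOp_codeVector hp hC _ _
  | one => rw [Submonoid.coe_one, tensorPow, tensorMatrix_one, Matrix.one_mulVec]
  | mul x y _ _ hx hy => rw [Submonoid.coe_mul, tensorPow_mul, ← Matrix.mulVec_mulVec, hy, hx]
  | inv x _ hx =>
    conv_lhs => rw [← hx, Matrix.mulVec_mulVec, ← tensorPow_mul, ← Submonoid.coe_mul,
      inv_mul_cancel, Submonoid.coe_one]
    rw [tensorPow, tensorMatrix_one, Matrix.one_mulVec]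

/-- The code vector of a self-dual code containing the all-ones vector is invariant under the
Clifford group. -/
theorem tensorPow_codeVector (hp : p ≠ 2) (hm : 1 ≤ m) (hC : IsSelfDual C)
    (h1 : (fun _ => 1) ∈ C) {g : Matrix.unitaryGroup (Fin m → ZMod p) ℂ}
    (hg : g ∈ cliffordGroup p m) :
    tensorPow N (g : Matrix (Fin m → ZMod p) (Fin m → ZMod p) ℂ) *ᵥ codeVector m C =
      codeVector m C := by
  obtain ⟨A, hA, hgA⟩ := exists_implements hp hm (cliffordGroup_le_normalizer hg)
  obtain ⟨t, ht, htA⟩ := exists_transvectionGroup_implements hp hA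
  obtain ⟨k, w, rfl⟩ := exists_eq_mul_rootScalar_mul_heis hp hm hg hgA ht htA
  have hN : clifA p * p ∣ N := Nat.Coprime.mul_dvd_of_dvd_of_dvd (clifA_coprime_prime hp)
    (hC.clifA_dvd hp) (hC.isSelfOrthogonal.prime_dvd h1)
  have hw := tensorMatrix_weyl_codeVector hC.isSelfOrthogonal h1 w
  simp only [one_smul] at hw
  have hk : ψ k.toAdd ^ N = 1 := by
    obtain ⟨d, hd⟩ := hN
    rw [hd, pow_mul, stdAddChar_pow, one_pow]
  rw [Submonoid.coe_mul, Submonoid.coe_mul, tensorPow_mul, tensorPow_mul, ← Matrix.mulVec_mulVec,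
    ← Matrix.mulVec_mulVec, coe_heis, AddChar.map_zero_eq_one, one_smul, tensorPow, tensorPow,
    tensorPow, hw]
  have h3 := tensorPow_rootScalar (N := N) _ k (codeVector m C)
  rw [tensorPow] at h3
  rw [h3, hk, one_smul]
  exact tensorPow_transvectionGroup_codeVector hp hC ht

theorem tensorAverage_codeVector_of_isSelfDual (hp : p ≠ 2) (hm : 1 ≤ m) (hC : IsSelfDual C)
    (h1 : (fun _ => 1) ∈ C) : tensorAverage p m N (codeVector m C) = codeVector m C :=
  tensorAverage_of_invariant hp hm fun _ hg => tensorPow_codeVector hp hm hC h1 hg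

/-- The translate of the code vector by a tensor. -/
def shiftVector (C : Submodule (ZMod p) (Fin N → ZMod p)) (a : Fin m → ZMod p)
    (k : Fin N → ZMod p) : (Fin N → Fin m → ZMod p) → ℂ := fun y => codeVector m C (y - outer k a)

theorem shiftVector_of_mem {k : Fin N → ZMod p} (hk : k ∈ C) (a : Fin m → ZMod p) :
    shiftVector C a k = codeVector m C := by
  ext y
  rw [shiftVector, codeVector, codeVector]
  congr 1
  exact propext (Submodule.sub_mem_iff_left _ (outer_mem_codeRows hk _))

theorem shiftVector_zero (k : Fin N → ZMod p) :
    shiftVector C (0 : Fin m → ZMod p) k = codeVector m C := by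
  ext y
  have : outer k (0 : Fin m → ZMod p) = 0 := by
    ext i
    simp [outer]
  rw [shiftVector, this, sub_zero]

/-- Row by row, a word over $C+\langle k\rangle$ is a word over $C$ plus a multiple of $k$, uniquely
since $k\notin C$; the $m$ multiples form $a$. -/
theorem sum_shiftVector {k : Fin N → ZMod p} (hk : k ∉ C) :
    ∑ a : Fin m → ZMod p, shiftVector C a k =
      codeVector m (C ⊔ Submodule.span (ZMod p) {k}) := by
  ext y
  rw [Finset.sum_apply]
  simp only [shiftVector, codeVector]
  by_cases hy : y ∈ codeRows m (C ⊔ Submodule.span (ZMod p) {k})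
  · rw [if_pos hy]
    have h1 : ∀ l, ∃ c ∈ C, ∃ a : ZMod p, c + a • k = fun i => y i l := fun l =>
      mem_sup_span_singleton_iff.1 (hy l)
    choose c hc a ha using h1
    rw [Finset.sum_eq_single a, if_pos]
    · intro l
      have : (fun i => (y - outer k a) i l) = c l := by
        ext i
        have := congrFun (ha l) i
        simp only [Pi.add_apply, Pi.smul_apply, smul_eq_mul] at this
        simp only [Pi.sub_apply, outer, Pi.smul_apply, smul_eq_mul, ← this]
        ring
      rw [this]
      exact hc l
    · intro b _ hb
      rw [if_neg]
      intro hmem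
      obtain ⟨l, hl⟩ := Function.ne_iff.1 hb
      have h2 := sub_mem (hmem l) (hc l)
      have h3 : (fun i => (y - outer k b) i l) - c l = (a l - b l) • k := by
        ext i
        have := congrFun (ha l) i
        simp only [Pi.add_apply, Pi.smul_apply, smul_eq_mul] at this
        simp only [Pi.sub_apply, outer, Pi.smul_apply, smul_eq_mul, ← this]
        ring
      rw [h3, Submodule.smul_mem_iff _ (sub_ne_zero.2 (Ne.symm hl))] at h2
      exact hk h2
    · simp
  · rw [if_neg hy]
    refine Finset.sum_eq_zero fun a _ => if_neg fun hmem => hy fun l => ?_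
    refine mem_sup_span_singleton_iff.2 ⟨_, hmem l, a l, ?_⟩
    ext i
    simp only [Pi.add_apply, Pi.smul_apply, smul_eq_mul, Pi.sub_apply, outer]
    ring

/-- Choosing $b$ with $b\cdot a=1$, each $y$ in the support has a row combination $r+k$ with $r\in
C$, of norm $k\cdot k\ne0$; so each basis tensor averages to zero. -/
theorem tensorAverage_shiftVector_eq_zero (hp : p ≠ 2) (hm : 1 ≤ m) (hC : IsSelfOrthogonal C)
    {a : Fin m → ZMod p} (ha : a ≠ 0) {k : Fin N → ZMod p} (hk : k ∈ dualCode C)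
    (hkk : k ⬝ᵥ k ≠ 0) : tensorAverage p m N (shiftVector C a k) = 0 := by
  rw [tensorAverage_eq_sum]
  refine Finset.sum_eq_zero fun y _ => ?_
  by_cases hy : y - outer k a ∈ codeRows m C
  · obtain ⟨l, hl⟩ := Function.ne_iff.1 ha
    set b : Fin m → ZMod p := Pi.single l (a l)⁻¹ with hb
    have hba : b ⬝ᵥ a = 1 := by
      rw [hb, single_dotProduct, inv_mul_cancel₀ hl]
    set r : Fin N → ZMod p := fun i => b ⬝ᵥ (y - outer k a) i with hr
    have hrC : r ∈ C := dotProduct_mem_of_mem_codeRows hy b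
    have h1 : (fun i => b ⬝ᵥ y i) = r + k := by
      ext i
      rw [hr, Pi.add_apply, Pi.sub_apply, outer, dotProduct_sub, dotProduct_smul, hba, smul_eq_mul,
        mul_one, sub_add_cancel]
    rw [tensorAverage_single_eq_zero_of_norm_ne hp hm (b := b), smul_zero]
    rw [h1]
    simp only [add_dotProduct, dotProduct_add, hC.dotProduct_eq_zero hrC hrC,
      dotProduct_comm k r, hk r hrC]
    simpa using hkk
  · rw [shiftVector, codeVector, if_neg hy, zero_smul]

theorem tensorMatrix_weylProj_inl_codeVector (a : Fin m → ZMod p) (j : Fin N → ZMod p) :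
    tensorMatrix (fun i => weylProj (Sum.elim a (0 : Fin m → ZMod p)) (j i)) *ᵥ codeVector m C =
      ((p : ℂ) ^ N)⁻¹ • ∑ k : Fin N → ZMod p, ψ (-(j ⬝ᵥ k)) • shiftVector C a k := by
  simp only [weylProj]
  rw [tensorMatrix_smul (fun _ => (p : ℂ)⁻¹), tensorMatrix_sum, Matrix.smul_mulVec,
    Matrix.sum_mulVec]
  congr 1
  · simp
  · refine Finset.sum_congr rfl fun k _ => ?_
    rw [tensorMatrix_smul (fun i => ψ (-(j i * k i))), Matrix.smul_mulVec, ← psi_sum, dotProduct,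
      Finset.sum_neg_distrib]
    congr 1
    ext y
    rw [tensorMatrix_weyl_mulVec]
    simp only [comp_smul_fun, Sum.elim_comp_inl, Sum.elim_comp_inr]
    simp only [smul_zero, zero_dotProduct, dotProduct_zero, mul_zero, add_zero,
      Finset.sum_const_zero, AddChar.map_zero_eq_one, one_mul]
    rfl

/-- Averaging over the transvections along one translation direction. -/
theorem tensorAverage_codeVector_eq_sum (hp : p ≠ 2) (hm : 1 ≤ m) (hC : IsSelfOrthogonal C)
    (a : Fin m → ZMod p) :
    ((p : ℂ) ^ N) • tensorAverage p m N (codeVector m C) =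
      ∑ k, isotropicSum C k • tensorAverage p m N (shiftVector C a k) := by
  set u : Phase p m := Sum.elim a (0 : Fin m → ZMod p) with hu
  -- No transvection operator changes the average. Summing over the parameter $c$ turns
  -- $\psi(c\,j\cdot j)$ into $p$ times the indicator of isotropy, and the eigenprojections for
  -- $(a,0)$ expand into translates of the code vector.
  have h1 : (p : ℂ) • tensorAverage p m N (codeVector m C) =
      ∑ c : ZMod p, tensorAverage p m N (tensorPow N (transvectionOp u c) *ᵥ codeVector m C) := by
    have (c : ZMod p) : tensorAverage p m N (tensorPow N (transvectionOp u c) *ᵥ codeVector m C) =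
        tensorAverage p m N (codeVector m C) :=
      tensorAverage_act hp hm (transvectionU_mem_cliffordGroup hp hm u c) _
    simp only [this]
    rw [Finset.sum_const, Finset.card_univ, ZMod.card, Nat.cast_smul_eq_nsmul]
  have h2 : ∑ c : ZMod p, tensorPow N (transvectionOp u c) *ᵥ codeVector m C =
      (p : ℂ) • ((p : ℂ) ^ N)⁻¹ • ∑ k, isotropicSum C k • shiftVector C a k := by
    have h3 (c : ZMod p) : tensorPow N (transvectionOp u c) *ᵥ codeVector m C =
        ∑ j : Fin N → ZMod p, ψ (c * (j ⬝ᵥ j)) •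
          (tensorMatrix (fun i => weylProj u (j i)) *ᵥ codeVector m C) := by
      rw [tensorPow_transvectionOp, Matrix.sum_mulVec]
      exact Finset.sum_congr rfl fun j _ => Matrix.smul_mulVec ..
    have h4 (j : Fin N → ZMod p) : ∑ c : ZMod p, ψ (c * (j ⬝ᵥ j)) •
          (tensorMatrix (fun i => weylProj u (j i)) *ᵥ codeVector m C) =
        (p : ℂ) • ((p : ℂ) ^ N)⁻¹ • ∑ k : Fin N → ZMod p,
          (if IsDualIsotropic C j then ψ (-(j ⬝ᵥ k)) else 0) • shiftVector C a k := by
      rw [← Finset.sum_smul, sum_psi_mul]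
      by_cases hj : IsDualIsotropic C j
      · simp only [if_pos hj]
        rw [if_pos hj.2, hu, tensorMatrix_weylProj_inl_codeVector]
      · simp only [if_neg hj, zero_smul, Finset.sum_const_zero, smul_zero]
        by_cases hj2 : j ∈ dualCode C
        · rw [if_neg (fun h => hj ⟨hj2, h⟩), zero_smul]
        · rw [tensorMatrix_weylProj_codeVector hp hC hj2, smul_zero]
    rw [Finset.sum_congr rfl fun c _ => h3 c, Finset.sum_comm,
      Finset.sum_congr rfl fun j _ => h4 j, ← Finset.smul_sum, ← Finset.smul_sum, Finset.sum_comm]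
    simp only [isotropicSum, Finset.sum_smul]
  rw [← map_sum, h2, map_smul] at h1
  have hp0 : (p : ℂ) ≠ 0 := prime_cast_ne_zero
  have h5 := smul_right_injective _ hp0 h1
  rw [h5, map_smul, smul_smul, mul_inv_cancel₀ (pow_ne_zero _ hp0), one_smul, map_sum]
  exact Finset.sum_congr rfl fun k _ => map_smul _ _ _

/-- The recursion for the averages of code vectors. -/
theorem tensorAverage_codeVector_recursion (hp : p ≠ 2) (hm : 1 ≤ m) (hC : IsSelfOrthogonal C) :
    (((p : ℂ) ^ m - 1) * (p : ℂ) ^ N) • tensorAverage p m N (codeVector m C) =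
      ∑ k, if IsDualIsotropic C k then isotropicSum C k •
        (if k ∈ C then ((p : ℂ) ^ m - 1) • tensorAverage p m N (codeVector m C)
        else tensorAverage p m N (codeVector m (C ⊔ Submodule.span (ZMod p) {k})) -
          tensorAverage p m N (codeVector m C)) else 0 := by
  have hcard : ((Finset.univ.erase (0 : Fin m → ZMod p)).card : ℂ) = (p : ℂ) ^ m - 1 := by
    rw [Finset.card_erase_of_mem (Finset.mem_univ _), Finset.card_univ, Nat.cast_sub
      Fintype.card_pos]
    simp [ZMod.card]
  have h1 : (((p : ℂ) ^ m - 1) * (p : ℂ) ^ N) • tensorAverage p m N (codeVector m C) =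
      ∑ a ∈ Finset.univ.erase (0 : Fin m → ZMod p),
        ∑ k, isotropicSum C k • tensorAverage p m N (shiftVector C a k) := by
    rw [← Finset.sum_congr rfl fun a _ => tensorAverage_codeVector_eq_sum hp hm hC a,
      Finset.sum_const, ← Nat.cast_smul_eq_nsmul ℂ, smul_smul, hcard]
  rw [h1, Finset.sum_comm]
  refine Finset.sum_congr rfl fun k _ => ?_
  rw [← Finset.smul_sum]
  by_cases hk : k ∈ dualCode C
  · by_cases hkk : k ⬝ᵥ k = 0
    · rw [if_pos ⟨hk, hkk⟩]
      congr 1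
      split_ifs with hkC
      · simp only [shiftVector_of_mem hkC]
        rw [Finset.sum_const, ← Nat.cast_smul_eq_nsmul ℂ, hcard]
      -- The sum over $a\ne0$ is the whole sum, which is the vector of $C+\langle k\rangle$, minus
      -- the untranslated term $a=0$.
      · rw [← sum_shiftVector hkC, map_sum, ← Finset.add_sum_erase _ _ (Finset.mem_univ 0),
          shiftVector_zero, add_sub_cancel_left]
    · rw [if_neg (fun h => hkk h.2), Finset.sum_eq_zero, smul_zero]
      intro a ha
      exact tensorAverage_shiftVector_eq_zero hp hm hC (Finset.ne_of_mem_erase ha) hk hkk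
  · rw [isotropicSum_eq_zero hC hk, zero_smul, if_neg (fun h => hk h.1)]

end CodeVectors

/-! ### Solving the recursion: the averaging formula. -/

section AveragingFormula

variable {p m N : ℕ} [Fact p.Prime] {C : Submodule (ZMod p) (Fin N → ZMod p)}

/-- The self-dual codes containing a given code. -/
def selfDualAbove (C : Submodule (ZMod p) (Fin N → ZMod p)) :
    Finset (Submodule (ZMod p) (Fin N → ZMod p)) :=
  (Set.toFinite {C' | IsSelfDual C' ∧ C ≤ C'}).toFinset

theorem mem_selfDualAbove {C' : Submodule (ZMod p) (Fin N → ZMod p)} :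
    C' ∈ selfDualAbove C ↔ IsSelfDual C' ∧ C ≤ C' := by
  rw [selfDualAbove, Set.Finite.mem_toFinset]
  rfl

theorem selfDualAbove_eq_empty (hp : p ≠ 2) (h : ¬ clifA p ∣ N) : selfDualAbove C = ∅ :=
  Finset.eq_empty_of_forall_notMem fun _ hC' => h ((mem_selfDualAbove.1 hC').1.clifA_dvd hp)

theorem selfDualAbove_of_isSelfDual (hC : IsSelfDual C) : selfDualAbove C = {C} := by
  ext C'
  rw [mem_selfDualAbove, Finset.mem_singleton]
  constructor
  · rintro ⟨h1, h2⟩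
    refine (Submodule.eq_of_le_of_finrank_eq h2 ?_).symm
    have := hC.two_mul_finrank
    have := h1.two_mul_finrank
    omega
  · rintro rfl
    exact ⟨hC, le_refl _⟩

/-- A code word of a self-dual code above `C` is isotropic in the dual of `C`. -/
theorem isDualIsotropic_of_mem {C' : Submodule (ZMod p) (Fin N → ZMod p)}
    (hC' : C' ∈ selfDualAbove C) {k : Fin N → ZMod p} (hk : k ∈ C') : IsDualIsotropic C k := by
  rw [mem_selfDualAbove] at hC'
  have hso := hC'.1.isSelfOrthogonal
  exact ⟨dualCode_anti hC'.2 (hso hk), hso.dotProduct_eq_zero hk hk⟩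

theorem mem_selfDualAbove_sup {C' : Submodule (ZMod p) (Fin N → ZMod p)} {k : Fin N → ZMod p} :
    C' ∈ selfDualAbove (C ⊔ Submodule.span (ZMod p) {k}) ↔ C' ∈ selfDualAbove C ∧ k ∈ C' := by
  rw [mem_selfDualAbove, mem_selfDualAbove, sup_le_iff, Submodule.span_singleton_le_iff_mem,
    and_assoc]

theorem finrank_sup_span {k : Fin N → ZMod p} (hk : k ∉ C) :
    Module.finrank (ZMod p) ↥(C ⊔ Submodule.span (ZMod p) {k}) =
      Module.finrank (ZMod p) C + 1 := by
  have h0 : k ≠ 0 := fun h => hk (h ▸ zero_mem C)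
  have h1 := Submodule.finrank_sup_add_finrank_inf_eq C (Submodule.span (ZMod p) {k})
  have h2 : C ⊓ Submodule.span (ZMod p) {k} = ⊥ := by
    rw [eq_bot_iff]
    rintro v ⟨hv1, hv2⟩
    obtain ⟨a, rfl⟩ := Submodule.mem_span_singleton.1 hv2
    by_cases ha : a = 0
    · simp [ha]
    · exact absurd ((Submodule.smul_mem_iff _ ha).1 hv1) hk
  rw [h2, finrank_bot, finrank_span_singleton h0] at h1
  exact h1

/-- Every isotropic $k\in C^\perp\setminus C$ gives a code $C+\langle k\rangle$ of codimension one
less, to which induction applies. The recursion is then a linear equation for the average with a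
nonzero coefficient. -/
theorem tensorAverage_codeVector_of_dvd (hp : p ≠ 2) (hm : 1 ≤ m) {n : ℕ} (hN : N = 2 * n)
    (ha : clifA p ∣ N) (r : ℕ) (C : Submodule (ZMod p) (Fin N → ZMod p))
    (hC : IsSelfOrthogonal C) (h1 : (fun _ => 1) ∈ C) (hr : Module.finrank (ZMod p) C + r = n) :
    tensorAverage p m N (codeVector m C) =
      (∏ i ∈ Finset.range r, ((p : ℂ) ^ m + (p : ℂ) ^ i)⁻¹) •
        ∑ C' ∈ selfDualAbove C, codeVector m C' := by
  induction r generalizing C with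
  | zero =>
    have hsd : IsSelfDual C := isSelfDual_of_finrank hC (by omega)
    rw [selfDualAbove_of_isSelfDual hsd, Finset.sum_singleton, Finset.prod_range_zero, one_smul]
    exact tensorAverage_codeVector_of_isSelfDual hp hm hsd h1
  | succ r ih =>
    have hrec := tensorAverage_codeVector_recursion (m := m) hp hm hC
    set A := tensorAverage p m N (codeVector m C) with hA
    set S := ∑ C' ∈ selfDualAbove C, codeVector m C' with hS
    set Q := ∏ i ∈ Finset.range r, ((p : ℂ) ^ m + (p : ℂ) ^ i)⁻¹ with hQ
    set e := Module.finrank (ZMod p) C with he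
    have hp0 : (p : ℂ) ≠ 0 := prime_cast_ne_zero
    have hn : n = e + r + 1 := by omega
    have hdual : Module.finrank (ZMod p) (dualCode C) = e + 2 * r + 2 := by
      have := finrank_dualCode (C := C)
      omega
    set s₀ : ℂ := (p : ℂ) ^ (e + 2 * r + 1) + ((p : ℂ) - 1) * (p : ℂ) ^ (e + r) with hs₀
    set s₁ : ℂ := ((p : ℂ) - 1) * (p : ℂ) ^ (e + r) with hs₁
    have hsum {k : Fin N → ZMod p} (hk : IsDualIsotropic C k) :
        isotropicSum C k = if k ∈ C then s₀ else s₁ := by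
      have h2 := isotropicSum_eq hp hC hN ha hk
      rw [hdual, hn] at h2
      refine mul_left_cancel₀ hp0 (h2.trans ?_)
      split_ifs
      · rw [hs₀]; ring
      · rw [hs₁]; ring
    have hiso {k : Fin N → ZMod p} (hk : k ∈ C) : IsDualIsotropic C k :=
      ⟨hC hk, hC.dotProduct_eq_zero hk hk⟩
    -- The Fourier coefficient at $0$ counts the isotropic vectors of $C^\perp$, and $p^e$ of them
    -- lie in $C$.
    have hcount : (∑ k, if IsDualIsotropic C k ∧ k ∉ C then (1 : ℂ) else 0) =
        s₀ - (p : ℂ) ^ e := by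
      have h2 : (∑ k, if IsDualIsotropic C k then (1 : ℂ) else 0) = s₀ := by
        have h3 := hsum (hiso (zero_mem C))
        rw [if_pos (zero_mem C)] at h3
        rw [← h3, isotropicSum]
        simp
      rw [← h2, ← sum_ite_mem_one, ← Finset.sum_sub_distrib]
      refine Finset.sum_congr rfl fun k _ => ?_
      by_cases hk : k ∈ C
      · simp [hk, hiso hk]
      · simp [hk]
    -- Double counting: a self-dual $C'\supseteq C$ occurs above $C+\langle k\rangle$ exactly for
    -- $k\in C'$, hence for $p^n-p^e$ vectors $k$ outside $C$.
    have hsup : (∑ k, if IsDualIsotropic C k ∧ k ∉ C then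
        tensorAverage p m N (codeVector m (C ⊔ Submodule.span (ZMod p) {k})) else 0) =
        (Q * ((p : ℂ) ^ n - (p : ℂ) ^ e)) • S := by
      have h2 (k : Fin N → ZMod p) : (if IsDualIsotropic C k ∧ k ∉ C then
          tensorAverage p m N (codeVector m (C ⊔ Submodule.span (ZMod p) {k})) else 0) =
          Q • ∑ C' ∈ selfDualAbove C,
            ((if k ∈ C' then (1 : ℂ) else 0) - if k ∈ C then 1 else 0) • codeVector m C' := by
        by_cases hk : k ∈ C
        · rw [if_neg (fun h => h.2 hk), Finset.sum_eq_zero, smul_zero]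
          intro C' hC'
          rw [if_pos hk, if_pos ((mem_selfDualAbove.1 hC').2 hk), sub_self, zero_smul]
        · simp only [if_neg hk, sub_zero, ite_smul, one_smul, zero_smul]
          rw [← Finset.sum_filter]
          have h3 : (selfDualAbove C).filter (fun C' => k ∈ C') =
              selfDualAbove (C ⊔ Submodule.span (ZMod p) {k}) := by
            ext C'
            rw [Finset.mem_filter, mem_selfDualAbove_sup]
          rw [h3]
          by_cases hki : IsDualIsotropic C k
          · rw [if_pos ⟨hki, hk⟩]
            refine ih _ (hC.sup_span hki.1 hki.2) (Submodule.mem_sup_left h1) ?_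
            rw [finrank_sup_span hk]
            omega
          · rw [if_neg (fun h => hki h.1), Finset.sum_eq_zero, smul_zero]
            intro C' hC'
            rw [mem_selfDualAbove_sup] at hC'
            exact absurd (isDualIsotropic_of_mem hC'.1 hC'.2) hki
      rw [Finset.sum_congr rfl fun k _ => h2 k, ← Finset.smul_sum, Finset.sum_comm, mul_smul]
      congr 1
      rw [hS, Finset.smul_sum]
      refine Finset.sum_congr rfl fun C' hC' => ?_
      rw [← Finset.sum_smul, Finset.sum_sub_distrib, sum_ite_mem_one, sum_ite_mem_one]
      have h3 := (mem_selfDualAbove.1 hC').1.two_mul_finrank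
      have h4 : Module.finrank (ZMod p) C' = n := by omega
      rw [h4]
    have hrec2 : (((p : ℂ) ^ m - 1) * (p : ℂ) ^ N) • A =
        ((p : ℂ) ^ e * (s₀ * ((p : ℂ) ^ m - 1))) • A +
          s₁ • (Q * ((p : ℂ) ^ n - (p : ℂ) ^ e)) • S - (s₁ * (s₀ - (p : ℂ) ^ e)) • A := by
      rw [hrec, ← hsup, ← hcount, he, ← sum_ite_mem_one, Finset.sum_mul, Finset.sum_smul,
        Finset.smul_sum, Finset.mul_sum, Finset.sum_smul, ← Finset.sum_add_distrib,
        ← Finset.sum_sub_distrib]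
      refine Finset.sum_congr rfl fun k _ => ?_
      by_cases hk : k ∈ C
      · simp [hk, hiso hk, hsum (hiso hk), smul_smul]
      · by_cases hki : IsDualIsotropic C k
        · simp [hk, hki, hsum hki, smul_sub]
        · simp [hk, hki]
    have hp1 : (1 : ℝ) < p := by exact_mod_cast (Fact.out : p.Prime).one_lt
    have hR0 : ((p : ℂ) ^ m + (p : ℂ) ^ r) ≠ 0 := by
      have : (0 : ℝ) < (p : ℝ) ^ m + (p : ℝ) ^ r := by positivity
      exact_mod_cast this.ne'
    have hp2 : (p : ℂ) - 1 ≠ 0 := by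
      have : (p : ℝ) - 1 ≠ 0 := (sub_pos.2 hp1).ne'
      exact_mod_cast this
    have hp3 : (p : ℂ) ^ (r + 1) - 1 ≠ 0 := by
      have : (p : ℝ) ^ (r + 1) - 1 ≠ 0 := (sub_pos.2 (one_lt_pow₀ hp1 (Nat.succ_ne_zero r))).ne'
      exact_mod_cast this
    -- This is the common factor of the equation: $p^N-p^es_0=K$, and
    -- $s_0-p^e=p^e(p^r+1)(p^{r+1}-1)$. The coefficient of the average is therefore
    -- $K(p^m-1)+K(p^r+1)=K(p^m+p^r)$.
    set K : ℂ := s₁ * (p : ℂ) ^ e * ((p : ℂ) ^ (r + 1) - 1) with hK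
    have hK0 : K ≠ 0 := mul_ne_zero (mul_ne_zero (mul_ne_zero hp2 (pow_ne_zero _ hp0))
      (pow_ne_zero _ hp0)) hp3
    have hcoef : ((p : ℂ) ^ m - 1) * (p : ℂ) ^ N - (p : ℂ) ^ e * (s₀ * ((p : ℂ) ^ m - 1)) +
        s₁ * (s₀ - (p : ℂ) ^ e) = K * ((p : ℂ) ^ m + (p : ℂ) ^ r) := by
      rw [hK, hs₀, hs₁, hN, hn]
      ring
    have hcoef2 : s₁ * (Q * ((p : ℂ) ^ n - (p : ℂ) ^ e)) = K * Q := by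
      rw [hK, hn]
      ring
    have h5 : (K * ((p : ℂ) ^ m + (p : ℂ) ^ r)) • A = (K * Q) • S := by
      rw [← hcoef, ← hcoef2, add_smul, sub_smul, hrec2, smul_smul]
      abel
    rw [mul_smul K, mul_smul K] at h5
    have h6 := smul_right_injective _ hK0 h5
    rw [Finset.prod_range_succ, mul_comm, mul_smul, ← hQ, ← h6, smul_smul, inv_mul_cancel₀ hR0,
      one_smul]

/-- The averaging formula for code vectors. -/
theorem tensorAverage_codeVector (hp : p ≠ 2) (hm : 1 ≤ m) {r : ℕ} (hC : IsSelfOrthogonal C)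
    (h1 : (fun _ => 1) ∈ C) (hr : 2 * Module.finrank (ZMod p) C + 2 * r = N) :
    tensorAverage p m N (codeVector m C) =
      (∏ i ∈ Finset.range r, ((p : ℂ) ^ m + (p : ℂ) ^ i)⁻¹) •
        ∑ C' ∈ selfDualAbove C, codeVector m C' := by
  by_cases ha : clifA p ∣ N
  · exact tensorAverage_codeVector_of_dvd hp hm (n := Module.finrank (ZMod p) C + r) (by omega) ha
      r C hC h1 rfl
  -- If $a\nmid N$ both sides vanish: no self-dual code has length $N$, and the scalars kill every
  -- average.
  · rw [selfDualAbove_eq_empty hp ha, Finset.sum_empty, smul_zero,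
      tensorAverage_eq_zero_of_not_dvd hp hm (fun h => ha ((dvd_mul_right _ _).trans h)),
      LinearMap.zero_apply]

theorem IsSelfOrthogonal.exists_codim (hp : p ≠ 2) (hC : IsSelfOrthogonal C)
    (ha : clifA p ∣ N) : ∃ r, 2 * Module.finrank (ZMod p) C + 2 * r = N := by
  obtain ⟨k, hk⟩ := (two_dvd_clifA hp).trans ha
  have h1 := Submodule.finrank_mono hC
  have h2 := finrank_dualCode (C := C)
  exact ⟨k - Module.finrank (ZMod p) C, by omega⟩

theorem tensorAverage_codeVector_eq_zero (hp : p ≠ 2) (hm : 1 ≤ m) (hC : IsSelfOrthogonal C)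
    (h1 : (fun _ => 1) ∈ C) (h : selfDualAbove C = ∅) :
    tensorAverage p m N (codeVector m C) = 0 := by
  by_cases ha : clifA p ∣ N
  · obtain ⟨r, hr⟩ := hC.exists_codim hp ha
    rw [tensorAverage_codeVector hp hm hC h1 hr, h, Finset.sum_empty, smul_zero]
  · rw [tensorAverage_eq_zero_of_not_dvd hp hm (fun h => ha ((dvd_mul_right _ _).trans h)),
      LinearMap.zero_apply]

end AveragingFormula

/-! ### Averages of basis tensors and the spanning argument. -/

section Spanning

/-- Linear maps with the same range differ by an automorphism of the source. -/
theorem exists_linearEquiv_comp_eq {K V W : Type*} [Field K] [AddCommGroup V] [Module K V]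
    [FiniteDimensional K V] [AddCommGroup W] [Module K W] {f g : V →ₗ[K] W}
    (h : LinearMap.range f = LinearMap.range g) : ∃ e : V ≃ₗ[K] V, ∀ v, g v = f (e v) := by
  obtain ⟨P, hP⟩ := Submodule.exists_isCompl (LinearMap.ker f)
  obtain ⟨R, hR⟩ := Submodule.exists_isCompl (LinearMap.ker g)
  have hker : Module.finrank K (LinearMap.ker g) = Module.finrank K (LinearMap.ker f) := by
    have h1 := LinearMap.finrank_range_add_finrank_ker f
    have h2 := LinearMap.finrank_range_add_finrank_ker g
    rw [h] at h1
    omega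
  -- The kernels have equal dimension, so any isomorphism between them will do; complements are
  -- matched through the common range.
  let α : LinearMap.ker g ≃ₗ[K] LinearMap.ker f := LinearEquiv.ofFinrankEq _ _ hker
  let β : R ≃ₗ[K] P := (g.kerComplementEquivRange hR.symm).trans
    ((LinearEquiv.ofEq _ _ h.symm).trans (f.kerComplementEquivRange hP.symm).symm)
  have hβ (v : R) : f (β v) = g v := by
    change ((f.kerComplementEquivRange hP.symm (β v) : LinearMap.range f) : W) =
      (g.kerComplementEquivRange hR.symm v : LinearMap.range g)
    simp only [β, LinearEquiv.trans_apply, LinearEquiv.apply_symm_apply]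
    rfl
  let e : V ≃ₗ[K] V := (Submodule.prodEquivOfIsCompl _ _ hR).symm.trans
    ((α.prodCongr β).trans (Submodule.prodEquivOfIsCompl _ _ hP))
  refine ⟨e, fun v => ?_⟩
  obtain ⟨⟨a, b⟩, rfl⟩ := (Submodule.prodEquivOfIsCompl _ _ hR).surjective v
  have h1 : e (Submodule.prodEquivOfIsCompl _ _ hR (a, b)) = (α a : V) + β b := by
    simp [e]
  rw [h1, map_add, hβ, LinearMap.mem_ker.1 (α a).2, zero_add, Submodule.coe_prodEquivOfIsCompl',
    map_add, LinearMap.mem_ker.1 a.2, zero_add]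

variable {p m N : ℕ} [Fact p.Prime] {C : Submodule (ZMod p) (Fin N → ZMod p)}

/-- The map from coefficient vectors to combinations of rows modulo the all-ones vector. -/
def rowMap (x : Fin N → Fin m → ZMod p) : (Fin m → ZMod p) →ₗ[ZMod p]
    (Fin N → ZMod p) ⧸ Submodule.span (ZMod p) {(fun _ => 1 : Fin N → ZMod p)} :=
  (Submodule.mkQ _).comp <| show (Fin m → ZMod p) →ₗ[ZMod p] (Fin N → ZMod p) from
    { toFun := fun b i => b ⬝ᵥ x i
      map_add' := fun b c => funext fun i => add_dotProduct b c (x i)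
      map_smul' := fun t b => funext fun i => smul_dotProduct t b (x i) }

/-- The code spanned by the rows and the all-ones vector. -/
def rowCode (x : Fin N → Fin m → ZMod p) : Submodule (ZMod p) (Fin N → ZMod p) :=
  (LinearMap.range (rowMap x)).comap (Submodule.mkQ _)

theorem mem_rowCode {x : Fin N → Fin m → ZMod p} {v : Fin N → ZMod p} :
    v ∈ rowCode x ↔ ∃ (b : Fin m → ZMod p) (t : ZMod p), v = fun i => b ⬝ᵥ x i + t := by
  rw [rowCode, Submodule.mem_comap, LinearMap.mem_range]
  have h (b : Fin m → ZMod p) : rowMap x b = (Submodule.mkQ _) v ↔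
      ∃ t : ZMod p, v = fun i => b ⬝ᵥ x i + t := by
    change (Submodule.span (ZMod p) {(fun _ => 1 : Fin N → ZMod p)}).mkQ (fun i => b ⬝ᵥ x i) =
      Submodule.mkQ _ v ↔ _
    rw [Submodule.mkQ_apply, Submodule.mkQ_apply]
    rw [eq_comm, Submodule.Quotient.eq, Submodule.mem_span_singleton]
    refine exists_congr fun t => ?_
    rw [funext_iff, funext_iff]
    refine forall_congr' fun i => ?_
    simp only [Pi.smul_apply, Pi.sub_apply, smul_eq_mul, mul_one]
    rw [eq_sub_iff_add_eq, eq_comm, add_comm]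
  simp only [h]

theorem one_mem_rowCode (x : Fin N → Fin m → ZMod p) : (fun _ => 1) ∈ rowCode x :=
  mem_rowCode.2 ⟨0, 1, by simp⟩

theorem mem_codeRows_rowCode (x : Fin N → Fin m → ZMod p) : x ∈ codeRows m (rowCode x) :=
  fun l => mem_rowCode.2 ⟨Pi.single l 1, 0, by simp⟩

theorem rowCode_le {x : Fin N → Fin m → ZMod p} (hx : x ∈ codeRows m C)
    (h1 : (fun _ => 1) ∈ C) : rowCode x ≤ C := by
  intro v hv
  obtain ⟨b, t, rfl⟩ := mem_rowCode.1 hv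
  have h2 := C.add_mem (dotProduct_mem_of_mem_codeRows hx b) (C.smul_mem t h1)
  convert h2 using 1
  ext i
  simp

/-- The average of a basis tensor depends only on the row code. -/
theorem tensorAverage_single_congr (hp : p ≠ 2) (hm : 1 ≤ m) {x y : Fin N → Fin m → ZMod p}
    (h : rowCode x = rowCode y) :
    tensorAverage p m N (Pi.single y 1) = tensorAverage p m N (Pi.single x 1) := by
  have hrange : LinearMap.range (rowMap x) = LinearMap.range (rowMap y) :=
    Submodule.comap_injective_of_surjective (Submodule.mkQ_surjective _) h
  obtain ⟨e, he⟩ := exists_linearEquiv_comp_eq hrange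
  have h1 (l : Fin m) : ∃ t : ZMod p, ∀ i, y i l = e (Pi.single l 1) ⬝ᵥ x i + t := by
    have h2 := he (Pi.single l 1)
    change (Submodule.span (ZMod p) {(fun _ => 1 : Fin N → ZMod p)}).mkQ
        (fun i => (Pi.single l 1 : Fin m → ZMod p) ⬝ᵥ y i) =
      Submodule.mkQ _ (fun i => e (Pi.single l 1) ⬝ᵥ x i) at h2
    rw [Submodule.mkQ_apply, Submodule.mkQ_apply, Submodule.Quotient.eq, Submodule.mem_span_singleton] at h2
    obtain ⟨t, ht⟩ := h2
    refine ⟨t, fun i => ?_⟩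
    have := congrFun ht i
    simp only [Pi.smul_apply, Pi.sub_apply, smul_eq_mul, mul_one, single_dotProduct, one_mul] at this
    rw [this]
    ring
  choose t ht using h1
  let E : Matrix (Fin m) (Fin m) (ZMod p) := (LinearMap.toMatrix' (e : (Fin m → ZMod p) →ₗ[ZMod p] _))
  have hE : IsUnit Eᵀ := by
    rw [Matrix.isUnit_transpose, Matrix.isUnit_iff_isUnit_det, LinearMap.det_toMatrix']
    exact e.isUnit_det'
  obtain ⟨g, hg⟩ := hE
  -- Equal row codes mean that $x$ and $y$ differ by an invertible recombination of rows and
  -- multiples of $\mathbf 1$, that is, by an affine map of $\mathbb F_p^m$. The Clifford group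
  -- contains the corresponding permutation operators.
  have hy : y = fun i => g.1 *ᵥ x i + t := by
    ext i l
    rw [ht l i, Pi.add_apply, hg, Matrix.mulVec_transpose]
    congr 1
    change _ = x i ⬝ᵥ (fun j => E j l)
    rw [dotProduct_comm]
    congr 1
  rw [hy, tensorAverage_single_add hp hm (fun i => g.1 *ᵥ x i), tensorAverage_single_mulVec hp hm]

/-- Clock operators force the rows to be orthogonal to $\mathbf 1$, diagonal transvections force all
row combinations to have norm zero, and polarization with $p$ odd gives the inner products. The norm
of $\mathbf 1$ vanishes because $p\mid N$. -/
theorem isSelfOrthogonal_rowCode (hp : p ≠ 2) (hm : 1 ≤ m) (hN : p ∣ N)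
    {x : Fin N → Fin m → ZMod p} (hx : tensorAverage p m N (Pi.single x 1) ≠ 0) :
    IsSelfOrthogonal (rowCode x) := by
  have h2 := two_ne_zero_zmod hp
  have hsum (l : Fin m) : ∑ i, x i l = 0 := by
    by_contra h
    exact hx (tensorAverage_single_eq_zero_of_sum_ne hp hm h)
  have hnorm (b : Fin m → ZMod p) : (fun i => b ⬝ᵥ x i) ⬝ᵥ (fun i => b ⬝ᵥ x i) = 0 := by
    by_contra h
    exact hx (tensorAverage_single_eq_zero_of_norm_ne hp hm h)
  have hinner (b c : Fin m → ZMod p) : (fun i => b ⬝ᵥ x i) ⬝ᵥ (fun i => c ⬝ᵥ x i) = 0 := by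
    have h3 := hnorm (b + c)
    have h4 : (fun i => (b + c) ⬝ᵥ x i) = (fun i => b ⬝ᵥ x i) + fun i => c ⬝ᵥ x i :=
      funext fun i => add_dotProduct b c (x i)
    rw [h4] at h3
    simp only [add_dotProduct, dotProduct_add] at h3
    rw [hnorm b, hnorm c, dotProduct_comm (fun i => c ⬝ᵥ x i)] at h3
    have h5 : 2 * ((fun i => b ⬝ᵥ x i) ⬝ᵥ (fun i => c ⬝ᵥ x i)) = 0 := by linear_combination h3
    exact (mul_eq_zero.1 h5).resolve_left h2
  have hone (b : Fin m → ZMod p) : ∑ i, b ⬝ᵥ x i = 0 := by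
    simp only [dotProduct]
    rw [Finset.sum_comm]
    refine Finset.sum_eq_zero fun l _ => ?_
    rw [← Finset.mul_sum, hsum, mul_zero]
  intro v hv w hw
  obtain ⟨b, s, rfl⟩ := mem_rowCode.1 hv
  obtain ⟨c, t, rfl⟩ := mem_rowCode.1 hw
  have h3 := hinner c b
  rw [dotProduct] at h3 ⊢
  have h4 : ∀ i, (c ⬝ᵥ x i + t) * (b ⬝ᵥ x i + s) = (c ⬝ᵥ x i) * (b ⬝ᵥ x i) + t * (b ⬝ᵥ x i) +
      s * (c ⬝ᵥ x i) + t * s := fun i => by ring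
  rw [Finset.sum_congr rfl fun i _ => h4 i]
  simp only [Finset.sum_add_distrib]
  rw [h3, ← Finset.mul_sum, ← Finset.mul_sum, hone, hone, Finset.sum_const, Finset.card_univ,
    Fintype.card_fin, nsmul_eq_mul, (ZMod.natCast_eq_zero_iff N p).2 hN]
  ring

/-- The span of the code vectors of the self-dual codes containing the all-ones vector. -/
def selfDualSpan (p m N : ℕ) [Fact p.Prime] : Submodule ℂ ((Fin N → Fin m → ZMod p) → ℂ) :=
  Submodule.span ℂ {φ | ∃ C : Submodule (ZMod p) (Fin N → ZMod p),
    IsSelfDual C ∧ (fun _ => 1) ∈ C ∧ φ = codeVector m C}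

theorem tensorAverage_codeVector_mem (hp : p ≠ 2) (hm : 1 ≤ m) (hC : IsSelfOrthogonal C)
    (h1 : (fun _ => 1) ∈ C) (ha : clifA p ∣ N) :
    tensorAverage p m N (codeVector m C) ∈ selfDualSpan p m N := by
  obtain ⟨r, hr⟩ := hC.exists_codim hp ha
  rw [tensorAverage_codeVector hp hm hC h1 hr]
  refine Submodule.smul_mem _ _ (sum_mem fun C' hC' => Submodule.subset_span ?_)
  rw [mem_selfDualAbove] at hC'
  exact ⟨C', hC'.1, hC'.2 h1, rfl⟩

/-- A triangular inversion: in the average of the code vector of `rowCode x`, the words generating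
the same code all contribute the average of $v_x$, and the other words generate smaller codes
covered by induction. -/
theorem tensorAverage_single_mem (hp : p ≠ 2) (hm : 1 ≤ m) (x : Fin N → Fin m → ZMod p) :
    tensorAverage p m N (Pi.single x 1) ∈ selfDualSpan p m N := by
  by_cases hN : clifA p * p ∣ N
  swap
  · rw [tensorAverage_eq_zero_of_not_dvd hp hm hN]
    exact zero_mem _
  induction hn : Module.finrank (ZMod p) (rowCode x) using Nat.strong_induction_on
    generalizing x with
  | _ n ih =>
  by_cases hx : tensorAverage p m N (Pi.single x 1) = 0
  · rw [hx]
    exact zero_mem _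
  have hC := isSelfOrthogonal_rowCode hp hm ((dvd_mul_left _ _).trans hN) hx
  have hmem := tensorAverage_codeVector_mem hp hm hC (one_mem_rowCode x)
    ((dvd_mul_right _ _).trans hN)
  rw [tensorAverage_eq_sum, ← Finset.sum_filter_add_sum_filter_not _
    (fun y => y ∈ codeRows m (rowCode x) ∧ rowCode y = rowCode x)] at hmem
  have h1 : ∑ y with ¬ (y ∈ codeRows m (rowCode x) ∧ rowCode y = rowCode x),
      codeVector m (rowCode x) y • tensorAverage p m N (Pi.single y 1) ∈ selfDualSpan p m N := by
    refine sum_mem fun y hy => ?_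
    rw [Finset.mem_filter] at hy
    by_cases hy1 : y ∈ codeRows m (rowCode x)
    · have hlt : rowCode y < rowCode x :=
        lt_of_le_of_ne (rowCode_le hy1 (one_mem_rowCode x)) fun h => hy.2 ⟨hy1, h⟩
      refine Submodule.smul_mem _ _ (ih _ ?_ y rfl)
      rw [← hn]
      exact Submodule.finrank_lt_finrank_of_lt hlt
    · rw [codeVector, if_neg hy1, zero_smul]
      exact zero_mem _
  rw [Submodule.add_mem_iff_left _ h1] at hmem
  have h2 : ∑ y with y ∈ codeRows m (rowCode x) ∧ rowCode y = rowCode x,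
      codeVector m (rowCode x) y • tensorAverage p m N (Pi.single y 1) =
      ((Finset.univ.filter fun y => y ∈ codeRows m (rowCode x) ∧
        rowCode y = rowCode x).card : ℂ) • tensorAverage p m N (Pi.single x 1) := by
    rw [Nat.cast_smul_eq_nsmul, ← Finset.sum_const]
    refine Finset.sum_congr rfl fun y hy => ?_
    rw [Finset.mem_filter] at hy
    rw [codeVector, if_pos hy.2.1, one_smul, tensorAverage_single_congr hp hm hy.2.2.symm]
  rw [h2] at hmem
  -- The multiplicity is nonzero because $x$ itself is among the words counted.
  refine (Submodule.smul_mem_iff _ (Nat.cast_ne_zero.2 (Finset.card_pos.2 ⟨x, ?_⟩).ne')).1 hmem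
  rw [Finset.mem_filter]
  exact ⟨Finset.mem_univ _, mem_codeRows_rowCode x, rfl⟩

theorem tensorAverage_mem (hp : p ≠ 2) (hm : 1 ≤ m) (φ : (Fin N → Fin m → ZMod p) → ℂ) :
    tensorAverage p m N φ ∈ selfDualSpan p m N := by
  rw [tensorAverage_eq_sum]
  exact sum_mem fun x _ => Submodule.smul_mem _ _ (tensorAverage_single_mem hp hm x)

end Spanning

/-! ### From tensors to polynomials, and the final statements. -/

section Polynomials

variable {p m N : ℕ} [Fact p.Prime] {F : Type*} [Field F] [Algebra (ZMod p) F]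
  (b : Module.Basis (Fin m) (ZMod p) F)

/-- The image of a tensor in the symmetric power: the polynomial
`∑ x, φ x * ∏ i, X_{x i}`. -/
def tensorPoly : ((Fin N → Fin m → ZMod p) → ℂ) →ₗ[ℂ] MvPolynomial F ℂ :=
  Fintype.linearCombination ℂ fun x => ∏ i, MvPolynomial.X (b.equivFun.symm (x i))

theorem tensorPoly_apply (φ : (Fin N → Fin m → ZMod p) → ℂ) :
    tensorPoly b φ = ∑ x, φ x • ∏ i, MvPolynomial.X (b.equivFun.symm (x i)) := rfl

theorem tensorPoly_isHomogeneous (φ : (Fin N → Fin m → ZMod p) → ℂ) :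
    (tensorPoly b φ).IsHomogeneous N := by
  refine (MvPolynomial.homogeneousSubmodule F ℂ N).sum_mem fun x _ =>
    (MvPolynomial.homogeneousSubmodule F ℂ N).smul_mem _ ?_
  have := MvPolynomial.IsHomogeneous.prod Finset.univ
    (fun i : Fin N => (MvPolynomial.X (b.equivFun.symm (x i)) : MvPolynomial F ℂ)) (fun _ => 1)
    fun i _ => MvPolynomial.isHomogeneous_X ℂ _
  simpa using this

theorem exists_tensorPoly_eq {q : MvPolynomial F ℂ} (hq : q.IsHomogeneous N) :
    ∃ φ : (Fin N → Fin m → ZMod p) → ℂ, q = tensorPoly b φ := by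
  suffices q ∈ LinearMap.range (tensorPoly (N := N) b) by
    obtain ⟨φ, h⟩ := this
    exact ⟨φ, h.symm⟩
  rw [q.as_sum]
  refine sum_mem fun d hd => ?_
  have hcard : d.toMultiset.card = N := by
    rw [Finsupp.card_toMultiset]
    have h := hq (MvPolynomial.mem_support_iff.1 hd)
    simp only [Finsupp.weight_apply, Pi.one_apply, smul_eq_mul, mul_one] at h
    exact h
  -- Any ordering of the variables of a monomial gives a basis tensor above it.
  obtain ⟨l, hl⟩ := Quot.exists_rep d.toMultiset
  have hlen : l.length = N := by rw [← hcard, ← hl]; rfl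
  subst hlen
  refine ⟨Pi.single (fun i => b.equivFun (l.get i)) (q.coeff d), ?_⟩
  rw [tensorPoly_apply, Finset.sum_eq_single (fun i => b.equivFun (l.get i))]
  · rw [Pi.single_eq_same]
    simp only [LinearEquiv.symm_apply_apply]
    have h1 : ∏ i, (MvPolynomial.X (l.get i) : MvPolynomial F ℂ) = (l.map MvPolynomial.X).prod := by
      rw [← List.prod_ofFn]
      congr 1
      rw [← Function.comp_def MvPolynomial.X, ← List.map_ofFn, List.ofFn_get]
    have h2 : (l.map (MvPolynomial.X : F → MvPolynomial F ℂ)).prod =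
        (d.toMultiset.map MvPolynomial.X).prod := by
      rw [← hl]
      rfl
    rw [h1, h2, Finsupp.toMultiset_map, Finsupp.prod_toMultiset, MvPolynomial.monomial_eq,
      MvPolynomial.smul_eq_C_mul]
    rw [Finsupp.prod_mapDomain_index pow_zero pow_add]
  · intro x _ hx
    rw [Pi.single_eq_of_ne hx, zero_smul]
  · simp

/-- Multiplication by an element of $F$ acts on coordinates by a matrix over $\mathbb F_p$, hence
only recombines rows within $C$; conversely a word is recovered from its rows as a combination with
the basis elements as coefficients. -/
theorem mem_extendCode_iff {C : Submodule (ZMod p) (Fin N → ZMod p)} {c : Fin N → F} :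
    c ∈ extendCode F C ↔ (fun i => b.equivFun (c i)) ∈ codeRows m C := by
  constructor
  · intro hc
    induction hc using Submodule.span_induction with
    | mem c hc =>
      obtain ⟨v, hv, rfl⟩ := hc
      intro l
      have h : (fun i => b.equivFun (algebraMap (ZMod p) F (v i)) l) = b.equivFun 1 l • v := by
        ext i
        rw [Algebra.algebraMap_eq_smul_one, map_smul, Pi.smul_apply, Pi.smul_apply, smul_eq_mul,
          smul_eq_mul, mul_comm]
      change (fun i => b.equivFun (algebraMap (ZMod p) F (v i)) l) ∈ C
      rw [h]
      exact C.smul_mem _ hv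
    | zero =>
      convert (codeRows m C).zero_mem
      simp
    | add c d _ _ hc hd =>
      convert (codeRows m C).add_mem hc hd
      simp
    | smul t c _ hc =>
      intro l
      have h : (fun i => b.equivFun ((t • c) i) l) =
          fun i => (fun j => b.equivFun (t * b j) l) ⬝ᵥ b.equivFun (c i) := by
        ext i
        conv_lhs => rw [Pi.smul_apply, smul_eq_mul, ← b.sum_equivFun (c i), Finset.mul_sum, map_sum,
          Finset.sum_apply]
        refine Finset.sum_congr rfl fun j _ => ?_
        rw [mul_smul_comm, map_smul, Pi.smul_apply, smul_eq_mul, mul_comm]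
      change (fun i => b.equivFun ((t • c) i) l) ∈ C
      rw [h]
      exact dotProduct_mem_of_mem_codeRows hc _
  · intro hc
    have h : c = ∑ l, b l • fun i => algebraMap (ZMod p) F (b.equivFun (c i) l) := by
      ext i
      rw [Finset.sum_apply]
      conv_lhs => rw [← b.sum_equivFun (c i)]
      refine Finset.sum_congr rfl fun l _ => ?_
      rw [Pi.smul_apply, smul_eq_mul, Algebra.smul_def, mul_comm]
    rw [h]
    exact sum_mem fun l _ => Submodule.smul_mem _ _ (Submodule.subset_span ⟨_, hc l, rfl⟩)

variable [Fintype F]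

/-- Symmetrization intertwines the diagonal action on tensors with the substitution action, so
averages and invariance transfer to polynomials. -/
theorem polyAct_tensorPoly (g : Matrix (Fin m → ZMod p) (Fin m → ZMod p) ℂ)
    (φ : (Fin N → Fin m → ZMod p) → ℂ) :
    polyAct b g (tensorPoly b φ) = tensorPoly b (tensorPow N g *ᵥ φ) := by
  have h (x : Fin m → ZMod p) : polyAct b g (MvPolynomial.X (b.equivFun.symm x)) =
      ∑ y, g y x • MvPolynomial.X (b.equivFun.symm y) := by
    rw [polyAct, MvPolynomial.aeval_X, ← b.equivFun.symm.toEquiv.sum_comp]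
    simp only [LinearEquiv.coe_toEquiv, LinearEquiv.apply_symm_apply]
  simp only [tensorPoly_apply, map_sum, map_smul, map_prod, h, Finset.prod_univ_sum,
    Fintype.piFinset_univ, mulVec, dotProduct, Finset.sum_smul, Finset.smul_sum]
  rw [Finset.sum_comm]
  refine Finset.sum_congr rfl fun y _ => Finset.sum_congr rfl fun x _ => ?_
  rw [Finset.prod_smul, smul_smul, mul_comm]
  rfl

theorem average_tensorPoly (hp : p ≠ 2) (hm : 1 ≤ m) (φ : (Fin N → Fin m → ZMod p) → ℂ) :
    average b (tensorPoly b φ) = tensorPoly b (tensorAverage p m N φ) := by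
  have := finite_cliffordGroup (p := p) (m := m) hp hm
  have := Fintype.ofFinite (cliffordGroup p m)
  rw [average, finsum_eq_sum_of_fintype, tensorAverage_apply, map_smul, map_sum]
  simp only [polyAct_tensorPoly]

theorem average_of_mem_invariants (hp : p ≠ 2) (hm : 1 ≤ m) {q : MvPolynomial F ℂ}
    (hq : q ∈ invariants b N) : average b q = q := by
  have := finite_cliffordGroup (p := p) (m := m) hp hm
  have := Fintype.ofFinite (cliffordGroup p m)
  rw [average, finsum_eq_sum_of_fintype, Finset.sum_congr rfl fun (g : cliffordGroup p m) _ => hq.2 g.1 g.2,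
    Finset.sum_const, Finset.card_univ, ← Nat.card_eq_fintype_card, ← Nat.cast_smul_eq_nsmul ℂ,
    smul_smul, inv_mul_cancel₀ (Nat.cast_ne_zero.2 Nat.card_pos.ne'), one_smul]

theorem cwe_extendCode (C : Submodule (ZMod p) (Fin N → ZMod p)) :
    cwe (extendCode F C) = tensorPoly b (codeVector m C) := by
  have h (c : Fin N → F) : ∏ f : F, (MvPolynomial.X f : MvPolynomial F ℂ) ^
      (Finset.univ.filter fun i => c i = f).card = ∏ i, MvPolynomial.X (c i) := by
    rw [← Finset.prod_fiberwise_of_maps_to (t := Finset.univ) (g := c) fun i _ => Finset.mem_univ _]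
    refine Finset.prod_congr rfl fun f _ => ?_
    rw [Finset.prod_congr rfl fun i hi => congrArg _ (Finset.mem_filter.1 hi).2, Finset.prod_const]
  rw [cwe, tensorPoly_apply, Finset.sum_filter]
  refine Fintype.sum_equiv (Equiv.piCongrRight fun _ => b.equivFun.toEquiv) _ _ fun c => ?_
  rw [h]
  have h2 : (Equiv.piCongrRight fun _ : Fin N => b.equivFun.toEquiv) c =
      fun i => b.equivFun (c i) := rfl
  simp only [h2, codeVector, ← mem_extendCode_iff, LinearEquiv.symm_apply_apply, ite_smul, one_smul,
    zero_smul]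

/-- An invariant polynomial equals its average, and it lifts to a tensor that need not be invariant;
the average of that tensor lies in the span of code vectors. -/
theorem invariants_eq_span (hp : p ≠ 2) (hm : 1 ≤ m) (N : ℕ) : invariants b N =
    Submodule.span ℂ {q | ∃ C : Submodule (ZMod p) (Fin N → ZMod p),
      IsSelfDual C ∧ (fun _ => 1) ∈ C ∧ q = cwe (extendCode F C)} := by
  refine le_antisymm (fun q hq => ?_) (Submodule.span_le.2 ?_)
  · obtain ⟨φ, rfl⟩ := exists_tensorPoly_eq b hq.1
    rw [← average_of_mem_invariants b hp hm hq, average_tensorPoly b hp hm]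
    refine (Submodule.map_span_le _ _ _).2 ?_ (Submodule.mem_map_of_mem (tensorAverage_mem hp hm φ))
    rintro _ ⟨C, hC, h1, rfl⟩
    exact Submodule.subset_span ⟨C, hC, h1, (cwe_extendCode b C).symm⟩
  · rintro _ ⟨C, hC, h1, rfl⟩
    rw [cwe_extendCode b]
    refine ⟨tensorPoly_isHomogeneous b _, fun g hg => ?_⟩
    rw [polyAct_tensorPoly, tensorPow_codeVector hp hm hC h1 hg]

theorem average_cwe (hp : p ≠ 2) (hm : 1 ≤ m) {r : ℕ} {C : Submodule (ZMod p) (Fin N → ZMod p)}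
    (hC : IsSelfOrthogonal C) (h1 : (fun _ => 1) ∈ C)
    (hr : (Module.finrank (ZMod p) C : ℚ) = N / 2 - r) :
    average b (cwe (extendCode F C)) =
      (∏ i ∈ Finset.range r, ((p : ℂ) ^ m + (p : ℂ) ^ i)⁻¹) •
        ∑ᶠ (C' : Submodule (ZMod p) (Fin N → ZMod p)) (_ : IsSelfDual C' ∧ C ≤ C'),
          cwe (extendCode F C') := by
  -- The division is rational, so the dimension hypothesis includes the evenness of $N$.
  have hr' : 2 * Module.finrank (ZMod p) C + 2 * r = N := by
    have : (2 : ℚ) * Module.finrank (ZMod p) C + 2 * r = N := by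
      rw [hr]
      ring
    exact_mod_cast this
  rw [cwe_extendCode b, average_tensorPoly b hp hm, tensorAverage_codeVector hp hm hC h1 hr',
    map_smul, map_sum]
  congr 1
  simp only [← cwe_extendCode b]
  exact (finsum_mem_eq_finite_toFinset_sum _
    (Set.toFinite {C' | IsSelfDual C' ∧ C ≤ C'})).symm

theorem average_cwe_eq_zero (hp : p ≠ 2) (hm : 1 ≤ m)
    {C : Submodule (ZMod p) (Fin N → ZMod p)} (hC : IsSelfOrthogonal C) (h1 : (fun _ => 1) ∈ C)
    (h : ¬ ∃ C' : Submodule (ZMod p) (Fin N → ZMod p), IsSelfDual C' ∧ C ≤ C') :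
    average b (cwe (extendCode F C)) = 0 := by
  rw [cwe_extendCode b, average_tensorPoly b hp hm, tensorAverage_codeVector_eq_zero hp hm hC h1,
    map_zero]
  exact Finset.eq_empty_of_forall_notMem fun C' hC' => h ⟨C', mem_selfDualAbove.1 hC'⟩

end Polynomials

end CliffordCode

end

theorem mainTheorem10 (p : ℕ) [Fact p.Prime] (hp : p ≠ 2) (m : ℕ) (hm : 1 ≤ m)
    (F : Type*) [Field F] [Fintype F] [Algebra (ZMod p) F]
    (b : Module.Basis (Fin m) (ZMod p) F) :
    -- the structure of the Clifford group: it is finite, and `Z_a × p^{1+2m}_+ . Sp(2m, p)`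
    Finite (CliffordCode.cliffordGroup p m) ∧
    CliffordCode.IsExtraspecialPlus p m (CliffordCode.extraspecialGroup p m) ∧
    (∃ (H : Subgroup (Matrix.unitaryGroup (Fin m → ZMod p) ℂ))
        (_ : ((CliffordCode.extraspecialGroup p m).subgroupOf H).Normal),
      CliffordCode.extraspecialGroup p m ≤ H ∧ H ≤ CliffordCode.cliffordGroup p m ∧
      Nonempty (H ⧸ (CliffordCode.extraspecialGroup p m).subgroupOf H ≃*
        Matrix.symplecticGroup (Fin m) (ZMod p)) ∧
      Nonempty (CliffordCode.cliffordGroup p m ≃*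
        Multiplicative (ZMod (CliffordCode.clifA p)) × H)) ∧
    -- the invariants of degree `N` are spanned by the complete weight enumerators
    (∀ N : ℕ, CliffordCode.invariants b N =
      Submodule.span ℂ {q | ∃ C : Submodule (ZMod p) (Fin N → ZMod p),
        CliffordCode.IsSelfDual C ∧ (fun _ => 1) ∈ C ∧
        q = CliffordCode.cwe (CliffordCode.extendCode F C)}) ∧
    -- the averaging formula
    (∀ (N r : ℕ) (C : Submodule (ZMod p) (Fin N → ZMod p)),
      CliffordCode.IsSelfOrthogonal C → (fun _ => 1) ∈ C →
      (Module.finrank (ZMod p) C : ℚ) = N / 2 - r →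
      CliffordCode.average b (CliffordCode.cwe (CliffordCode.extendCode F C)) =
        (∏ i ∈ Finset.range r, ((p : ℂ) ^ m + (p : ℂ) ^ i)⁻¹) •
          ∑ᶠ (C' : Submodule (ZMod p) (Fin N → ZMod p))
            (_ : CliffordCode.IsSelfDual C' ∧ C ≤ C'),
            CliffordCode.cwe (CliffordCode.extendCode F C')) ∧
    -- and the average is zero if no self-dual code contains `C`
    (∀ (N : ℕ) (C : Submodule (ZMod p) (Fin N → ZMod p)),
      CliffordCode.IsSelfOrthogonal C → (fun _ => 1) ∈ C →
      (¬ ∃ C' : Submodule (ZMod p) (Fin N → ZMod p), CliffordCode.IsSelfDual C' ∧ C ≤ C') →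
      CliffordCode.average b (CliffordCode.cwe (CliffordCode.extendCode F C)) = 0) :=
  ⟨CliffordCode.finite_cliffordGroup hp hm, CliffordCode.isExtraspecialPlus hp hm,
    CliffordCode.cliffordGroup_structure hp hm, CliffordCode.invariants_eq_span b hp hm,
    fun _ _ _ hC h1 hr => CliffordCode.average_cwe b hp hm hC h1 hr,
    fun _ _ hC h1 h => CliffordCode.average_cwe_eq_zero b hp hm hC h1 h⟩
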